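/- Let $d\ge 1$ and $\lambda_1,\dots,\lambda_d\in\mathbf C$, let $\gamma(s)=\prod_{j=1}^d\Gamma\left(\frac{s+\lambda_j}{2}\right)$, and for $t>0$ let $$\phi(t)=\frac1{2\pi i}\int_{\sigma-i\infty}^{\sigma+i\infty}\gamma(s)t^{-s}\,ds\qquad(\sigma>\max_j(-\operatorname{Re}\lambda_j))$$ be the inverse Mellin transform of $\gamma$. For $s\in\mathbf C$ and $t>0$ put $G_s(t)=t^{-s}\int_t^\infty\phi(x)x^s\frac{dx}{x}$; this integral converges absolutely and is an entire function of $s$. Let $S_m$ be the $m$-th elementary symmetric function of $\lambda_1,\dots,\lambda_d$, let $\kappa=(1-d+S_1)/2$, and let $$\tilde S_m=\sum_{k=0}^m(-S_1)^k d^{\,m-1-k}\binom{k+d-m}{k}S_{m-k}\quad(0\le m\le d),\qquad \tilde S_{d+1}=0.$$ Let $\Delta_k(x)\in\mathbf Q[x]$ be defined by $\left(\frac{\sinh t}{t}\right)^x=\sum_{k\ge0}\Delta_k(x)t^{2k}$. For $1\le p\le d+1$ let $\nu_p$ be the polynomial $$\nu_p(n)=-\frac{d}{(2d)^p}\sum_{m=0}^p\tilde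 S_m\prod_{j=m}^{p-1}(d-j)\sum_{k=0}^{\lfloor (p-m)/2\rfloor}\frac{(2n-p+1)^{p-m-2k}}{(p-m-2k)!}\,\Delta_k(d-p).$$ All asymptotic expansions below are meant in the sense of Poincaré, for real $t\to\infty$ (with the other parameters fixed). (a) There is an asymptotic expansion $$\phi(t^{d/2})\sim\frac{2(2\pi)^{(d-1)/2}}{\sqrt d}\,e^{-dt}\,t^{\kappa}\sum_{n=0}^\infty M_nt^{-n},$$ and its coefficients satisfy, with $M_n=0$ for $n<0$, $$M_0=1,\qquad M_n=\frac1n\sum_{p=1}^d\nu_{p+1}(n)M_{n-p}\quad(n\ge1).$$ (b) For every $s\in\mathbf C$ there is an asymptotic expansion $$G_s(t^{d/2})\sim\frac{(2\pi)^{(d-1)/2}}{\sqrt d}\,e^{-dt}\,t^{\kappa-1}\sum_{n=0}^\infty\mu_n(s)t^{-n},$$ and its coefficients satisfy, with $\mu_n=0$ for $n<0$, $\mu_0=1$ and $$\mu_n=\frac1n\sum_{p=1}^d\left(\nu_{p+1}(n)-\frac{S_1+d(s-1)-2(n-p)-1}{2d}\,\nu_p(n)\right)\mu_{n-p}\quad(n\ge1).$$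 (c) For every $n\ge0$, $\mu_n(s)$ is a polynomial in $s$ of degree $n$ with leading term $2^{-n}s^n$, and for every integer $k\ge0$ and every $s\in\mathbf C$ $$\frac{\partial^k}{\partial s^k}G_s(t^{d/2})\sim\frac{(2\pi)^{(d-1)/2}}{\sqrt d}\,e^{-dt}\,t^{\kappa-1-k}\sum_{n=0}^\infty\frac{\partial^k\mu_{n+k}(s)}{\partial s^k}\,t^{-n}.$$ -/

import Mathlib

noncomputable section

namespace MotivicL

open Filter Asymptotics MeasureTheory

/-! ### The Gamma factor and the associated special functions -/

/-- The Gamma factor `γ(s) = ∏_j Γ((s + λ_j)/2)`. -/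
def gammaFactor {d : ℕ} (lam : Fin d → ℂ) (s : ℂ) : ℂ :=
  ∏ j, Complex.Gamma ((s + lam j) / 2)

/-- The inverse Mellin transform `φ(t) = (1/2πi) ∫_{σ-i∞}^{σ+i∞} γ(s) t^{-s} ds` of the Gamma
factor along the vertical line `Re s = σ`. The line has to lie to the right of the poles
of `γ`. -/
def phi {d : ℕ} (lam : Fin d → ℂ) (σ : ℝ) (t : ℝ) : ℂ :=
  mellinInv σ (gammaFactor lam) t

/-- The integrand `φ(x) x^s / x` of the incomplete Mellin transform. -/
def incompleteIntegrand {d : ℕ} (lam : Fin d → ℂ) (σ : ℝ) (s : ℂ) (x : ℝ) : ℂ :=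
  phi lam σ x * (x : ℂ) ^ s / (x : ℂ)

/-- `G_s(t) = t^{-s} ∫_t^∞ φ(x) x^s dx/x`. -/
def G {d : ℕ} (lam : Fin d → ℂ) (σ : ℝ) (s : ℂ) (t : ℝ) : ℂ :=
  (t : ℂ) ^ (-s) * ∫ x in Set.Ioi t, incompleteIntegrand lam σ s x

/-! ### Asymptotic expansions at infinity -/

/-- Poincaré asymptotic expansion `f(t) ∼ g(t) ∑_{n ≥ 0} a_n t^{-n}` as `t → ∞`. -/
def HasAsymptoticExpansion (f g : ℝ → ℂ) (a : ℕ → ℂ) : Prop :=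
  ∀ N : ℕ,
    (fun t : ℝ => f t - g t * ∑ n ∈ Finset.range N, a n * (t : ℂ) ^ (-(n : ℤ)))
      =O[atTop] (fun t : ℝ => g t * (t : ℂ) ^ (-(N : ℤ)))

/-- `κ = (1 - d + ∑_j λ_j)/2`. -/
def kappa {d : ℕ} (lam : Fin d → ℂ) : ℂ := (1 - (d : ℂ) + ∑ j, lam j) / 2

/-- The constant `(2π)^{(d-1)/2} / √d`. -/
def asympConst (d : ℕ) : ℝ := (2 * Real.pi) ^ (((d : ℝ) - 1) / 2) / Real.sqrt d

/-- The function `t ↦ (2π)^{(d-1)/2} d^{-1/2} e^{-dt} t^α`. -/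
def leadingTerm (d : ℕ) (α : ℂ) (t : ℝ) : ℂ :=
  (asympConst d : ℂ) * Complex.exp (-((d : ℂ) * (t : ℂ))) * (t : ℂ) ^ α

/-! ### Symmetric functions -/

/-- The elementary symmetric function `S_m(λ_1, …, λ_d)`. -/
def symS {d : ℕ} (lam : Fin d → ℂ) (m : ℕ) : ℂ :=
  ((Finset.univ : Finset (Fin d)).val.map lam).esymm m

/-- The modified symmetric functions
`S̃_m = ∑_{k=0}^m (-S_1)^k d^{m-1-k} C(k+d-m, k) S_{m-k}` for `m ≤ d`, and zero for `m > d`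
(only `m = d + 1` is ever used). -/
def symStilde {d : ℕ} (lam : Fin d → ℂ) (m : ℕ) : ℂ :=
  if m ≤ d then
    ∑ k ∈ Finset.range (m + 1),
      (-symS lam 1) ^ k * (d : ℂ) ^ ((m : ℤ) - 1 - (k : ℤ))
        * ((k + d - m).choose k : ℂ) * symS lam (m - k)
  else 0

/-! ### The polynomials `Δ_k` -/

/-- The power series `sinh t / t = ∑_i t^{2i} / (2i+1)!`. -/
def sinhDiv : PowerSeries ℚ :=
  PowerSeries.mk fun n => if Even n then (1 : ℚ) / ((n + 1).factorial : ℚ) else 0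

/-- `Δ_k(x) ∈ ℚ[x]`, the coefficient of `t^{2k}` in
`(sinh t / t)^x = ∑_j C(x, j) (sinh t / t - 1)^j`. Here `C(x, j) = x(x-1)⋯(x-j+1)/j!`; the
terms with `j > k` do not contribute, as `sinh t / t - 1` is divisible by `t^2`. -/
def Delta (k : ℕ) : Polynomial ℚ :=
  ∑ j ∈ Finset.range (k + 1),
    Polynomial.C (PowerSeries.coeff (2 * k) ((sinhDiv - 1) ^ j) / (j.factorial : ℚ))
      * descPochhammer ℚ j

lemma coeff_sinhDiv_sub_one_pow (j n : ℕ) (h : n < 2 * j) :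
    PowerSeries.coeff n ((sinhDiv - 1) ^ j) = 0 := by
  have h2 : (PowerSeries.X : PowerSeries ℚ) ^ 2 ∣ sinhDiv - 1 := by
    rw [PowerSeries.X_pow_dvd_iff]
    intro m hm
    interval_cases m <;> simp [sinhDiv, PowerSeries.coeff_one]
  have h3 := pow_dvd_pow_of_dvd h2 j
  rw [← pow_mul, PowerSeries.X_pow_dvd_iff] at h3
  exact h3 n h

/-- The generating function of the `Δ_k` at a natural number `m`:
`(sinh t / t)^m = ∑_k Δ_k(m) t^{2k}`. -/
theorem sinhDiv_pow (m : ℕ) :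
    sinhDiv ^ m =
      PowerSeries.mk fun n => if Even n then (Delta (n / 2)).eval (m : ℚ) else 0 := by
  ext n
  rw [PowerSeries.coeff_mk]
  split_ifs with hn
  · obtain ⟨k, rfl⟩ := hn.exists_two_nsmul
    simp only [smul_eq_mul]
    have hk : 2 * k / 2 = k := by omega
    rw [hk]
    have e : sinhDiv = (sinhDiv - 1) + 1 := by ring
    have key : ∀ j : ℕ, PowerSeries.coeff (2 * k) ((sinhDiv - 1) ^ j * 1 ^ (m - j)
        * ((m.choose j : ℕ) : PowerSeries ℚ))
        = PowerSeries.coeff (2 * k) ((sinhDiv - 1) ^ j) * (m.choose j : ℚ) := by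
      intro j
      rw [one_pow, mul_one, ← map_natCast (PowerSeries.C (R := ℚ)), PowerSeries.coeff_mul_C]
    have lhs : PowerSeries.coeff (2 * k) (sinhDiv ^ m)
        = ∑ j ∈ Finset.range (m + 1),
          PowerSeries.coeff (2 * k) ((sinhDiv - 1) ^ j) * (m.choose j : ℚ) := by
      conv_lhs => rw [e, add_pow]
      rw [map_sum]
      exact Finset.sum_congr rfl fun j _ => key j
    have rhs : (Delta k).eval (m : ℚ)
        = ∑ j ∈ Finset.range (k + 1),
          PowerSeries.coeff (2 * k) ((sinhDiv - 1) ^ j) * (m.choose j : ℚ) := by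
      rw [Delta, Polynomial.eval_finsetSum]
      refine Finset.sum_congr rfl fun j _ => ?_
      rw [Polynomial.eval_mul, Polynomial.eval_C, descPochhammer_eval_eq_descFactorial,
        Nat.descFactorial_eq_factorial_mul_choose]
      have : (j.factorial : ℚ) ≠ 0 := by exact_mod_cast j.factorial_ne_zero
      push_cast
      field_simp
    rw [lhs, rhs]
    have l1 : ∑ j ∈ Finset.range (m + 1),
          PowerSeries.coeff (2 * k) ((sinhDiv - 1) ^ j) * (m.choose j : ℚ)
        = ∑ j ∈ Finset.range (m + k + 1),
          PowerSeries.coeff (2 * k) ((sinhDiv - 1) ^ j) * (m.choose j : ℚ) := by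
      refine Finset.sum_subset (by intro j; simp only [Finset.mem_range]; omega) ?_
      intro j _ hj
      simp only [Finset.mem_range, not_lt] at hj
      rw [Nat.choose_eq_zero_of_lt (by omega)]
      simp
    have l2 : ∑ j ∈ Finset.range (k + 1),
          PowerSeries.coeff (2 * k) ((sinhDiv - 1) ^ j) * (m.choose j : ℚ)
        = ∑ j ∈ Finset.range (m + k + 1),
          PowerSeries.coeff (2 * k) ((sinhDiv - 1) ^ j) * (m.choose j : ℚ) := by
      refine Finset.sum_subset (by intro j; simp only [Finset.mem_range]; omega) ?_
      intro j _ hj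
      simp only [Finset.mem_range, not_lt] at hj
      rw [coeff_sinhDiv_sub_one_pow j _ (by omega)]
      simp
    rw [l1, l2]
  · have hr : PowerSeries.rescale (-1 : ℚ) sinhDiv = sinhDiv := by
      ext i
      rw [PowerSeries.coeff_rescale, sinhDiv, PowerSeries.coeff_mk]
      split_ifs with hi
      · rw [hi.neg_one_pow, one_mul]
      · simp
    have hp : PowerSeries.rescale (-1 : ℚ) (sinhDiv ^ m) = sinhDiv ^ m := by
      rw [map_pow, hr]
    have hc := congrArg (PowerSeries.coeff n) hp
    rw [PowerSeries.coeff_rescale, (Nat.not_even_iff_odd.mp hn).neg_one_pow] at hc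
    linarith

/-! ### The polynomials `ν_p` -/

/-- The polynomial
`ν_p(n) = -d/(2d)^p ∑_{m=0}^p S̃_m ∏_{j=m}^{p-1} (d-j)
    ∑_{k=0}^{⌊(p-m)/2⌋} (2n-p+1)^{p-m-2k} / (p-m-2k)! Δ_k(d-p)` in the variable `n`. -/
def nu {d : ℕ} (lam : Fin d → ℂ) (p : ℕ) : Polynomial ℂ :=
  Polynomial.C (-((d : ℂ) / (2 * (d : ℂ)) ^ p)) *
    ∑ m ∈ Finset.range (p + 1),
      Polynomial.C (symStilde lam m * ∏ j ∈ Finset.Ico m p, ((d : ℂ) - (j : ℂ))) *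
        ∑ k ∈ Finset.range ((p - m) / 2 + 1),
          Polynomial.C ((((Delta k).eval ((d : ℚ) - (p : ℚ)) : ℚ) : ℂ)
              / ((p - m - 2 * k).factorial : ℂ)) *
            (2 * Polynomial.X - (p : Polynomial ℂ) + 1) ^ (p - m - 2 * k)

/-! ### The asymptotic expansions of `φ` and `G_s` -/

/-- `(M_n)` (with `M_n = 0` for `n < 0`) are the coefficients of the expansion
`φ(t^{d/2}) ∼ 2 (2π)^{(d-1)/2} d^{-1/2} e^{-dt} t^κ ∑_{n ≥ 0} M_n t^{-n}`. -/
def IsPhiCoeff {d : ℕ} (lam : Fin d → ℂ) (σ : ℝ) (M : ℤ → ℂ) : Prop :=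
  (∀ n : ℤ, n < 0 → M n = 0) ∧
  HasAsymptoticExpansion (fun t => phi lam σ (t ^ ((d : ℝ) / 2)))
    (fun t => 2 * leadingTerm d (kappa lam) t) (fun n => M n)

/-- `(μ_n(s))` (with `μ_n = 0` for `n < 0`) are the coefficients of the expansions
`G_s(t^{d/2}) ∼ (2π)^{(d-1)/2} d^{-1/2} e^{-dt} t^{κ-1} ∑_{n ≥ 0} μ_n(s) t^{-n}`,
for all complex `s`. -/
def IsGCoeff {d : ℕ} (lam : Fin d → ℂ) (σ : ℝ) (μ : ℤ → ℂ → ℂ) : Prop :=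
  (∀ n : ℤ, n < 0 → ∀ s, μ n s = 0) ∧
  ∀ s : ℂ, HasAsymptoticExpansion (fun t => G lam σ s (t ^ ((d : ℝ) / 2)))
    (leadingTerm d (kappa lam - 1)) (fun n => μ n s)

end MotivicL

end

namespace MotivicL

open Filter Asymptotics MeasureTheory Topology

/-! Put `z = ds/2 + κ` and write `γ(s) = q(z) d^{-z} Γ(z)`, with `q` the function `gammaRatio`. As a
function of `x = t^{d/2}`, the term `e^{-dt} t^{κ-n}` has Mellin transform `(d/2) d^{n-z} Γ(z-n)`.
An expansion of `φ` in these terms therefore corresponds to an expansion of `q(z)` in the functions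
`d^n Γ(z-n)/Γ(z)`, and the proof establishes the latter first, uniformly in a right half-plane.

The functional equation of `Γ` gives `q(z+d) = r(z) q(z)` with `r` rational (`gammaRatio_add`).
Expanding `∏_j (z - κ + dλ_j/2)` in rising factorials of `z - n` produces exactly the numbers `-d^p
ν_p(n+p-1)` (`prod_shift_eq_sum_nu`). This rests on `e^{wt} = ∑_k (w)_k/k! (1 - e^{-t})^k`, and the
powers of `sinh` behind `Δ_k` come from `1 - e^{-t} = 2 e^{-t/2} sinh(t/2)`. Substituting `∑ M_n d^n
Γ(z-n)/Γ(z)` into the functional equation and comparing coefficients yields `∑_i ν_{n-i+1}(n) M_i =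
0`. As `ν_1(n) = -n`, this is the recursion for `M_n`.

The truncated sum thus satisfies the functional equation up to `O(|z|^{-N-1})`. Its quotient by `q`
changes by that order under `z ↦ z + d` and has a known limit along `z + dℕ`, so summing the
increments gives an error `O(|z|^{-N})` (`norm_sub_limit_le`, `exists_gammaRatio_sub_bound`). The
limit of `q` comes from Euler's product and Stirling's formula (`tendsto_gammaRatio`).

For `φ`, the contour is moved to `Re z = m`. The error is then essentially `t^κ (m+1)!/(dt)^m` times
a negative power of `m`, and `m = ⌈dt⌉` makes it `e^{-dt}` times a power of `t`
(`exists_phi_sub_bound`). Crude Gamma bounds suffice, since lost powers are recovered by taking more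
terms.

For `G_s`, the coefficients `μ_n` are chosen so that the derivative of the truncated series
reproduces the integrand up to one term. Integrating the difference gives the expansion, uniformly
for bounded `s` (`exists_G_sub_bound`). Cauchy's inequalities then give the `s`-derivatives, and
`deg μ_n = n` removes the first `k` terms. Inserting the relation between `M_n` and `μ_n` into the
recursion for `M_n` gives the one for `μ_n` (`gCoeff_recursion`). Uniqueness of Poincaré expansions
transfers everything to arbitrary coefficient sequences. -/

/-! ### Rising factorials -/

/-- The power series `e^{at} (1 - e^{-t})^k`. -/
noncomputable def expShift (a : ℂ) (k : ℕ) : PowerSeries ℂ :=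
  PowerSeries.rescale a (PowerSeries.exp ℂ) *
    (1 - PowerSeries.rescale (-1) (PowerSeries.exp ℂ)) ^ k

lemma derivative_rescale_exp (a : ℂ) :
    PowerSeries.derivative ℂ (PowerSeries.rescale a (PowerSeries.exp ℂ))
      = PowerSeries.C a * PowerSeries.rescale a (PowerSeries.exp ℂ) := by
  ext n
  rw [PowerSeries.coeff_derivative, PowerSeries.coeff_C_mul, PowerSeries.coeff_rescale,
    PowerSeries.coeff_rescale, PowerSeries.coeff_exp, PowerSeries.coeff_exp, Nat.factorial_succ]
  have h1 : (n.factorial : ℂ) ≠ 0 := by exact_mod_cast n.factorial_ne_zero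
  have h2 : (n : ℂ) + 1 ≠ 0 := by exact_mod_cast n.succ_ne_zero
  simp
  field_simp
  ring

lemma derivative_expShift_zero (a : ℂ) :
    PowerSeries.derivative ℂ (expShift a 0) = PowerSeries.C a * expShift a 0 := by
  simp [expShift, derivative_rescale_exp]

/-- The factor `e^{-t}` produced by the chain rule is rewritten as `1 - (1 - e^{-t})`. The resulting
rule mirrors `(w + a) (w)_k = (w)_{k+1} + (a - k) (w)_k`, which is why these series generate the
coefficients of `(w + a)^D` in rising factorials. -/
lemma derivative_expShift_succ (a : ℂ) (k : ℕ) :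
    PowerSeries.derivative ℂ (expShift a (k + 1))
      = PowerSeries.C (a - (k + 1)) * expShift a (k + 1)
        + PowerSeries.C ((k : ℂ) + 1) * expShift a k := by
  simp only [expShift, Derivation.leibniz, Derivation.leibniz_pow, smul_eq_mul,
    derivative_rescale_exp, map_sub, map_add, map_one, map_natCast, Derivation.map_one_eq_zero,
    Nat.add_sub_cancel, nsmul_eq_mul, map_neg, Nat.cast_add, Nat.cast_one]
  ring

lemma coeff_expShift_recursion (a : ℂ) (D k : ℕ) :
    ((D : ℂ) + 1) * PowerSeries.coeff (D + 1) (expShift a (k + 1))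
      = (a - (k + 1)) * PowerSeries.coeff D (expShift a (k + 1))
        + ((k : ℂ) + 1) * PowerSeries.coeff D (expShift a k) := by
  have h := congrArg (PowerSeries.coeff D) (derivative_expShift_succ a k)
  rw [PowerSeries.coeff_derivative, map_add, PowerSeries.coeff_C_mul, PowerSeries.coeff_C_mul] at h
  rw [← h, mul_comm]

lemma coeff_expShift_zero_recursion (a : ℂ) (D : ℕ) :
    ((D : ℂ) + 1) * PowerSeries.coeff (D + 1) (expShift a 0)
      = a * PowerSeries.coeff D (expShift a 0) := by
  have h := congrArg (PowerSeries.coeff D) (derivative_expShift_zero a)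
  rw [PowerSeries.coeff_derivative, PowerSeries.coeff_C_mul] at h
  rw [← h, mul_comm]

lemma one_sub_rescale_exp :
    (1 : PowerSeries ℂ) - PowerSeries.rescale (-1) (PowerSeries.exp ℂ)
      = PowerSeries.rescale (-(1 / 2) : ℂ) (PowerSeries.exp ℂ) * (PowerSeries.X *
          PowerSeries.rescale (1 / 2 : ℂ) (PowerSeries.map (algebraMap ℚ ℂ) sinhDiv)) := by
  have key : PowerSeries.rescale (1 / 2 : ℂ) (PowerSeries.exp ℂ)
      - PowerSeries.rescale (-(1 / 2) : ℂ) (PowerSeries.exp ℂ)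
      = PowerSeries.X *
          PowerSeries.rescale (1 / 2 : ℂ) (PowerSeries.map (algebraMap ℚ ℂ) sinhDiv) := by
    ext n
    rcases n with _ | n
    · simp [-PowerSeries.coeff_zero_eq_constantCoeff, PowerSeries.coeff_rescale,
        PowerSeries.coeff_zero_X_mul]
    · rw [PowerSeries.coeff_succ_X_mul, map_sub, PowerSeries.coeff_rescale,
        PowerSeries.coeff_rescale, PowerSeries.coeff_rescale, PowerSeries.coeff_map,
        PowerSeries.coeff_exp, sinhDiv, PowerSeries.coeff_mk]
      split_ifs with hn
      · rw [neg_pow, (Even.add_one hn).neg_one_pow]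
        simp
        ring
      · rw [neg_pow, (Nat.not_even_iff_odd.mp hn).add_one.neg_one_pow]
        simp
  rw [← key, mul_sub, PowerSeries.exp_mul_exp_eq_exp_add, PowerSeries.exp_mul_exp_eq_exp_add]
  norm_num

lemma rescale_exp_pow (a : ℂ) (k : ℕ) :
    PowerSeries.rescale a (PowerSeries.exp ℂ) ^ k
      = PowerSeries.rescale (k * a) (PowerSeries.exp ℂ) := by
  induction k with
  | zero => simp
  | succ k ih =>
    rw [pow_succ, ih, PowerSeries.exp_mul_exp_eq_exp_add]
    congr 2
    push_cast
    ring

/-- The coefficient of `t^r` in `e^{bt} (sinh (t/2) / (t/2))^k`. -/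
noncomputable def sinhCoeff (b : ℂ) (k r : ℕ) : ℂ :=
  ∑ l ∈ Finset.range (r / 2 + 1),
    b ^ (r - 2 * l) / ((r - 2 * l).factorial : ℂ) * (((Delta l).eval (k : ℚ) : ℚ) : ℂ)
      * (1 / 2) ^ (2 * l)

/-- Pulling `e^{-t/2}` out of each of the `k` factors `1 - e^{-t}` leaves `t^k e^{(a - k/2)t}
(sinh(t/2)/(t/2))^k`. This is the point where the `Δ_l` enter. -/
lemma coeff_expShift (a : ℂ) (k r : ℕ) :
    PowerSeries.coeff (k + r) (expShift a k) = sinhCoeff (a - k / 2) k r := by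
  have h1 : expShift a k = PowerSeries.X ^ k *
      (PowerSeries.rescale (1 / 2 : ℂ) (PowerSeries.map (algebraMap ℚ ℂ) (sinhDiv ^ k)) *
        PowerSeries.rescale (a - k / 2) (PowerSeries.exp ℂ)) := by
    rw [expShift, one_sub_rescale_exp, mul_pow, mul_pow, rescale_exp_pow, map_pow, map_pow,
      ← mul_assoc, PowerSeries.exp_mul_exp_eq_exp_add, show a + k * -(1 / 2) = a - k / 2 by ring]
    ring
  rw [h1, add_comm, PowerSeries.coeff_X_pow_mul, sinhDiv_pow, PowerSeries.coeff_mul,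
    Finset.Nat.sum_antidiagonal_eq_sum_range_succ_mk, sinhCoeff]
  symm
  refine Finset.sum_of_injOn (fun l => 2 * l) (fun x _ y _ h => by simpa using h) ?_ ?_ ?_
  · intro l hl
    simp only [Finset.coe_range, Set.mem_Iio] at hl ⊢
    omega
  · intro i hi hi'
    have : ¬ Even i := by
      rintro ⟨l, rfl⟩
      refine hi' ⟨l, ?_, by ring⟩
      simp only [Finset.coe_range, Set.mem_Iio, Finset.mem_range] at hi ⊢
      omega
    rw [PowerSeries.coeff_rescale, PowerSeries.coeff_map, PowerSeries.coeff_mk, if_neg this]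
    simp
  · intro l hl
    rw [PowerSeries.coeff_rescale, PowerSeries.coeff_map, PowerSeries.coeff_mk,
      if_pos (even_two_mul l), PowerSeries.coeff_rescale, PowerSeries.coeff_exp]
    simp
    ring

lemma coeff_expShift_of_lt (a : ℂ) {D k : ℕ} (h : D < k) :
    PowerSeries.coeff D (expShift a k) = 0 := by
  rw [expShift, one_sub_rescale_exp, mul_pow, mul_pow,
    show ∀ x y z w : PowerSeries ℂ, x * (y * (z * w)) = z * (x * y * w) by intros; ring,
    PowerSeries.coeff_X_pow_mul', if_neg (by omega)]

lemma ascPochhammer_eval_succ' (k : ℕ) (w : ℂ) :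
    (ascPochhammer ℂ (k + 1)).eval w = (ascPochhammer ℂ k).eval w * (w + k) := by
  rw [ascPochhammer_succ_right, Polynomial.eval_mul]
  simp

/-- The expansion of `(w + a)^D` in rising factorials. -/
lemma add_pow_eq_sum_ascPochhammer (w a : ℂ) (D : ℕ) :
    (w + a) ^ D = ∑ k ∈ Finset.range (D + 1),
      (D.factorial : ℂ) / (k.factorial : ℂ) * PowerSeries.coeff D (expShift a k)
        * (ascPochhammer ℂ k).eval w := by
  induction D with
  | zero =>
    simp [expShift, -PowerSeries.coeff_zero_eq_constantCoeff, PowerSeries.coeff_rescale]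
  | succ D ih =>
    set c : ℕ → ℕ → ℂ := fun D k => (D.factorial : ℂ) / (k.factorial : ℂ) *
      PowerSeries.coeff D (expShift a k) with hc
    set y : ℕ → ℂ := fun k => (ascPochhammer ℂ k).eval w with hy
    have h0 : c (D + 1) 0 = a * c D 0 := by
      simp only [hc, Nat.factorial_succ]
      push_cast
      linear_combination (D.factorial : ℂ) / ((Nat.factorial 0 : ℕ) : ℂ) *
        coeff_expShift_zero_recursion a D
    have hs : ∀ k, c (D + 1) (k + 1) = (a - (k + 1)) * c D (k + 1) + c D k := by
      intro k
      have h1 : (k.factorial : ℂ) ≠ 0 := by exact_mod_cast k.factorial_ne_zero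
      have h2 : (k : ℂ) + 1 ≠ 0 := by exact_mod_cast k.succ_ne_zero
      have := coeff_expShift_recursion a D k
      simp only [hc, Nat.factorial_succ]
      push_cast
      field_simp
      linear_combination (D.factorial : ℂ) * this
    -- The series starts at `t^k`, so the top coefficient contributed by degree `D` vanishes and the
    -- two sums of the induction step have matching ranges.
    have hz : c D (D + 1) = 0 := by
      simp only [hc]
      rw [coeff_expShift_of_lt a (Nat.lt_succ_self D), mul_zero]
    have hyk : ∀ k, y (k + 1) = y k * (w + k) := fun k => ascPochhammer_eval_succ' k w
    change (w + a) ^ (D + 1) = ∑ k ∈ Finset.range (D + 1 + 1), c (D + 1) k * y k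
    change (w + a) ^ D = ∑ k ∈ Finset.range (D + 1), c D k * y k at ih
    rw [pow_succ, ih, Finset.sum_range_succ' _ (D + 1), h0]
    simp_rw [hs]
    have e1 : ∑ k ∈ Finset.range (D + 1), ((a - (k + 1)) * c D (k + 1) + c D k) * y (k + 1)
        = ∑ k ∈ Finset.range (D + 1), (a - ((k + 1 : ℕ) : ℂ)) * c D (k + 1) * y (k + 1)
          + ∑ k ∈ Finset.range (D + 1), c D k * (y k * (w + k)) := by
      rw [← Finset.sum_add_distrib]
      refine Finset.sum_congr rfl fun k _ => ?_
      rw [hyk]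
      push_cast
      ring
    have e2 : ∑ k ∈ Finset.range (D + 1), (a - ((k + 1 : ℕ) : ℂ)) * c D (k + 1) * y (k + 1)
          + a * c D 0 * y 0 = ∑ k ∈ Finset.range (D + 1), (a - k) * c D k * y k := by
      have := Finset.sum_range_succ' (fun k : ℕ => (a - k) * c D k * y k) (D + 1)
      rw [Finset.sum_range_succ, hz] at this
      simp only [Nat.cast_zero, sub_zero] at this
      rw [← this]
      ring
    rw [e1, add_right_comm, e2, ← Finset.sum_add_distrib, Finset.sum_mul]
    refine Finset.sum_congr rfl fun k _ => ?_
    ring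

/-! ### The polynomials `ν_p` and the functional equation of the Gamma factor -/

lemma prod_add_mul_eq_sum_symS {d : ℕ} (lam : Fin d → ℂ) {c : ℂ} (hc : c ≠ 0) (y : ℂ) :
    ∏ j, (y + c * lam j) = ∑ i ∈ Finset.range (d + 1), c ^ i * symS lam i * y ^ (d - i) := by
  have h := congrArg (Polynomial.eval (y / c))
    (Multiset.prod_X_add_C_eq_sum_esymm ((Finset.univ : Finset (Fin d)).val.map lam))
  rw [Multiset.map_map] at h
  have h1 : ((Finset.univ : Finset (Fin d)).val.map
      ((fun r => Polynomial.X + Polynomial.C r) ∘ lam)).prod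
      = ∏ j, (Polynomial.X + Polynomial.C (lam j)) := rfl
  rw [h1, Polynomial.eval_prod, Polynomial.eval_finsetSum] at h
  simp only [Polynomial.eval_add, Polynomial.eval_X, Polynomial.eval_C, Polynomial.eval_mul,
    Polynomial.eval_pow, Multiset.card_map, Finset.card_val, Finset.card_univ,
    Fintype.card_fin] at h
  have h2 : ∏ j, (y + c * lam j) = c ^ d * ∏ j, (y / c + lam j) := by
    rw [← Fin.prod_const, ← Finset.prod_mul_distrib]
    refine Finset.prod_congr rfl fun j _ => ?_
    field_simp
  rw [h2, h, Finset.mul_sum]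
  refine Finset.sum_congr rfl fun i hi => ?_
  have hid : i ≤ d := by simpa [Nat.lt_succ_iff] using hi
  have h3 : c ^ d = c ^ i * c ^ (d - i) := by rw [← pow_add]; congr 1; omega
  rw [h3, div_pow, symS]
  field_simp

lemma symS_one {d : ℕ} (lam : Fin d → ℂ) : symS lam 1 = ∑ j, lam j := by
  simp [symS, Multiset.esymm, Multiset.powersetCard_one, Finset.sum, Function.comp_def]

/-- The numbers `dλ_j/2 - S_1/2` are the `λ_j` rescaled and centred to have sum zero, and `2^{-m} d
S̃_m` is their `m`-th elementary symmetric function. Expanding `(y - S_1/2)^{d-i}` binomially and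
collecting `m = i + k` gives the defining sum of `S̃_m`. -/
lemma prod_add_half_eq_sum_symStilde {d : ℕ} (hd : 1 ≤ d) (lam : Fin d → ℂ) (y : ℂ) :
    ∏ j, (y - symS lam 1 / 2 + d / 2 * lam j)
      = ∑ m ∈ Finset.range (d + 1), (1 / 2) ^ m * d * symStilde lam m * y ^ (d - m) := by
  have hd0 : (d : ℂ) ≠ 0 := by exact_mod_cast (by omega : d ≠ 0)
  rw [prod_add_mul_eq_sum_symS lam (div_ne_zero hd0 two_ne_zero)]
  set F : ℕ → ℕ → ℂ := fun i k => ((d : ℂ) / 2) ^ i * symS lam i * ((-(symS lam 1 / 2)) ^ k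
    * y ^ (d - i - k) * ((d - i).choose k : ℂ)) with hF
  have h1 : ∀ i ∈ Finset.range (d + 1),
      ((d : ℂ) / 2) ^ i * symS lam i * (y - symS lam 1 / 2) ^ (d - i)
        = ∑ k ∈ Finset.range (d + 1 - i), F i k := by
    intro i hi
    have hid : i ≤ d := by simpa [Nat.lt_succ_iff] using hi
    rw [show y - symS lam 1 / 2 = -(symS lam 1 / 2) + y by ring, add_pow, Finset.mul_sum,
      show d + 1 - i = d - i + 1 by omega]
  rw [Finset.sum_congr rfl h1, ← Finset.sum_range_diag_flip]
  refine Finset.sum_congr rfl fun m hm => ?_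
  have hmd : m ≤ d := by simpa [Nat.lt_succ_iff] using hm
  rw [← Finset.sum_flip, symStilde, if_pos hmd, Finset.mul_sum, Finset.sum_mul]
  refine Finset.sum_congr rfl fun k hk => ?_
  have hkm : k ≤ m := by simpa [Nat.lt_succ_iff] using hk
  obtain ⟨i, rfl⟩ := Nat.exists_eq_add_of_le' hkm
  rw [hF]
  simp only [Nat.add_sub_cancel]
  rw [show i + k - i = k by omega, show d - i - k = d - (i + k) by omega,
    show k + d - (i + k) = d - i by omega,
    show ((i + k : ℕ) : ℤ) - 1 - (k : ℤ) = (i : ℤ) - 1 by push_cast; ring,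
    zpow_sub_one₀ hd0, zpow_natCast, div_pow, neg_pow, neg_pow (symS lam 1), div_pow, pow_add,
    one_div, inv_pow, inv_pow]
  field_simp

lemma prod_Ico_sub_eq_factorial_div {d m p : ℕ} (hmp : m ≤ p) (hpd : p ≤ d) :
    ∏ j ∈ Finset.Ico m p, ((d : ℂ) - (j : ℂ))
      = ((d - m).factorial : ℂ) / ((d - p).factorial : ℂ) := by
  induction p, hmp using Nat.le_induction with
  | base =>
    have : ((d - m).factorial : ℂ) ≠ 0 := by exact_mod_cast (d - m).factorial_ne_zero
    simp [this]
  | succ p hmp ih =>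
    rw [Finset.prod_Ico_succ_top hmp, ih (by omega)]
    have h1 : d - p = (d - (p + 1)) + 1 := by omega
    have h2 : ((d - (p + 1)).factorial : ℂ) ≠ 0 := by
      exact_mod_cast (d - (p + 1)).factorial_ne_zero
    have h3 : (d : ℂ) - p = ((d - (p + 1) : ℕ) : ℂ) + 1 := by
      rw [Nat.cast_sub hpd]; push_cast; ring
    have h4 : ((d - (p + 1) : ℕ) : ℂ) + 1 ≠ 0 := by exact_mod_cast Nat.succ_ne_zero (d - (p + 1))
    rw [h1, Nat.factorial_succ, h3]
    push_cast
    field_simp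

lemma nu_eval {d : ℕ} (lam : Fin d → ℂ) (p : ℕ) (x : ℂ) :
    (nu lam p).eval x = -((d : ℂ) / (2 * (d : ℂ)) ^ p) *
      ∑ m ∈ Finset.range (p + 1), symStilde lam m * (∏ j ∈ Finset.Ico m p, ((d : ℂ) - (j : ℂ))) *
        ∑ k ∈ Finset.range ((p - m) / 2 + 1),
          (((Delta k).eval ((d : ℚ) - (p : ℚ)) : ℚ) : ℂ) / ((p - m - 2 * k).factorial : ℂ) *
            (2 * x - p + 1) ^ (p - m - 2 * k) := by
  simp [nu, Polynomial.eval_finsetSum, Polynomial.eval_prod]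

/-- The functional equation of the Gamma factor, expanded in rising factorials. -/
lemma prod_shift_eq_sum_nu {d : ℕ} (hd : 1 ≤ d) (lam : Fin d → ℂ) (w n : ℂ) :
    ∏ j, (w + n - kappa lam + d / 2 * lam j)
      = ∑ p ∈ Finset.range (d + 1), -((d : ℂ) ^ p * (nu lam p).eval (n + p - 1))
          * (ascPochhammer ℂ (d - p)).eval w := by
  have hd0 : (d : ℂ) ≠ 0 := by exact_mod_cast (by omega : d ≠ 0)
  have h0 : ∀ j, w + n - kappa lam + d / 2 * lam j
      = (w + (n + (d - 1) / 2)) - symS lam 1 / 2 + d / 2 * lam j := by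
    intro j
    rw [kappa, symS_one]
    ring
  simp_rw [h0]
  rw [prod_add_half_eq_sum_symStilde hd]
  -- With this shift, `a - (d - p)/2` is half of `2(n + p - 1) - p + 1`, the base of the powers in
  -- `ν_p` at the argument `n + p - 1`; see `hb`.
  set a : ℂ := n + (d - 1) / 2 with ha
  set F : ℕ → ℕ → ℂ := fun m r => (1 / 2) ^ m * d * symStilde lam m *
    (((d - m).factorial : ℂ) / ((d - m - r).factorial : ℂ)
      * PowerSeries.coeff (d - m) (expShift a (d - m - r))
      * (ascPochhammer ℂ (d - m - r)).eval w) with hF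
  have h1 : ∀ m ∈ Finset.range (d + 1),
      (1 / 2) ^ m * d * symStilde lam m * (w + a) ^ (d - m)
        = ∑ r ∈ Finset.range (d + 1 - m), F m r := by
    intro m hm
    have hmd : m ≤ d := by simpa [Nat.lt_succ_iff] using hm
    rw [add_pow_eq_sum_ascPochhammer, Finset.mul_sum, show d + 1 - m = d - m + 1 by omega,
      ← Finset.sum_flip]
  rw [Finset.sum_congr rfl h1, ← Finset.sum_range_diag_flip]
  refine Finset.sum_congr rfl fun p hp => ?_
  have hpd : p ≤ d := by simpa [Nat.lt_succ_iff] using hp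
  rw [nu_eval, Finset.mul_sum, Finset.mul_sum, ← Finset.sum_neg_distrib, Finset.sum_mul]
  refine Finset.sum_congr rfl fun m hm => ?_
  have hmp : m ≤ p := by simpa [Nat.lt_succ_iff] using hm
  rw [hF, prod_Ico_sub_eq_factorial_div hmp hpd]
  simp only
  rw [show d - m - (p - m) = d - p by omega, show d - m = (d - p) + (p - m) by omega,
    coeff_expShift, sinhCoeff, Finset.mul_sum, Finset.mul_sum, Finset.sum_mul, Finset.mul_sum,
    Finset.mul_sum, Finset.mul_sum, ← Finset.sum_neg_distrib, Finset.sum_mul]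
  refine Finset.sum_congr rfl fun l hl => ?_
  have hl' : 2 * l ≤ p - m := by
    have : l < (p - m) / 2 + 1 := by simpa using hl
    omega
  have hb : a - ((d - p : ℕ) : ℂ) / 2 = (2 * (n + p - 1) - p + 1) / 2 := by
    rw [ha, Nat.cast_sub hpd]; ring
  have hpow : (2 : ℂ) ^ p = 2 ^ m * (2 ^ (p - m - 2 * l) * 2 ^ (2 * l)) := by
    rw [← pow_add, ← pow_add]; congr 1; omega
  rw [hb, div_pow, mul_pow, hpow, Nat.cast_sub hpd (R := ℚ), div_pow, div_pow]
  field_simp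
  simp

lemma symStilde_zero {d : ℕ} (lam : Fin d → ℂ) :
    symStilde lam 0 = (d : ℂ)⁻¹ := by
  simp [symStilde, symS, Multiset.esymm]

lemma symStilde_one {d : ℕ} (hd : 1 ≤ d) (lam : Fin d → ℂ) : symStilde lam 1 = 0 := by
  have hd0 : (d : ℂ) ≠ 0 := by exact_mod_cast (by omega : d ≠ 0)
  have : 1 + d - 1 = d := by omega
  rw [symStilde, if_pos hd]
  simp [Finset.sum_range_succ, this]
  simp [symS, Multiset.esymm, hd0]

/-- For `m ≤ d < p` the product over `j` contains the factor `d - d`, and for `m > d` the convention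
`S̃_m = 0` applies. Hence the recursions stop at `p = d`. -/
lemma nu_eq_zero_of_lt {d p : ℕ} (lam : Fin d → ℂ) (hp : d < p) : nu lam p = 0 := by
  rw [nu]
  refine mul_eq_zero_of_right _ (Finset.sum_eq_zero fun m hm => ?_)
  have hmp : m ≤ p := by simpa [Nat.lt_succ_iff] using hm
  rcases le_or_gt m d with h | h
  · rw [Finset.prod_eq_zero (Finset.mem_Ico.mpr ⟨h, hp⟩) (sub_self _)]
    simp
  · rw [symStilde, if_neg (by omega)]
    simp

lemma Delta_zero : Delta 0 = 1 := by simp [Delta]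

lemma nu_zero_eval {d : ℕ} (hd : 1 ≤ d) (lam : Fin d → ℂ) (x : ℂ) :
    (nu lam 0).eval x = -1 := by
  have hd0 : (d : ℂ) ≠ 0 := by exact_mod_cast (by omega : d ≠ 0)
  simp [nu_eval, symStilde_zero, Delta_zero, hd0]

/-- Because `S̃_1 = 0`, only `m = 0` contributes. This value is the source of the divisor `n` in
both recursions. -/
lemma nu_one_eval {d : ℕ} (hd : 1 ≤ d) (lam : Fin d → ℂ) (x : ℂ) :
    (nu lam 1).eval x = -x := by
  have hd0 : (d : ℂ) ≠ 0 := by exact_mod_cast (by omega : d ≠ 0)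
  simp [nu_eval, symStilde_zero, symStilde_one hd, Delta_zero, Finset.sum_range_succ]
  field_simp

/-! ### The coefficients -/

/-- The coefficients `M_n` of the expansion of `φ`. -/
noncomputable def phiCoeff {d : ℕ} (lam : Fin d → ℂ) : ℕ → ℂ
  | 0 => 1
  | n + 1 => 1 / ((n : ℂ) + 1) *
      ∑ i : Fin (n + 1), (nu lam (n + 1 - i + 1)).eval ((n : ℂ) + 1) * phiCoeff lam i

/-- The recursion in homogeneous form, its left side being the term `i = n` through `ν_1(n) = -n`.
In this form it expresses the cancellation of a coefficient in the difference equation, and it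
remains valid at `n = 0`. -/
lemma sum_nu_mul_phiCoeff {d : ℕ} (hd : 1 ≤ d) (lam : Fin d → ℂ) (n : ℕ) :
    ∑ i ∈ Finset.range (n + 1), (nu lam (n - i + 1)).eval (n : ℂ) * phiCoeff lam i = 0 := by
  rcases n with _ | n
  · simp [nu_one_eval hd]
  · have h : (n : ℂ) + 1 ≠ 0 := by exact_mod_cast n.succ_ne_zero
    rw [Finset.sum_range_succ, Nat.sub_self, zero_add, nu_one_eval hd, phiCoeff,
      Fin.sum_univ_eq_sum_range
        (fun i => (nu lam (n + 1 - i + 1)).eval ((n : ℂ) + 1) * phiCoeff lam i)]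
    push_cast
    field_simp
    ring

/-- The polynomials `μ_n(s)`. -/
noncomputable def gCoeff {d : ℕ} (lam : Fin d → ℂ) : ℕ → Polynomial ℂ
  | 0 => 1
  | n + 1 => Polynomial.C (phiCoeff lam (n + 1)) +
      (Polynomial.C ((kappa lam - (n + 1)) / d) + Polynomial.C (1 / 2) * Polynomial.X)
        * gCoeff lam n

lemma gCoeff_natDegree_leadingCoeff {d : ℕ} (lam : Fin d → ℂ) (n : ℕ) :
    (gCoeff lam n).natDegree = n ∧ (gCoeff lam n).leadingCoeff = (2 : ℂ)⁻¹ ^ n := by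
  induction n with
  | zero => simp [gCoeff]
  | succ n ih =>
    set L : Polynomial ℂ :=
      Polynomial.C ((kappa lam - (n + 1)) / d) + Polynomial.C (1 / 2) * Polynomial.X with hL
    have hL' : L = Polynomial.C (1 / 2) * Polynomial.X
        + Polynomial.C ((kappa lam - (n + 1)) / d) := add_comm _ _
    have h1 : L.natDegree = 1 := by rw [hL']; exact Polynomial.natDegree_linear (by norm_num)
    have h2 : L.leadingCoeff = 1 / 2 := by
      rw [hL']; exact Polynomial.leadingCoeff_linear (by norm_num)
    have hL0 : L ≠ 0 := by
      intro h; rw [h] at h1; simp at h1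
    have hg0 : gCoeff lam n ≠ 0 := by
      intro h
      have := ih.2
      rw [h, Polynomial.leadingCoeff_zero] at this
      exact pow_ne_zero n (inv_ne_zero two_ne_zero) this.symm
    have h3 : (L * gCoeff lam n).natDegree = n + 1 := by
      rw [Polynomial.natDegree_mul hL0 hg0, h1, ih.1, add_comm]
    have h4 : (Polynomial.C (phiCoeff lam (n + 1))).degree < (L * gCoeff lam n).degree := by
      refine lt_of_le_of_lt Polynomial.degree_C_le ?_
      rw [← Polynomial.natDegree_pos_iff_degree_pos, h3]
      omega
    rw [gCoeff, ← hL]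
    refine ⟨?_, ?_⟩
    · rw [Polynomial.natDegree_add_eq_right_of_degree_lt h4, h3]
    · rw [Polynomial.leadingCoeff_add_of_degree_lt h4, Polynomial.leadingCoeff_mul, h2, ih.2,
        pow_succ]
      ring

lemma phiCoeff_recursion {d : ℕ} (hd : 1 ≤ d) (lam : Fin d → ℂ) (n : ℕ) (hn : 1 ≤ n) :
    phiCoeff lam n = 1 / (n : ℂ) *
      ∑ i ∈ Finset.range n, (nu lam (n - i + 1)).eval (n : ℂ) * phiCoeff lam i := by
  have h := sum_nu_mul_phiCoeff hd lam n
  have hn0 : (n : ℂ) ≠ 0 := by exact_mod_cast (by omega : n ≠ 0)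
  rw [Finset.sum_range_succ, Nat.sub_self, zero_add, nu_one_eval hd] at h
  field_simp
  linear_combination -h

lemma phiCoeff_eq_gCoeff {d : ℕ} (hd : 1 ≤ d) (lam : Fin d → ℂ) (n : ℕ) (s : ℂ) :
    phiCoeff lam (n + 1) = (gCoeff lam (n + 1)).eval s
      - (symS lam 1 + d * (s - 1) - 2 * n - 1) / (2 * d) * (gCoeff lam n).eval s := by
  have hd0 : (d : ℂ) ≠ 0 := by exact_mod_cast (by omega : d ≠ 0)
  rw [gCoeff]
  simp only [Polynomial.eval_add, Polynomial.eval_mul, Polynomial.eval_C, Polynomial.eval_X]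
  rw [kappa, symS_one]
  field_simp
  ring

/-- Substitute `M_{i+1} = μ_{i+1} - β_i μ_i` into the homogeneous recursion `∑ v_i M_i = 0`. A
summation by parts moves the shift onto `v_i = ν_{n-i+1}(n)`, and `v_{i+1} = ν_{n-i}(n)` supplies
the second term. -/
lemma gCoeff_recursion {d : ℕ} (hd : 1 ≤ d) (lam : Fin d → ℂ) (n : ℕ) (hn : 1 ≤ n) (s : ℂ) :
    (gCoeff lam n).eval s = 1 / (n : ℂ) *
      ∑ i ∈ Finset.range n, ((nu lam (n - i + 1)).eval (n : ℂ)
        - (symS lam 1 + d * (s - 1) - 2 * i - 1) / (2 * d) * (nu lam (n - i)).eval (n : ℂ))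
          * (gCoeff lam i).eval s := by
  have hn0 : (n : ℂ) ≠ 0 := by exact_mod_cast (by omega : n ≠ 0)
  set β : ℕ → ℂ := fun i => (symS lam 1 + d * (s - 1) - 2 * i - 1) / (2 * d) with hβ
  set μ : ℕ → ℂ := fun i => (gCoeff lam i).eval s with hμ
  set v : ℕ → ℂ := fun i => (nu lam (n - i + 1)).eval (n : ℂ) with hv
  have hM : ∀ i, phiCoeff lam (i + 1) = μ (i + 1) - β i * μ i :=
    fun i => phiCoeff_eq_gCoeff hd lam i s
  have hM0 : phiCoeff lam 0 = μ 0 := by simp [phiCoeff, gCoeff, hμ]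
  have hvn : v n = -n := by
    simp only [hv]
    rw [Nat.sub_self, zero_add, nu_one_eval hd]
  have h : ∑ i ∈ Finset.range (n + 1), v i * phiCoeff lam i = 0 := sum_nu_mul_phiCoeff hd lam n
  rw [Finset.sum_range_succ', hM0] at h
  simp_rw [hM, mul_sub] at h
  rw [Finset.sum_sub_distrib] at h
  have h2 := Finset.sum_range_succ' (fun i => v i * μ i) n
  rw [Finset.sum_range_succ, hvn] at h2
  have h3 : ∀ i ∈ Finset.range n, (v i - β i * (nu lam (n - i)).eval (n : ℂ)) * μ i
      = v i * μ i - v (i + 1) * (β i * μ i) := by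
    intro i hi
    have : n - (i + 1) + 1 = n - i := by
      have : i < n := by simpa using hi
      omega
    simp only [hv]
    rw [this]
    ring
  change μ n = 1 / (n : ℂ) *
    ∑ i ∈ Finset.range n, (v i - β i * (nu lam (n - i)).eval (n : ℂ)) * μ i
  rw [Finset.sum_congr rfl h3, Finset.sum_sub_distrib]
  rw [one_div, eq_inv_mul_iff_mul_eq₀ hn0]
  linear_combination -h2 - h

/-! ### Solutions of difference equations in a right half-plane -/

lemma norm_le_norm_add_ofReal {z : ℂ} (hz : 0 ≤ z.re) {x : ℝ} (hx : 0 ≤ x) :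
    ‖z‖ ≤ ‖z + x‖ := by
  rw [Complex.norm_def, Complex.norm_def]
  refine Real.sqrt_le_sqrt ?_
  simp only [Complex.normSq_apply, Complex.add_re, Complex.ofReal_re, Complex.add_im,
    Complex.ofReal_im, add_zero]
  nlinarith

lemma norm_add_le_two_mul_norm_add_ofReal {z : ℂ} (hz : 0 ≤ z.re) {x : ℝ} (hx : 0 ≤ x) :
    ‖z‖ + x ≤ 2 * ‖z + x‖ := by
  have h1 := norm_le_norm_add_ofReal hz hx
  have h2 : x ≤ ‖z + x‖ := by
    refine le_trans ?_ (Complex.re_le_norm _)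
    simp [hz]
  linarith

lemma inv_pow_succ_le_sub {y : ℝ} (hy : 1 ≤ y) {N : ℕ} (hN : 1 ≤ N) :
    1 / y ^ (N + 1) ≤ 2 * (1 / y ^ N - 1 / (y + 1) ^ N) := by
  have hy0 : 0 < y := by linarith
  obtain ⟨n, rfl⟩ := Nat.exists_eq_add_of_le' hN
  have h1 : y ^ n * (y + 1) ≤ (y + 1) ^ (n + 1) := by
    rw [pow_succ]
    gcongr
    linarith
  have h2 : 1 / (y + 1) ^ (n + 1) ≤ 1 / (y ^ n * (y + 1)) :=
    one_div_le_one_div_of_le (by positivity) h1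
  have h3 : 1 / y ^ (n + 1 + 1) ≤ 2 * (1 / y ^ (n + 1) - 1 / (y ^ n * (y + 1))) := by
    have e : 2 * (1 / y ^ (n + 1) - 1 / (y ^ n * (y + 1))) = 2 / (y ^ (n + 1) * (y + 1)) := by
      field_simp
      ring
    rw [e, div_le_div_iff₀ (by positivity) (by positivity), pow_succ y (n + 1)]
    nlinarith [pow_pos hy0 (n + 1)]
  linarith

/-- Since `Re z > 0`, one has `|z + dm| ≥ (|z| + m)/2`, so the increments are dominated by a
multiple of `(|z| + m)^{-N-1}`, which telescopes against `(|z| + m)^{-N}`. The bound is in `|z|`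
rather than `Re z`, hence uniform on vertical lines. The constant collects `2^{N+1}` from the
halving and `2` from `inv_pow_succ_le_sub`. -/
lemma norm_sub_limit_le {E : Type*} [NormedAddCommGroup E] {ρ : ℂ → E} {L : E} {d N : ℕ}
    {K X : ℝ} (hd : 1 ≤ d) (hN : 1 ≤ N) (hX : 1 ≤ X) (hK : 0 ≤ K)
    (hρ : ∀ z : ℂ, X ≤ z.re → ‖ρ (z + d) - ρ z‖ ≤ K / ‖z‖ ^ (N + 1))
    {z : ℂ} (hz : X ≤ z.re)
    (hL : Tendsto (fun k : ℕ => ρ (z + d * k)) atTop (𝓝 L)) :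
    ‖ρ z - L‖ ≤ K * 2 ^ (N + 2) / ‖z‖ ^ N := by
  have hz1 : 1 ≤ ‖z‖ := (hX.trans hz).trans (Complex.re_le_norm z)
  have hstep : ∀ m : ℕ, ‖ρ z - ρ (z + d * m)‖
      ≤ K * 2 ^ (N + 2) * (1 / ‖z‖ ^ N - 1 / (‖z‖ + m) ^ N) := by
    intro m
    induction m with
    | zero => simp
    | succ m ih =>
      have hre : X ≤ (z + d * m : ℂ).re := by
        have : 0 ≤ (d : ℝ) * m := by positivity
        simp
        linarith
      have h1 := hρ _ hre
      have hdm : (m : ℝ) ≤ (d : ℝ) * m := by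
        have : (1 : ℝ) ≤ d := by exact_mod_cast hd
        nlinarith [(Nat.cast_nonneg m : (0 : ℝ) ≤ m)]
      have h2 : (‖z‖ + m) / 2 ≤ ‖z + d * m‖ := by
        have := norm_add_le_two_mul_norm_add_ofReal (z := z) (by linarith)
          (x := (d : ℝ) * m) (by positivity)
        push_cast at this
        linarith
      have h3 : K / ‖z + d * m‖ ^ (N + 1) ≤ K * 2 ^ (N + 1) * (1 / (‖z‖ + m) ^ (N + 1)) := by
        calc K / ‖z + d * m‖ ^ (N + 1) ≤ K / ((‖z‖ + m) / 2) ^ (N + 1) := by gcongr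
          _ = K * 2 ^ (N + 1) * (1 / (‖z‖ + m) ^ (N + 1)) := by
            rw [div_pow]; field_simp
      have h4 := inv_pow_succ_le_sub (y := ‖z‖ + m)
        (by linarith [(Nat.cast_nonneg m : (0 : ℝ) ≤ m)]) hN
      have h5 : ‖ρ z - ρ (z + d * (m + 1 : ℕ))‖
          ≤ ‖ρ z - ρ (z + d * m)‖ + ‖ρ (z + d * m + d) - ρ (z + d * m)‖ := by
        have : z + (d : ℂ) * (m + 1 : ℕ) = z + d * m + d := by push_cast; ring
        rw [this, ← norm_neg (ρ (z + d * m + d) - ρ (z + d * m)), neg_sub]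
        exact norm_sub_le_norm_sub_add_norm_sub _ _ _
      have h6 : K * 2 ^ (N + 1) * (1 / (‖z‖ + m) ^ (N + 1))
          ≤ K * 2 ^ (N + 1) * (2 * (1 / (‖z‖ + m) ^ N - 1 / (‖z‖ + m + 1) ^ N)) := by
        gcongr
      have h7 : K * 2 ^ (N + 2) * (1 / ‖z‖ ^ N - 1 / (‖z‖ + (m + 1 : ℕ)) ^ N)
          = K * 2 ^ (N + 2) * (1 / ‖z‖ ^ N - 1 / (‖z‖ + m) ^ N)
            + K * 2 ^ (N + 1) * (2 * (1 / (‖z‖ + m) ^ N - 1 / (‖z‖ + m + 1) ^ N)) := by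
        push_cast
        rw [add_assoc]
        ring
      rw [h7]
      linarith
  refine le_of_tendsto (tendsto_const_nhds.sub hL).norm (Eventually.of_forall fun m => ?_)
  refine (hstep m).trans ?_
  rw [mul_sub, mul_one_div]
  have : 0 ≤ K * 2 ^ (N + 2) * (1 / (‖z‖ + m) ^ N) := by positivity
  linarith

lemma abs_log_le_two_mul {x : ℝ} (hx : |x - 1| ≤ 1 / 2) : |Real.log x| ≤ 2 * |x - 1| := by
  obtain ⟨h1, h2⟩ := abs_le.mp hx
  have hx0 : 0 < x := by linarith
  rw [abs_le]
  constructor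
  · have h3 := Real.one_sub_inv_le_log_of_pos hx0
    have h4 : -(2 * |x - 1|) ≤ 1 - x⁻¹ := by
      have e : 1 - x⁻¹ = (x - 1) / x := by field_simp
      rw [e, le_div_iff₀ hx0]
      rcases abs_cases (x - 1) with ⟨h, _⟩ | ⟨h, _⟩ <;> rw [h] <;> nlinarith
    linarith
  · have := Real.log_le_sub_one_of_pos hx0
    have h5 := le_abs_self (x - 1)
    have h6 := abs_nonneg (x - 1)
    linarith

/-- If `q(z + d) = r(z) q(z)` with `r(z) = 1 + O(z⁻²)` and `q` has a non-zero limit along `z + dℕ`,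
then `q` is bounded above and below in a right half-plane. -/
lemma exists_bounds_of_ratio {q : ℂ → ℂ} {r : ℂ → ℂ} {c : ℂ} {d : ℕ} {K X : ℝ} (hd : 1 ≤ d)
    (hX : 1 ≤ X) (hK : 0 ≤ K) (hc : c ≠ 0) (hq0 : ∀ z : ℂ, X ≤ z.re → q z ≠ 0)
    (hq : ∀ z : ℂ, X ≤ z.re → q (z + d) = r z * q z)
    (hr : ∀ z : ℂ, X ≤ z.re → ‖r z - 1‖ ≤ K / ‖z‖ ^ 2)
    (hL : ∀ z : ℂ, X ≤ z.re → Tendsto (fun k : ℕ => q (z + d * k)) atTop (𝓝 c)) :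
    ∃ A X' : ℝ, 0 < A ∧ X ≤ X' ∧ ∀ z : ℂ, X' ≤ z.re → ‖q z‖ ≤ A ∧ ‖q z‖⁻¹ ≤ A := by
  -- This margin forces `K/|z|^2 ≤ 1/2`, the range in which `abs_log_le_two_mul` applies.
  set X' : ℝ := X + 2 * K with hX'
  have hXX' : X ≤ X' := by linarith
  -- The real logarithm of `|q|` turns the multiplicative equation into an additive one without a
  -- choice of branch.
  have hu : ∀ z : ℂ, X' ≤ z.re → ‖Real.log ‖q (z + d)‖ - Real.log ‖q z‖‖
      ≤ (2 * K) / ‖z‖ ^ (1 + 1) := by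
    intro z hz
    have hz1 : X' ≤ ‖z‖ := hz.trans (Complex.re_le_norm z)
    have hzpos : 0 < ‖z‖ := by linarith
    have hzX : X ≤ z.re := hXX'.trans hz
    have hzd : X ≤ (z + d : ℂ).re := by
      simp
      linarith [(Nat.cast_nonneg d : (0 : ℝ) ≤ d)]
    have h1 : ‖q (z + d)‖ = ‖r z‖ * ‖q z‖ := by rw [hq z hzX, norm_mul]
    have hr0 : ‖r z‖ ≠ 0 := by
      intro h
      rw [h, zero_mul] at h1
      exact hq0 _ hzd (norm_eq_zero.mp h1)
    have h2 : |‖r z‖ - 1| ≤ K / ‖z‖ ^ 2 := by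
      have := abs_norm_sub_norm_le (r z) 1
      rw [norm_one] at this
      exact this.trans (hr z hzX)
    have h3 : K / ‖z‖ ^ 2 ≤ 1 / 2 := by
      rw [div_le_div_iff₀ (by positivity) two_pos]
      nlinarith
    rw [h1, Real.log_mul hr0 (norm_ne_zero_iff.mpr (hq0 z hzX)), add_sub_cancel_right,
      Real.norm_eq_abs]
    refine (abs_log_le_two_mul (h2.trans h3)).trans ?_
    rw [mul_div_assoc]
    gcongr
  set B : ℝ := (2 * K) * 2 ^ (1 + 2) with hB
  have hB0 : 0 ≤ B := by positivity
  have hbound : ∀ z : ℂ, X' ≤ z.re → |Real.log ‖q z‖ - Real.log ‖c‖| ≤ B := by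
    intro z hz
    have hzX : X ≤ z.re := hXX'.trans hz
    have hz1 : 1 ≤ ‖z‖ := (hX.trans hzX).trans (Complex.re_le_norm z)
    have := norm_sub_limit_le (ρ := fun z => Real.log ‖q z‖) hd le_rfl (hX.trans hXX')
      (by positivity) hu hz
      ((Real.continuousAt_log (norm_ne_zero_iff.mpr hc)).tendsto.comp (hL z hzX).norm)
    rw [Real.norm_eq_abs] at this
    refine this.trans (div_le_self hB0 ?_)
    simpa using hz1
  refine ⟨Real.exp (|Real.log ‖c‖| + B), X', Real.exp_pos _, hXX', fun z hz => ?_⟩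
  have hqpos : 0 < ‖q z‖ := norm_pos_iff.mpr (hq0 z (hXX'.trans hz))
  obtain ⟨h1, h2⟩ := abs_le.mp (hbound z hz)
  have h3 := le_abs_self (Real.log ‖c‖)
  have h4 := neg_abs_le (Real.log ‖c‖)
  constructor
  · rw [← Real.log_le_iff_le_exp hqpos]
    linarith
  · rw [← Real.log_le_iff_le_exp (inv_pos.mpr hqpos), Real.log_inv]
    linarith

/-! ### Ratios of Gamma functions -/

/-- The quotient is the inverse of `(v - 1)⋯(v - m)`, and each factor has norm at least `|v|/2`
because `2m ≤ Re v ≤ |v|`. -/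
lemma norm_Gamma_sub_nat_div_le {v : ℂ} (hv : 0 < v.re) (m : ℕ) (hm : 2 * (m : ℝ) ≤ v.re) :
    ‖Complex.Gamma (v - m) / Complex.Gamma v‖ ≤ (2 / ‖v‖) ^ m := by
  have hv0 : 0 < ‖v‖ := hv.trans_le (Complex.re_le_norm v)
  induction m with
  | zero => simp [div_self (Complex.Gamma_ne_zero_of_re_pos hv)]
  | succ m ih =>
    push_cast at hm
    have ih' := ih (by linarith)
    have hle : ‖v‖ / 2 ≤ ‖v - (m + 1 : ℕ)‖ := by
      have h1 := norm_sub_norm_le v ((m + 1 : ℕ) : ℂ)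
      rw [Complex.norm_natCast] at h1
      have h2 := Complex.re_le_norm v
      push_cast at h1 ⊢
      linarith
    have hne : v - (m + 1 : ℕ) ≠ 0 := by
      rw [← norm_pos_iff]
      linarith
    have hG : Complex.Gamma (v - m) = (v - (m + 1 : ℕ)) * Complex.Gamma (v - (m + 1 : ℕ)) := by
      rw [← Complex.Gamma_add_one _ hne]
      congr 1
      push_cast
      ring
    have e : Complex.Gamma (v - (m + 1 : ℕ)) / Complex.Gamma v
        = (Complex.Gamma (v - m) / Complex.Gamma v) / (v - (m + 1 : ℕ)) := by
      rw [hG]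
      field_simp
    rw [e, norm_div, pow_succ]
    calc ‖Complex.Gamma (v - m) / Complex.Gamma v‖ / ‖v - (m + 1 : ℕ)‖
        ≤ (2 / ‖v‖) ^ m / (‖v‖ / 2) := by gcongr
      _ = (2 / ‖v‖) ^ m * (2 / ‖v‖) := by field_simp

lemma ascPochhammer_eval_mul_Gamma {w : ℂ} (hw : 0 < w.re) (k : ℕ) :
    (ascPochhammer ℂ k).eval w * Complex.Gamma w = Complex.Gamma (w + k) := by
  rw [← Complex.Gamma_add_nat_div_Gamma_eq w, div_mul_cancel₀ _
    (Complex.Gamma_ne_zero_of_re_pos hw)]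
  rintro m rfl
  simp at hw
  linarith [(Nat.cast_nonneg m : (0 : ℝ) ≤ m)]

/-- The truncated expansion `∑_{n < N} M_n d^n Γ(z - n) / Γ(z)`. -/
noncomputable def gammaSum {d : ℕ} (lam : Fin d → ℂ) (N : ℕ) (z : ℂ) : ℂ :=
  ∑ n ∈ Finset.range N, phiCoeff lam n * (d : ℂ) ^ n * (Complex.Gamma (z - n) / Complex.Gamma z)

/-- The ratio in the functional equation of `γ(s) d^z / Γ(z)` under `z ↦ z + d`. -/
noncomputable def shiftRatio {d : ℕ} (lam : Fin d → ℂ) (z : ℂ) : ℂ :=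
  (∏ j, (z - kappa lam + d / 2 * lam j)) / (ascPochhammer ℂ d).eval z

/-- Multiply the expansion in rising factorials of `w = z - n` by `Γ(w)`, using `(w)_k Γ(w) = Γ(w +
k)`. Its term `p = 0` is `Γ(z + d - n)`, since `ν_0 = -1`. -/
lemma prod_shift_mul_Gamma {d : ℕ} (hd : 1 ≤ d) (lam : Fin d → ℂ) (n : ℕ) {z : ℂ}
    (hz : (n : ℝ) < z.re) :
    Complex.Gamma (z + d - n)
        - (∏ j, (z - kappa lam + d / 2 * lam j)) * Complex.Gamma (z - n)
      = ∑ p ∈ Finset.Icc 1 d, (d : ℂ) ^ p * (nu lam p).eval ((n : ℂ) + p - 1)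
          * Complex.Gamma (z + d - (n + p : ℕ)) := by
  have hw : 0 < (z - n : ℂ).re := by simpa using hz
  have h := prod_shift_eq_sum_nu hd lam (z - n) n
  rw [sub_add_cancel] at h
  rw [h, Finset.sum_mul, Finset.sum_range_succ', sub_add_eq_sub_sub]
  have e0 : -((d : ℂ) ^ 0 * (nu lam 0).eval ((n : ℂ) + (0 : ℕ) - 1))
      * (ascPochhammer ℂ (d - 0)).eval (z - n) * Complex.Gamma (z - n)
      = Complex.Gamma (z + d - n) := by
    rw [nu_zero_eval hd, mul_assoc, Nat.sub_zero, ascPochhammer_eval_mul_Gamma hw]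
    rw [show z - n + d = z + d - n by ring]
    simp
  rw [e0, sub_right_comm, sub_self, zero_sub, ← Finset.sum_neg_distrib]
  rw [Finset.range_eq_Ico, Finset.sum_Ico_add' (fun p => -(-((d : ℂ) ^ p *
    (nu lam p).eval ((n : ℂ) + p - 1)) * (ascPochhammer ℂ (d - p)).eval (z - n)
      * Complex.Gamma (z - n))) 0 d 1]
  refine Finset.sum_congr rfl fun p hp => ?_
  have hpd : p ≤ d := by
    have := (Finset.mem_Ico.mp hp).2
    omega
  rw [mul_assoc _ _ (Complex.Gamma (z - n)), ascPochhammer_eval_mul_Gamma hw,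
    Nat.cast_sub hpd, show z - n + ((d : ℂ) - p) = z + d - (n + p : ℕ) by push_cast; ring]
  ring

/-- Collect the terms by the index `m = n + p` of `Γ(z + d - m)`. For `m ≤ N` every `n < m` is
present and the coefficient vanishes by the recursion for `M_n`, so truncation leaves only `N < m ≤
N + d`. -/
lemma gammaSum_shift_eq {d : ℕ} (hd : 1 ≤ d) (lam : Fin d → ℂ) (N : ℕ) {z : ℂ}
    (hz : (N : ℝ) < z.re) :
    gammaSum lam N (z + d) - shiftRatio lam z * gammaSum lam N z
      = ∑ n ∈ Finset.range N, ∑ m ∈ Finset.Ioc N (N + d),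
          phiCoeff lam n * (d : ℂ) ^ m * (nu lam (m - n)).eval ((m : ℂ) - 1)
            * (Complex.Gamma (z + d - m) / Complex.Gamma (z + d)) := by
  have hz0 : 0 < z.re := (Nat.cast_nonneg N).trans_lt hz
  have hG : (ascPochhammer ℂ d).eval z * Complex.Gamma z = Complex.Gamma (z + d) :=
    ascPochhammer_eval_mul_Gamma hz0 d
  have hGz := Complex.Gamma_ne_zero_of_re_pos hz0
  have hGd : Complex.Gamma (z + d) ≠ 0 :=
    Complex.Gamma_ne_zero_of_re_pos (by simp; positivity)
  have hP : (ascPochhammer ℂ d).eval z ≠ 0 := fun h => hGd (by rw [← hG, h, zero_mul])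
  set H : ℕ → ℕ → ℂ := fun n m => phiCoeff lam n * (d : ℂ) ^ m *
    (nu lam (m - n)).eval ((m : ℂ) - 1)
      * (Complex.Gamma (z + d - m) / Complex.Gamma (z + d)) with hH
  have h1 : ∀ n ∈ Finset.range N,
      phiCoeff lam n * (d : ℂ) ^ n * (Complex.Gamma (z + d - n) / Complex.Gamma (z + d))
        - shiftRatio lam z * (phiCoeff lam n * (d : ℂ) ^ n *
          (Complex.Gamma (z - n) / Complex.Gamma z))
        = ∑ m ∈ Finset.Ioc n N, H n m + ∑ m ∈ Finset.Ioc N (N + d), H n m := by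
    intro n hn
    have hnN : n < N := by simpa using hn
    have hn' : (n : ℝ) < z.re := lt_trans (by exact_mod_cast hnN) hz
    rw [Finset.sum_Ioc_consecutive _ hnN.le (by omega)]
    have e1 : phiCoeff lam n * (d : ℂ) ^ n * (Complex.Gamma (z + d - n) / Complex.Gamma (z + d))
        - shiftRatio lam z * (phiCoeff lam n * (d : ℂ) ^ n *
          (Complex.Gamma (z - n) / Complex.Gamma z))
        = phiCoeff lam n * (d : ℂ) ^ n / Complex.Gamma (z + d) * (Complex.Gamma (z + d - n)
          - (∏ j, (z - kappa lam + d / 2 * lam j)) * Complex.Gamma (z - n)) := by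
      rw [shiftRatio, ← hG]
      field_simp
    rw [e1, prod_shift_mul_Gamma hd lam n hn', Finset.mul_sum]
    refine Finset.sum_of_injOn (fun p => n + p) (fun x _ y _ h => by simpa using h) ?_ ?_ ?_
    · intro p hp
      have := Finset.mem_Icc.mp (Finset.mem_coe.mp hp)
      simp only [Finset.coe_Ioc, Set.mem_Ioc]
      omega
    -- The range of `m` has been enlarged to be independent of `n`; the added terms have `m - n > d`
    -- and vanish with `ν_{m-n}`.
    · intro m hm hm'
      have hmm := Finset.mem_Ioc.mp hm
      have : d < m - n := by
        by_contra hcon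
        refine hm' ⟨m - n, ?_, ?_⟩
        · simp only [Finset.coe_Icc, Set.mem_Icc]
          omega
        · simp only
          omega
      simp only [hH]
      rw [nu_eq_zero_of_lt lam this]
      simp
    · intro p hp
      simp only [hH]
      rw [Nat.add_sub_cancel_left]
      push_cast
      rw [pow_add]
      ring
  have h2 : ∑ n ∈ Finset.range N, ∑ m ∈ Finset.Ioc n N, H n m = 0 := by
    rw [Finset.sum_comm' (s' := fun m => Finset.range m) (t' := Finset.Ioc 0 N)
      (by intro x y; simp only [Finset.mem_range, Finset.mem_Ioc]; omega)]
    refine Finset.sum_eq_zero fun m hm => ?_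
    obtain ⟨m, rfl⟩ := Nat.exists_eq_add_of_le' (Finset.mem_Ioc.mp hm).1
    have e := sum_nu_mul_phiCoeff hd lam m
    have e2 : ∀ n ∈ Finset.range (m + 1), H n (m + 1) = (d : ℂ) ^ (m + 1) *
        (Complex.Gamma (z + d - (m + 1 : ℕ)) / Complex.Gamma (z + d)) *
          ((nu lam (m - n + 1)).eval (m : ℂ) * phiCoeff lam n) := by
      intro n hn
      have hnm : n ≤ m := by simpa [Nat.lt_succ_iff] using hn
      simp only [hH]
      rw [show m + 1 - n = m - n + 1 by omega, Nat.cast_add_one, add_sub_cancel_right]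
      ring
    change ∑ n ∈ Finset.range (m + 1), H n (m + 1) = 0
    rw [Finset.sum_congr rfl e2, ← Finset.mul_sum, e, mul_zero]
  rw [gammaSum, gammaSum, Finset.mul_sum, ← Finset.sum_sub_distrib, Finset.sum_congr rfl h1,
    Finset.sum_add_distrib, h2, zero_add]

lemma exists_gammaSum_shift_bound {d : ℕ} (hd : 1 ≤ d) (lam : Fin d → ℂ) (N : ℕ) :
    ∃ K X : ℝ, 0 ≤ K ∧ 1 ≤ X ∧ ∀ z : ℂ, X ≤ z.re →
      ‖gammaSum lam N (z + d) - shiftRatio lam z * gammaSum lam N z‖ ≤ K / ‖z‖ ^ (N + 1) := by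
  set C : ℕ → ℕ → ℝ := fun n m =>
    ‖phiCoeff lam n * (d : ℂ) ^ m * (nu lam (m - n)).eval ((m : ℂ) - 1)‖ with hC
  refine ⟨(∑ n ∈ Finset.range N, ∑ m ∈ Finset.Ioc N (N + d), C n m) * 2 ^ (N + 1),
    -- This threshold gives `2m ≤ Re (z + d)` for all `m ≤ N + d`, and `|z| ≥ 2`, so that powers of
    -- `2/|z|` decrease.
    2 * (N + d) + 1, by positivity, ?_, fun z hz => ?_⟩
  · have h1 : (0 : ℝ) ≤ N := Nat.cast_nonneg N
    have h2 : (0 : ℝ) ≤ d := Nat.cast_nonneg d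
    linarith
  have hN0 : (0 : ℝ) ≤ N := Nat.cast_nonneg N
  have hd1 : (1 : ℝ) ≤ d := by exact_mod_cast hd
  have hz2 : 2 ≤ ‖z‖ := le_trans (by linarith) (Complex.re_le_norm z)
  rw [gammaSum_shift_eq hd lam N (by linarith)]
  refine (norm_sum_le _ _).trans ?_
  rw [mul_div_assoc, Finset.sum_mul]
  refine Finset.sum_le_sum fun n _ => (norm_sum_le _ _).trans ?_
  rw [Finset.sum_mul]
  refine Finset.sum_le_sum fun m hm => ?_
  have hmm := Finset.mem_Ioc.mp hm
  rw [norm_mul]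
  refine mul_le_mul_of_nonneg_left ?_ (norm_nonneg _)
  have hre : 0 < (z + d : ℂ).re := by simp; linarith
  have hmr : (m : ℝ) ≤ N + d := by exact_mod_cast hmm.2
  refine (norm_Gamma_sub_nat_div_le hre m (by simp; linarith)).trans ?_
  have hle : ‖z‖ ≤ ‖z + d‖ := by
    have := norm_le_norm_add_ofReal (z := z) (by linarith) (Nat.cast_nonneg d)
    simpa using this
  calc (2 / ‖z + d‖) ^ m ≤ (2 / ‖z‖) ^ m := by gcongr
    _ ≤ (2 / ‖z‖) ^ (N + 1) :=
      pow_le_pow_of_le_one (by positivity) ((div_le_one (by linarith)).mpr hz2) hmm.1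
    _ = 2 ^ (N + 1) / ‖z‖ ^ (N + 1) := div_pow _ _ _

lemma gammaSum_one {d : ℕ} (lam : Fin d → ℂ) {z : ℂ} (hz : 0 < z.re) : gammaSum lam 1 z = 1 := by
  simp [gammaSum, phiCoeff, div_self (Complex.Gamma_ne_zero_of_re_pos hz)]

lemma tendsto_gammaSum {d : ℕ} (hd : 1 ≤ d) (lam : Fin d → ℂ) {N : ℕ} (hN : 1 ≤ N) {z : ℂ}
    (hz : 0 < z.re) :
    Tendsto (fun k : ℕ => gammaSum lam N (z + d * k)) atTop (𝓝 1) := by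
  have hnorm : Tendsto (fun k : ℕ => ‖z + (d : ℂ) * k‖) atTop atTop := by
    refine tendsto_atTop_mono (fun k => ?_) tendsto_natCast_atTop_atTop
    refine le_trans ?_ (Complex.re_le_norm _)
    have hd1 : (1 : ℝ) ≤ d := by exact_mod_cast hd
    simp
    nlinarith [(Nat.cast_nonneg k : (0 : ℝ) ≤ k)]
  have hre : Tendsto (fun k : ℕ => (z + (d : ℂ) * k).re) atTop atTop := by
    refine tendsto_atTop_mono (fun k => ?_) tendsto_natCast_atTop_atTop
    have hd1 : (1 : ℝ) ≤ d := by exact_mod_cast hd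
    simp
    nlinarith [(Nat.cast_nonneg k : (0 : ℝ) ≤ k)]
  have hterm : ∀ n : ℕ, Tendsto (fun k : ℕ => Complex.Gamma (z + d * k - n) /
      Complex.Gamma (z + d * k)) atTop (𝓝 (if n = 0 then 1 else 0)) := by
    intro n
    split_ifs with hn
    · subst hn
      refine tendsto_const_nhds.congr' ?_
      filter_upwards [hre.eventually_gt_atTop 0] with k hk
      simp [div_self (Complex.Gamma_ne_zero_of_re_pos hk)]
    · have h0 : Tendsto (fun k : ℕ => (2 / ‖z + (d : ℂ) * k‖) ^ n) atTop (𝓝 0) := by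
        have := (tendsto_const_nhds (x := (2 : ℝ))).div_atTop hnorm |>.pow n
        rwa [zero_pow hn] at this
      refine squeeze_zero_norm' ?_ h0
      filter_upwards [hre.eventually_gt_atTop 0, hre.eventually_ge_atTop (2 * n)] with k hk hk2
      exact norm_Gamma_sub_nat_div_le hk n hk2
  have := tendsto_finsetSum (Finset.range N) fun n _ =>
    (hterm n).const_mul (phiCoeff lam n * (d : ℂ) ^ n)
  have e : ∑ n ∈ Finset.range N, phiCoeff lam n * (d : ℂ) ^ n * (if n = 0 then 1 else 0) = 1 := by
    simp [phiCoeff]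
    omega
  rw [e] at this
  exact this

/-- A solution `q` of `q(z + d) = r(z) q(z)` with limit `c` along `z + dℕ` is approximated by
`c ∑_{n < N} M_n d^n Γ(z - n) / Γ(z)` uniformly in a right half-plane. -/
lemma exists_sub_gammaSum_bound {d : ℕ} (hd : 1 ≤ d) (lam : Fin d → ℂ) {q : ℂ → ℂ} {c : ℂ}
    {X₀ : ℝ} (hc : c ≠ 0) (hq0 : ∀ z : ℂ, X₀ ≤ z.re → q z ≠ 0)
    (hq : ∀ z : ℂ, X₀ ≤ z.re → q (z + d) = shiftRatio lam z * q z)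
    (hL : ∀ z : ℂ, X₀ ≤ z.re → Tendsto (fun k : ℕ => q (z + d * k)) atTop (𝓝 c))
    {N : ℕ} (hN : 1 ≤ N) :
    ∃ K X : ℝ, 0 ≤ K ∧ 1 ≤ X ∧ ∀ z : ℂ, X ≤ z.re →
      ‖q z - c * gammaSum lam N z‖ ≤ K / ‖z‖ ^ N := by
  -- For `N = 1` the truncated sum is `1`, so this bound says `r(z) = 1 + O(z^{-2})`.
  obtain ⟨K₁, X₁, hK₁, hX₁, h₁⟩ := exists_gammaSum_shift_bound hd lam 1
  have hr : ∀ z : ℂ, max X₀ X₁ ≤ z.re → ‖shiftRatio lam z - 1‖ ≤ K₁ / ‖z‖ ^ 2 := by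
    intro z hz
    have hz1 : 0 < z.re := by linarith [(le_max_right X₀ X₁).trans hz]
    have h := h₁ z ((le_max_right _ _).trans hz)
    rw [gammaSum_one lam hz1, gammaSum_one lam (by simp; positivity), mul_one, norm_sub_rev] at h
    exact h
  obtain ⟨A, X₂, hA, hX₂, h₂⟩ := exists_bounds_of_ratio hd (hX₁.trans (le_max_right X₀ X₁)) hK₁ hc
    (fun z hz => hq0 z ((le_max_left _ _).trans hz))
    (fun z hz => hq z ((le_max_left _ _).trans hz)) hr
    (fun z hz => hL z ((le_max_left _ _).trans hz))
  obtain ⟨K₃, X₃, hK₃, hX₃, h₃⟩ := exists_gammaSum_shift_bound hd lam N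
  set X := max X₂ X₃ with hX
  have hX0 : X₀ ≤ X := (le_max_left _ _).trans (hX₂.trans (le_max_left _ _))
  have hX1 : 1 ≤ X := hX₃.trans (le_max_right _ _)
  -- Dividing by the exact solution `q` removes the factor `r`: the defect in the functional
  -- equation becomes the increment of the quotient.
  have hρ : ∀ z : ℂ, X ≤ z.re →
      ‖gammaSum lam N (z + d) / q (z + d) - gammaSum lam N z / q z‖
        ≤ (K₃ * A) / ‖z‖ ^ (N + 1) := by
    intro z hz
    have hzd : X ≤ (z + d : ℂ).re := by
      simp
      linarith [(Nat.cast_nonneg d : (0 : ℝ) ≤ d)]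
    have hqz := hq0 z (hX0.trans hz)
    have hqd := hq0 _ (hX0.trans hzd)
    have e : gammaSum lam N (z + d) / q (z + d) - gammaSum lam N z / q z
        = (gammaSum lam N (z + d) - shiftRatio lam z * gammaSum lam N z) / q (z + d) := by
      have hs : shiftRatio lam z = q (z + d) / q z := by
        rw [hq z (hX0.trans hz)]
        field_simp
      rw [hs]
      field_simp
    rw [e, norm_div, div_eq_mul_inv, mul_div_right_comm]
    exact mul_le_mul (h₃ z ((le_max_right _ _).trans hz))
      (h₂ _ ((le_max_left _ _).trans hzd)).2 (by positivity) (by positivity)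
  refine ⟨‖c‖ * A * (K₃ * A * 2 ^ (N + 2)), X, by positivity, hX1, fun z hz => ?_⟩
  have hqz := hq0 z (hX0.trans hz)
  have hlim := norm_sub_limit_le (ρ := fun z => gammaSum lam N z / q z) hd hN hX1
    (by positivity) hρ hz
    ((tendsto_gammaSum hd lam hN (by linarith)).div (hL z (hX0.trans hz)) hc)
  have e : q z - c * gammaSum lam N z = -(c * q z) * (gammaSum lam N z / q z - 1 / c) := by
    field_simp
    ring
  rw [e, norm_mul, norm_neg, norm_mul, mul_div_assoc]
  gcongr
  exact (h₂ z ((le_max_left _ _).trans hz)).1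

/-! ### The limit of the Gamma ratio -/

/-- By `Γ(w + n + 1) = (w)_{n+1} Γ(w)` the quotient equals `Γ(w)` divided by the `n`-th term of
Euler's limit for `Γ(w)`. -/
lemma tendsto_Gamma_div_cpow_mul_factorial {w : ℂ} (hw : 0 < w.re) :
    Tendsto (fun n : ℕ => Complex.Gamma (w + (n + 1)) / ((n : ℂ) ^ w * (n.factorial : ℂ)))
      atTop (𝓝 1) := by
  have hG := Complex.Gamma_ne_zero_of_re_pos hw
  have h1 : Tendsto (fun n : ℕ => Complex.Gamma w / Complex.GammaSeq w n) atTop (𝓝 1) := by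
    have := (tendsto_const_nhds (x := Complex.Gamma w)).div
      (Complex.GammaSeq_tendsto_Gamma w) hG
    rwa [div_self hG] at this
  refine h1.congr fun n => ?_
  have hp : ∀ m : ℕ, (ascPochhammer ℂ m).eval w = ∏ j ∈ Finset.range m, (w + j) := by
    intro m
    induction m with
    | zero => simp
    | succ m ih => rw [ascPochhammer_eval_succ', ih, Finset.prod_range_succ]
  have h2 := ascPochhammer_eval_mul_Gamma hw (n + 1)
  push_cast at h2
  rw [← h2, hp, Complex.GammaSeq, div_div_eq_mul_div, mul_comm]

/-- With `d = e + 1`, this is `S(n)^d / S(dn)` up to a constant factor, where `S(n) = n!/(√(2n)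
(n/e)^n)` (here `e` is Euler's number) tends to `√π` by Stirling's formula. -/
lemma tendsto_factorial_pow_div (e : ℕ) :
    Tendsto (fun n : ℕ => ((e + 1 : ℕ) : ℝ) ^ ((e + 1) * n + 1) * (n.factorial : ℝ) ^ (e + 1)
        / ((((e + 1) * n).factorial : ℝ) * Real.sqrt n ^ e)) atTop
      (𝓝 (Real.sqrt ((e + 1 : ℕ) : ℝ) * Real.sqrt (2 * Real.pi) ^ e)) := by
  set d : ℕ := e + 1 with hd
  have hS := Stirling.tendsto_stirlingSeq_sqrt_pi
  have hdn : Tendsto (fun n : ℕ => d * n) atTop atTop :=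
    tendsto_id.const_mul_atTop' (by omega)
  have hpi : Real.sqrt Real.pi ≠ 0 := (Real.sqrt_pos.mpr Real.pi_pos).ne'
  have h1 := ((hS.pow d).div (hS.comp hdn) hpi).mul_const
    (Real.sqrt (d : ℝ) * Real.sqrt 2 ^ e)
  have e1 : Real.sqrt Real.pi ^ d / Real.sqrt Real.pi * (Real.sqrt (d : ℝ) * Real.sqrt 2 ^ e)
      = Real.sqrt (d : ℝ) * Real.sqrt (2 * Real.pi) ^ e := by
    rw [Real.sqrt_mul zero_le_two, mul_pow, hd, pow_succ]
    field_simp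
  rw [e1] at h1
  refine h1.congr' ?_
  filter_upwards [eventually_ge_atTop 1] with n hn
  have hn0 : (0 : ℝ) < n := by exact_mod_cast hn
  have hd0 : (0 : ℝ) < d := by exact_mod_cast (by omega : 0 < d)
  have hsn : 0 < Real.sqrt n := Real.sqrt_pos.mpr hn0
  have hsd : 0 < Real.sqrt d := Real.sqrt_pos.mpr hd0
  have hsd2 : Real.sqrt d * Real.sqrt d = d := Real.mul_self_sqrt hd0.le
  have hs2 : 0 < Real.sqrt 2 := Real.sqrt_pos.mpr two_pos
  have hf : ((d * n).factorial : ℝ) ≠ 0 := by exact_mod_cast (d * n).factorial_ne_zero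
  simp only [Stirling.stirlingSeq, Function.comp_apply, Pi.div_apply]
  push_cast
  rw [Real.sqrt_mul zero_le_two, Real.sqrt_mul zero_le_two, Real.sqrt_mul hd0.le]
  have e2 : ((n : ℝ) / Real.exp 1) ^ (d * n) ≠ 0 := by positivity
  have e3 : ((d : ℝ) * n / Real.exp 1) ^ (d * n)
      = (d : ℝ) ^ (d * n) * ((n : ℝ) / Real.exp 1) ^ (d * n) := by
    rw [← mul_pow]
    congr 1
    ring
  have e4 : (Real.sqrt 2 * Real.sqrt n * ((n : ℝ) / Real.exp 1) ^ n) ^ d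
      = Real.sqrt 2 ^ e * Real.sqrt 2 * (Real.sqrt n ^ e * Real.sqrt n)
        * ((n : ℝ) / Real.exp 1) ^ (d * n) := by
    rw [mul_pow, mul_pow, ← pow_mul, mul_comm n d, ← pow_succ, ← pow_succ]
  rw [e3, div_pow, e4]
  generalize ((n : ℝ) / Real.exp 1) ^ (d * n) = E at e2
  rw [pow_succ (d : ℝ)]
  field_simp
  rw [Real.sq_sqrt hd0.le]

/-- The function `∏_j Γ((z - κ)/d + λ_j/2) d^z / Γ(z)`; the numerator is `γ(s)` for
`z = ds/2 + κ`. -/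
noncomputable def gammaRatio {d : ℕ} (lam : Fin d → ℂ) (z : ℂ) : ℂ :=
  (∏ j, Complex.Gamma ((z - kappa lam) / d + lam j / 2)) * (d : ℂ) ^ z / Complex.Gamma z

lemma exists_re_pos {d : ℕ} (hd : 1 ≤ d) (lam : Fin d → ℂ) :
    ∃ X : ℝ, 1 ≤ X ∧ ∀ z : ℂ, X ≤ z.re → ∀ j, 1 ≤ ((z - kappa lam) / d + lam j / 2).re := by
  refine ⟨1 + |(kappa lam).re| + d * (1 + ∑ j, |(lam j).re|), ?_, fun z hz j => ?_⟩
  · have : 0 ≤ |(kappa lam).re| + d * (1 + ∑ j, |(lam j).re|) := by positivity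
    linarith
  · have hd1 : (1 : ℝ) ≤ d := by exact_mod_cast hd
    have h1 : |(lam j).re| ≤ ∑ j, |(lam j).re| :=
      Finset.single_le_sum (f := fun j => |(lam j).re|) (fun _ _ => abs_nonneg _)
        (Finset.mem_univ j)
    have h2 := neg_abs_le (lam j).re
    have h3 := le_abs_self (kappa lam).re
    have h4 : 1 + ∑ j, |(lam j).re| ≤ (z.re - (kappa lam).re) / d := by
      rw [le_div_iff₀ (by linarith)]
      linarith
    have h6 := abs_nonneg (lam j).re
    have h5 : ((z - kappa lam) / d + lam j / 2).re
        = (z.re - (kappa lam).re) / d + (lam j).re / 2 := by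
      simp [Complex.div_natCast_re]
    rw [h5]
    linarith

lemma gammaRatio_ne_zero {d : ℕ} (hd : 1 ≤ d) (lam : Fin d → ℂ) {z : ℂ} (hz : 0 < z.re)
    (h : ∀ j, 0 < ((z - kappa lam) / d + lam j / 2).re) : gammaRatio lam z ≠ 0 := by
  have hd0 : (d : ℂ) ≠ 0 := by exact_mod_cast (by omega : d ≠ 0)
  refine div_ne_zero (mul_ne_zero ?_ ?_) (Complex.Gamma_ne_zero_of_re_pos hz)
  · exact Finset.prod_ne_zero_iff.mpr fun j _ => Complex.Gamma_ne_zero_of_re_pos (h j)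
  · rw [Complex.cpow_ne_zero_iff_of_exponent_ne_zero]
    · exact hd0
    · rintro rfl
      simp at hz

lemma gammaRatio_add {d : ℕ} (hd : 1 ≤ d) (lam : Fin d → ℂ) {z : ℂ} (hz : 0 < z.re)
    (h : ∀ j, 0 < ((z - kappa lam) / d + lam j / 2).re) :
    gammaRatio lam (z + d) = shiftRatio lam z * gammaRatio lam z := by
  have hd0 : (d : ℂ) ≠ 0 := by exact_mod_cast (by omega : d ≠ 0)
  have h1 : ∏ j, Complex.Gamma ((z + d - kappa lam) / d + lam j / 2)
      = (∏ j, ((z - kappa lam) / d + lam j / 2))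
        * ∏ j, Complex.Gamma ((z - kappa lam) / d + lam j / 2) := by
    rw [← Finset.prod_mul_distrib]
    refine Finset.prod_congr rfl fun j _ => ?_
    rw [← Complex.Gamma_add_one]
    · congr 1
      field_simp
      ring
    · intro h0
      have := h j
      rw [h0] at this
      simp at this
  have h2 : ∏ j, (z - kappa lam + d / 2 * lam j)
      = (d : ℂ) ^ d * ∏ j, ((z - kappa lam) / d + lam j / 2) := by
    rw [← Fin.prod_const, ← Finset.prod_mul_distrib]
    refine Finset.prod_congr rfl fun j _ => ?_
    field_simp
  rw [gammaRatio, gammaRatio, shiftRatio, h1, h2, ← ascPochhammer_eval_mul_Gamma hz,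
    Complex.cpow_add _ _ hd0, Complex.cpow_natCast]
  ring

/-- This identity is what determines `κ`: it makes the powers of `n` cancel in the limit of
`gammaRatio` along `z + dn`. -/
lemma sum_shift_eq {d : ℕ} (hd : 1 ≤ d) (lam : Fin d → ℂ) (z : ℂ) :
    ∑ j, ((z - kappa lam) / d + lam j / 2) = z + (d - 1) / 2 := by
  have hd0 : (d : ℂ) ≠ 0 := by exact_mod_cast (by omega : d ≠ 0)
  rw [Finset.sum_add_distrib, Finset.sum_const, ← Finset.sum_div, Finset.card_univ,
    Fintype.card_fin, nsmul_eq_mul, kappa]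
  field_simp
  ring

lemma natCast_cpow_half_mul (n e : ℕ) : (n : ℂ) ^ ((e : ℂ) / 2) = ((Real.sqrt n ^ e : ℝ) : ℂ) := by
  rw [div_eq_mul_inv, Complex.cpow_nat_mul, Complex.ofReal_pow, Real.sqrt_eq_rpow,
    Complex.ofReal_cpow (Nat.cast_nonneg n)]
  norm_num

lemma asympConst_mul_self {d : ℕ} (hd : 1 ≤ d) :
    asympConst d * d = Real.sqrt (d : ℝ) * Real.sqrt (2 * Real.pi) ^ (d - 1) := by
  have hd0 : (0 : ℝ) < d := by exact_mod_cast hd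
  have hs : Real.sqrt d ≠ 0 := (Real.sqrt_pos.mpr hd0).ne'
  have h2 : (2 * Real.pi) ^ (((d : ℝ) - 1) / 2) = Real.sqrt (2 * Real.pi) ^ (d - 1) := by
    rw [Real.sqrt_eq_rpow, ← Real.rpow_natCast, ← Real.rpow_mul (by positivity),
      Nat.cast_sub hd]
    congr 1
    push_cast
    ring
  rw [asympConst, h2]
  nth_rewrite 2 [← Real.mul_self_sqrt hd0.le]
  field_simp

lemma tendsto_gammaRatio {d : ℕ} (hd : 1 ≤ d) (lam : Fin d → ℂ) {z : ℂ} (hz : 0 < z.re)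
    (h : ∀ j, 0 < ((z - kappa lam) / d + lam j / 2).re) :
    Tendsto (fun k : ℕ => gammaRatio lam (z + d * k)) atTop
      (𝓝 ((asympConst d * d : ℝ) : ℂ)) := by
  obtain ⟨e, hde⟩ := Nat.exists_eq_add_of_le' hd
  have hdeC : (d : ℂ) = e + 1 := by rw [hde]; push_cast; ring
  have hd0 : (d : ℂ) ≠ 0 := by exact_mod_cast (by omega : d ≠ 0)
  -- At index `n + 1` the numerator consists of `Γ(w_j + n + 1)` and the denominator is `Γ(z' + dn +
  -- 1)` with `z' = z + d - 1`, so Euler's limit applies to all of them.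
  rw [← tendsto_add_atTop_iff_nat 1]
  set w : Fin d → ℂ := fun j => (z - kappa lam) / d + lam j / 2 with hw
  set z' : ℂ := z + e with hz'
  have hz'0 : 0 < z'.re := by
    simp [hz']
    positivity
  set E : ℂ → ℕ → ℂ := fun w n =>
    Complex.Gamma (w + (n + 1)) / ((n : ℂ) ^ w * (n.factorial : ℂ)) with hE
  have hE1 : ∀ w : ℂ, 0 < w.re → Tendsto (E w) atTop (𝓝 1) :=
    fun w hw => tendsto_Gamma_div_cpow_mul_factorial hw
  have hdn : Tendsto (fun n : ℕ => d * n) atTop atTop :=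
    tendsto_id.const_mul_atTop' (by omega)
  have hfac := (Complex.continuous_ofReal.tendsto _).comp (tendsto_factorial_pow_div e)
  rw [← hde] at hfac
  have hlim := ((tendsto_finsetProd Finset.univ fun j _ => hE1 (w j) (h j)).div
    ((hE1 z' hz'0).comp hdn) one_ne_zero).mul hfac
  have e0 : asympConst d * d = Real.sqrt (d : ℝ) * Real.sqrt (2 * Real.pi) ^ e := by
    rw [asympConst_mul_self hd, hde, Nat.add_sub_cancel]
  rw [Finset.prod_const_one, div_one, one_mul, ← e0] at hlim
  refine hlim.congr' ?_
  filter_upwards [eventually_ge_atTop 1] with n hn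
  have hn0 : (n : ℂ) ≠ 0 := by exact_mod_cast (by omega : n ≠ 0)
  have hfn : (n.factorial : ℂ) ≠ 0 := by exact_mod_cast n.factorial_ne_zero
  have hGw : ∀ j, Complex.Gamma ((z + d * (n + 1 : ℕ) - kappa lam) / d + lam j / 2)
      = E (w j) n * ((n : ℂ) ^ w j * (n.factorial : ℂ)) := by
    intro j
    simp only [hE]
    rw [div_mul_cancel₀ _ (mul_ne_zero ?_ hfn)]
    · congr 1
      simp only [hw]
      push_cast
      field_simp
      ring
    · rw [Complex.cpow_ne_zero_iff_of_exponent_ne_zero]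
      · exact hn0
      · intro h0
        have := h j
        simp only [hw] at h0
        rw [h0] at this
        simp at this
  have hGz : Complex.Gamma (z + d * (n + 1 : ℕ))
      = E z' (d * n) * (((d * n : ℕ) : ℂ) ^ z' * ((d * n).factorial : ℂ)) := by
    simp only [hE]
    rw [div_mul_cancel₀ _ (mul_ne_zero ?_ ?_)]
    · congr 1
      push_cast
      rw [hz', hdeC]
      ring
    · rw [Complex.cpow_ne_zero_iff_of_exponent_ne_zero]
      · push_cast
        exact mul_ne_zero hd0 hn0
      · rintro h0
        rw [h0] at hz'0
        simp at hz'0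
    · exact_mod_cast (d * n).factorial_ne_zero
  have hsum : ∏ j, (n : ℂ) ^ w j = (n : ℂ) ^ z' / ((Real.sqrt n ^ e : ℝ) : ℂ) := by
    simp_rw [Complex.cpow_def_of_ne_zero hn0 (w _)]
    rw [← Complex.exp_sum, ← Finset.mul_sum, ← Complex.cpow_def_of_ne_zero hn0,
      sum_shift_eq hd, ← natCast_cpow_half_mul,
      ← Complex.cpow_sub _ _ hn0]
    congr 1
    rw [hz', hdeC]
    ring
  have hdpow : (d : ℂ) ^ (z + d * (n + 1 : ℕ)) = (d : ℂ) ^ z' * (d : ℂ) ^ (d * n + 1) := by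
    rw [← Complex.cpow_natCast, ← Complex.cpow_add _ _ hd0]
    congr 1
    rw [hz']
    push_cast
    linear_combination hdeC
  have hmul : ((d * n : ℕ) : ℂ) ^ z' = (d : ℂ) ^ z' * (n : ℂ) ^ z' := by
    push_cast
    exact Complex.natCast_mul_natCast_cpow d n z'
  have hnz : (n : ℂ) ^ z' ≠ 0 := by
    rw [Complex.cpow_def_of_ne_zero hn0]; exact Complex.exp_ne_zero _
  have hdz : (d : ℂ) ^ z' ≠ 0 := by
    rw [Complex.cpow_def_of_ne_zero hd0]; exact Complex.exp_ne_zero _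
  rw [gammaRatio, Finset.prod_congr rfl fun j _ => hGw j, Finset.prod_mul_distrib,
    Finset.prod_mul_distrib, hsum, hGz, hdpow, hmul, Finset.prod_const, Finset.card_univ,
    Fintype.card_fin]
  simp only [Function.comp_apply, Pi.div_apply]
  push_cast
  field_simp

/-- The expansion of the Gamma factor, uniformly in a right half-plane. -/
lemma exists_gammaRatio_sub_bound {d : ℕ} (hd : 1 ≤ d) (lam : Fin d → ℂ) {N : ℕ} (hN : 1 ≤ N) :
    ∃ K X : ℝ, 0 ≤ K ∧ 1 ≤ X ∧ ∀ z : ℂ, X ≤ z.re →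
      ‖gammaRatio lam z - (asympConst d * d : ℝ) * gammaSum lam N z‖ ≤ K / ‖z‖ ^ N := by
  obtain ⟨X, hX, h⟩ := exists_re_pos hd lam
  have hpos : ∀ z : ℂ, X ≤ z.re → ∀ j, 0 < ((z - kappa lam) / d + lam j / 2).re :=
    fun z hz j => zero_lt_one.trans_le (h z hz j)
  have hd0 : (0 : ℝ) < d := by exact_mod_cast hd
  refine exists_sub_gammaSum_bound hd lam (X₀ := X) ?_
    (fun z hz => gammaRatio_ne_zero hd lam (by linarith) (hpos z hz))
    (fun z hz => gammaRatio_add hd lam (by linarith) (hpos z hz))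
    (fun z hz => tendsto_gammaRatio hd lam (by linarith) (hpos z hz)) hN
  rw [asympConst_mul_self hd]
  have := Real.pi_pos
  exact_mod_cast (by positivity :
    (0 : ℝ) < Real.sqrt (d : ℝ) * Real.sqrt (2 * Real.pi) ^ (d - 1)).ne'

/-! ### Bounds for the Gamma factor on vertical lines -/

lemma norm_Gamma_le_Gamma_re {z : ℂ} (hz : 0 < z.re) : ‖Complex.Gamma z‖ ≤ Real.Gamma z.re := by
  rw [Complex.Gamma_eq_integral hz, Real.Gamma_eq_integral hz, Complex.GammaIntegral]
  refine (norm_integral_le_integral_norm _).trans (le_of_eq ?_)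
  refine setIntegral_congr_fun measurableSet_Ioi fun x hx => ?_
  simp only [norm_mul, Complex.norm_real, Real.norm_eq_abs, Real.abs_exp]
  rw [Complex.norm_cpow_eq_rpow_re_of_pos hx]
  simp

/-- Two applications of the functional equation give quadratic decay on vertical lines. This is
enough for every integrability statement and makes complex Stirling estimates unnecessary. -/
lemma norm_Gamma_le_div_sq {z : ℂ} (hz : 0 < z.re) :
    ‖Complex.Gamma z‖ ≤ Real.Gamma (z.re + 2) / ‖z‖ ^ 2 := by
  have hz0 : z ≠ 0 := by rintro rfl; simp at hz
  have hz1 : z + 1 ≠ 0 := by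
    intro h
    have := congrArg Complex.re h
    simp at this
    linarith
  have hG : Complex.Gamma (z + 2) = (z + 1) * (z * Complex.Gamma z) := by
    rw [← Complex.Gamma_add_one z hz0, ← Complex.Gamma_add_one _ hz1]
    congr 1
    ring
  have h1 : ‖Complex.Gamma (z + 2)‖ ≤ Real.Gamma (z.re + 2) := by
    have := norm_Gamma_le_Gamma_re (z := z + 2) (by simp; linarith)
    simpa using this
  have h2 : ‖z‖ ≤ ‖z + 1‖ := by
    have := norm_le_norm_add_ofReal hz.le zero_le_one
    simpa using this
  have hn : 0 < ‖z‖ := norm_pos_iff.mpr hz0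
  rw [hG, norm_mul, norm_mul] at h1
  rw [le_div_iff₀ (by positivity)]
  calc ‖Complex.Gamma z‖ * ‖z‖ ^ 2 = ‖z‖ * (‖z‖ * ‖Complex.Gamma z‖) := by ring
    _ ≤ ‖z + 1‖ * (‖z‖ * ‖Complex.Gamma z‖) := by gcongr
    _ ≤ _ := h1

lemma exists_norm_Gamma_half_le {a b : ℝ} (l : ℂ) (ha : 0 < a + l.re) :
    ∃ C : ℝ, 0 ≤ C ∧ ∀ s : ℂ, a ≤ s.re → s.re ≤ b →
      ‖Complex.Gamma ((s + l) / 2)‖ ≤ C * (1 + s.im ^ 2)⁻¹ := by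
  set α : ℝ := (a + l.re) / 2 with hα
  set β : ℝ := (b + l.re) / 2 with hβ
  have hα0 : 0 < α := by positivity
  have hcont : ContinuousOn (fun x : ℝ => Real.Gamma (x + 2)) (Set.Icc α β) := by
    intro x hx
    refine ContinuousAt.continuousWithinAt ?_
    have h1 : ContinuousAt Real.Gamma (x + 2) := by
      refine (Real.differentiableAt_Gamma fun m => ?_).continuousAt
      have : (0 : ℝ) ≤ m := Nat.cast_nonneg m
      have := hx.1
      linarith
    exact ContinuousAt.comp (f := fun x : ℝ => x + 2) h1 (by fun_prop)
  obtain ⟨B, hB⟩ := isCompact_Icc.exists_bound_of_continuousOn hcont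
  -- From `Im s = 2 Im w - Im l` one gets `(Im s)^2 ≤ 8|w|^2 + 2(Im l)^2`; the remaining constant is
  -- absorbed through `α ≤ Re w ≤ |w|`.
  set Q : ℝ := 8 + (1 + 2 * l.im ^ 2) / α ^ 2 with hQ
  refine ⟨|B| * Q, by positivity, fun s h1 h2 => ?_⟩
  set w : ℂ := (s + l) / 2 with hw
  have hwre : w.re = (s.re + l.re) / 2 := by simp [hw]
  have hwim : w.im = (s.im + l.im) / 2 := by simp [hw]
  have hwα : α ≤ w.re := by rw [hwre]; linarith
  have hwβ : w.re ≤ β := by rw [hwre]; linarith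
  have hwpos : 0 < w.re := by linarith
  have hwn : 0 < ‖w‖ := hwpos.trans_le (Complex.re_le_norm w)
  have hBw : Real.Gamma (w.re + 2) ≤ |B| :=
    (le_abs_self _).trans ((hB w.re ⟨hwα, hwβ⟩).trans (le_abs_self B))
  have hsq : ‖w‖ ^ 2 = w.re ^ 2 + w.im ^ 2 := by
    rw [Complex.sq_norm, Complex.normSq_apply]; ring
  have hQw : 1 + s.im ^ 2 ≤ Q * ‖w‖ ^ 2 := by
    have e1 : s.im = 2 * w.im - l.im := by rw [hwim]; ring
    have e2 : (1 + 2 * l.im ^ 2) ≤ (1 + 2 * l.im ^ 2) / α ^ 2 * ‖w‖ ^ 2 := by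
      rw [div_mul_eq_mul_div, le_div_iff₀ (by positivity)]
      have : α ^ 2 ≤ ‖w‖ ^ 2 := by
        rw [hsq]
        nlinarith [sq_nonneg w.im]
      gcongr
    have e3 : s.im ^ 2 ≤ 8 * ‖w‖ ^ 2 + 2 * l.im ^ 2 := by
      rw [e1, hsq]
      nlinarith [sq_nonneg (2 * w.im + l.im), sq_nonneg w.re]
    rw [hQ, add_mul]
    linarith
  refine (norm_Gamma_le_div_sq hwpos).trans ?_
  have h3 : (0 : ℝ) < 1 + s.im ^ 2 := by positivity
  rw [div_le_iff₀ (by positivity), mul_assoc, mul_assoc]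
  calc Real.Gamma (w.re + 2) ≤ |B| * 1 := by rw [mul_one]; exact hBw
    _ ≤ |B| * (Q * ((1 + s.im ^ 2)⁻¹ * ‖w‖ ^ 2)) := by
      gcongr
      rw [mul_left_comm, inv_mul_eq_div, le_div_iff₀ h3, one_mul]
      exact hQw

lemma exists_norm_gammaFactor_le {d : ℕ} (hd : 1 ≤ d) (lam : Fin d → ℂ) {a b : ℝ}
    (ha : ∀ j, 0 < a + (lam j).re) :
    ∃ C : ℝ, 0 ≤ C ∧ ∀ s : ℂ, a ≤ s.re → s.re ≤ b →
      ‖gammaFactor lam s‖ ≤ C * (1 + s.im ^ 2)⁻¹ := by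
  choose C hC h using fun j => exists_norm_Gamma_half_le (b := b) (lam j) (ha j)
  refine ⟨∏ j, C j, Finset.prod_nonneg fun j _ => hC j, fun s h1 h2 => ?_⟩
  have h3 : (0 : ℝ) < (1 + s.im ^ 2)⁻¹ := by positivity
  have h4 : (1 + s.im ^ 2)⁻¹ ≤ 1 := inv_le_one_of_one_le₀ (by nlinarith [sq_nonneg s.im])
  rw [gammaFactor, norm_prod]
  calc ∏ j, ‖Complex.Gamma ((s + lam j) / 2)‖ ≤ ∏ j, C j * (1 + s.im ^ 2)⁻¹ :=
        Finset.prod_le_prod (fun _ _ => norm_nonneg _) fun j _ => h j s h1 h2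
    _ = (∏ j, C j) * ((1 + s.im ^ 2)⁻¹) ^ d := by
      rw [Finset.prod_mul_distrib, Fin.prod_const]
    _ ≤ (∏ j, C j) * (1 + s.im ^ 2)⁻¹ := by
      refine mul_le_mul_of_nonneg_left ?_ (Finset.prod_nonneg fun j _ => hC j)
      exact pow_le_of_le_one h3.le h4 (by omega)

lemma differentiableAt_gammaFactor {d : ℕ} (lam : Fin d → ℂ) {s : ℂ}
    (hs : ∀ j, 0 < s.re + (lam j).re) : DifferentiableAt ℂ (gammaFactor lam) s := by
  unfold gammaFactor
  refine DifferentiableAt.fun_finsetProd fun j _ => ?_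
  have h1 : DifferentiableAt ℂ Complex.Gamma ((s + lam j) / 2) := by
    refine Complex.differentiableAt_Gamma _ fun m h => ?_
    have := congrArg Complex.re h
    simp at this
    have := hs j
    have : (0 : ℝ) ≤ m := Nat.cast_nonneg m
    linarith
  exact DifferentiableAt.comp (f := fun s => (s + lam j) / 2) s h1 (by fun_prop)

/-! ### Shifting a vertical contour -/

lemma integrable_vertical_of_bound {f : ℂ → ℂ} {σ C : ℝ}
    (hf : ∀ s : ℂ, s.re = σ → DifferentiableAt ℂ f s)
    (hb : ∀ s : ℂ, s.re = σ → ‖f s‖ ≤ C * (1 + s.im ^ 2)⁻¹) :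
    Integrable fun y : ℝ => f (σ + y * Complex.I) := by
  have hcont : Continuous fun y : ℝ => f (σ + y * Complex.I) := by
    rw [continuous_iff_continuousAt]
    intro y
    exact ContinuousAt.comp (f := fun y : ℝ => (σ : ℂ) + y * Complex.I)
      (hf _ (by simp)).continuousAt (by fun_prop)
  refine Integrable.mono' (integrable_inv_one_add_sq.const_mul C) hcont.aestronglyMeasurable
    (Eventually.of_forall fun y => ?_)
  simpa using hb (σ + y * Complex.I) (by simp)

/-- Cauchy's theorem on the rectangle of height `2T`; its horizontal sides contribute `O(T^{-2})`.
-/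
lemma integral_vertical_eq {f : ℂ → ℂ} {σ σ' C : ℝ} (hσ : σ ≤ σ')
    (hf : ∀ s : ℂ, σ ≤ s.re → s.re ≤ σ' → DifferentiableAt ℂ f s)
    (hb : ∀ s : ℂ, σ ≤ s.re → s.re ≤ σ' → ‖f s‖ ≤ C * (1 + s.im ^ 2)⁻¹) :
    ∫ y : ℝ, f (σ + y * Complex.I) = ∫ y : ℝ, f (σ' + y * Complex.I) := by
  have hi : Integrable fun y : ℝ => f (σ + y * Complex.I) :=
    integrable_vertical_of_bound (fun s hs => hf s hs.ge (hs.le.trans hσ))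
      (fun s hs => hb s hs.ge (hs.le.trans hσ))
  have hi' : Integrable fun y : ℝ => f (σ' + y * Complex.I) :=
    integrable_vertical_of_bound (fun s hs => hf s (hσ.trans hs.ge) hs.le)
      (fun s hs => hb s (hσ.trans hs.ge) hs.le)
  have l1 := intervalIntegral_tendsto_integral hi tendsto_neg_atTop_atBot tendsto_id
  have l2 := intervalIntegral_tendsto_integral hi' tendsto_neg_atTop_atBot tendsto_id
  have hT : Tendsto (fun T : ℝ => C * (1 + T ^ 2)⁻¹ * |σ' - σ|) atTop (𝓝 0) := by
    have h1 : Tendsto (fun T : ℝ => 1 + T ^ 2) atTop atTop :=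
      tendsto_atTop_add_const_left _ _ (tendsto_pow_atTop two_ne_zero)
    have h2 := (h1.inv_tendsto_atTop.const_mul C).mul_const |σ' - σ|
    simpa using h2
  have hh : ∀ T : ℝ, ‖∫ x : ℝ in σ..σ', f (x + T * Complex.I)‖
      ≤ C * (1 + T ^ 2)⁻¹ * |σ' - σ| := by
    intro T
    refine intervalIntegral.norm_integral_le_of_norm_le_const fun x hx => ?_
    rw [Set.uIoc_of_le hσ] at hx
    simpa using hb (x + T * Complex.I) (by simpa using hx.1.le) (by simpa using hx.2)
  have l3 : Tendsto (fun T : ℝ => ∫ x : ℝ in σ..σ', f (x + T * Complex.I)) atTop (𝓝 0) :=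
    squeeze_zero_norm hh hT
  have l4 : Tendsto (fun T : ℝ => ∫ x : ℝ in σ..σ', f (x + (-T : ℝ) * Complex.I)) atTop (𝓝 0) :=
    squeeze_zero_norm (fun T => by simpa using hh (-T)) hT
  have hrect : ∀ T : ℝ, (∫ x : ℝ in σ..σ', f (x + (-T : ℝ) * Complex.I))
      - (∫ x : ℝ in σ..σ', f (x + T * Complex.I))
      + Complex.I * (∫ y : ℝ in (-T)..T, f (σ' + y * Complex.I))
      - Complex.I * (∫ y : ℝ in (-T)..T, f (σ + y * Complex.I)) = 0 := by
    intro T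
    have := Complex.integral_boundary_rect_eq_zero_of_differentiableOn f
      (σ + (-T : ℝ) * Complex.I) (σ' + T * Complex.I) (by
        intro s hs
        have h1 := (Complex.mem_reProdIm.mp hs).1
        simp only [Complex.add_re, Complex.ofReal_re, Complex.mul_re, Complex.I_re, mul_zero,
          Complex.ofReal_im, Complex.I_im, mul_one, sub_self, add_zero] at h1
        rw [Set.uIcc_of_le hσ] at h1
        exact (hf s h1.1 h1.2).differentiableWithinAt)
    simpa using this
  have l5 := ((l4.sub l3).add (l2.const_mul Complex.I)).sub (l1.const_mul Complex.I)
  have l6 := tendsto_nhds_unique (l5.congr fun T => hrect T) tendsto_const_nhds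
  rw [sub_zero, zero_add, ← mul_sub] at l6
  rcases mul_eq_zero.mp l6 with h | h
  · exact absurd h Complex.I_ne_zero
  · exact (sub_eq_zero.mp h).symm

/-! ### The function `φ` -/

lemma differentiableAt_cpow_neg_mul_gammaFactor {d : ℕ} (lam : Fin d → ℂ) {x : ℝ} (hx : 0 < x)
    {s : ℂ} (hs : ∀ j, 0 < s.re + (lam j).re) :
    DifferentiableAt ℂ (fun s => (x : ℂ) ^ (-s) * gammaFactor lam s) s := by
  have hx0 : (x : ℂ) ≠ 0 := by exact_mod_cast hx.ne'
  exact (DifferentiableAt.const_cpow (by fun_prop) (Or.inl hx0)).mul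
    (differentiableAt_gammaFactor lam hs)

lemma phi_eq_of_le {d : ℕ} (hd : 1 ≤ d) (lam : Fin d → ℂ) {σ σ' : ℝ}
    (hσ : ∀ j, 0 < σ + (lam j).re) (hσσ' : σ ≤ σ') {x : ℝ} (hx : 0 < x) :
    phi lam σ x = phi lam σ' x := by
  obtain ⟨C, hC, hb⟩ := exists_norm_gammaFactor_le (b := σ') hd lam hσ
  rw [phi, phi, mellinInv, mellinInv]
  congr 1
  refine integral_vertical_eq (f := fun s => (x : ℂ) ^ (-s) • gammaFactor lam s)
    -- On the strip `x^{-Re s}` is at most its value at one of the two edges; the sum covers both `x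
    -- ≥ 1` and `x ≤ 1`.
    (C := (x ^ (-σ) + x ^ (-σ')) * C) hσσ' ?_ ?_
  · intro s h1 _
    exact differentiableAt_cpow_neg_mul_gammaFactor lam hx fun j => by linarith [hσ j]
  · intro s h1 h2
    rw [norm_smul, Complex.norm_cpow_eq_rpow_re_of_pos hx, mul_assoc]
    refine mul_le_mul ?_ (hb s h1 h2) (norm_nonneg _) (by positivity)
    have p1 : 0 < x ^ (-σ) := by positivity
    have p2 : 0 < x ^ (-σ') := by positivity
    rcases le_total 1 x with h | h
    · have := Real.rpow_le_rpow_of_exponent_le h (x := x) (y := (-s).re) (z := -σ)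
        (by simpa using h1)
      linarith
    · have := Real.rpow_le_rpow_of_exponent_ge hx h (y := (-s).re) (z := -σ')
        (by simpa using h2)
      linarith

lemma exists_norm_phi_le {d : ℕ} (hd : 1 ≤ d) (lam : Fin d → ℂ) {σ σ' : ℝ}
    (hσ : ∀ j, 0 < σ + (lam j).re) (hσσ' : σ ≤ σ') :
    ∃ C : ℝ, ∀ x : ℝ, 0 < x → ‖phi lam σ x‖ ≤ C * x ^ (-σ') := by
  obtain ⟨C, hC, hb⟩ := exists_norm_gammaFactor_le (b := σ') hd lam
    (a := σ') (fun j => by linarith [hσ j])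
  refine ⟨1 / (2 * Real.pi) * (∫ y : ℝ, C * (1 + y ^ 2)⁻¹), fun x hx => ?_⟩
  rw [phi_eq_of_le hd lam hσ hσσ' hx, phi, mellinInv, norm_smul, mul_assoc]
  have e : ‖(1 / (2 * Real.pi) : ℝ)‖ = 1 / (2 * Real.pi) := by
    rw [Real.norm_eq_abs, abs_of_pos (by positivity)]
  rw [e]
  refine mul_le_mul_of_nonneg_left ?_ (by positivity)
  rw [← integral_mul_const]
  refine norm_integral_le_of_norm_le ((integrable_inv_one_add_sq.const_mul C).mul_const _)
    (Eventually.of_forall fun y => ?_)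
  rw [norm_smul, Complex.norm_cpow_eq_rpow_re_of_pos hx, mul_comm]
  have h1 : (-((σ' : ℂ) + y * Complex.I)).re = -σ' := by simp
  rw [h1]
  refine mul_le_mul_of_nonneg_right ?_ (by positivity)
  simpa using hb (σ' + y * Complex.I) (by simp) (by simp)

lemma continuousOn_phi {d : ℕ} (hd : 1 ≤ d) (lam : Fin d → ℂ) {σ : ℝ}
    (hσ : ∀ j, 0 < σ + (lam j).re) : ContinuousOn (phi lam σ) (Set.Ioi 0) := by
  obtain ⟨C, hC, hb⟩ := exists_norm_gammaFactor_le (b := σ) hd lam hσ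
  have hi : Integrable fun y : ℝ => gammaFactor lam (σ + y * Complex.I) :=
    integrable_vertical_of_bound
      (fun s hs => differentiableAt_gammaFactor lam fun j => by rw [hs]; exact hσ j)
      (fun s hs => hb s hs.ge hs.le)
  intro x hx
  have hx0 : 0 < x := hx
  refine ContinuousAt.continuousWithinAt ?_
  have hcσ : ContinuousAt (fun x : ℝ => x ^ (-σ)) x :=
    Real.continuousAt_rpow_const _ _ (Or.inl hx0.ne')
  unfold phi mellinInv
  refine ContinuousAt.const_smul ?_ _
  refine continuousAt_of_dominated
    (bound := fun y => (x ^ (-σ) + 1) * ‖gammaFactor lam (σ + y * Complex.I)‖) ?_ ?_ ?_ ?_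
  · filter_upwards [lt_mem_nhds hx0] with u hu
    have hu0 : (u : ℂ) ≠ 0 := by exact_mod_cast hu.ne'
    have hc : Continuous fun y : ℝ => (u : ℂ) ^ (-((σ : ℂ) + y * Complex.I)) :=
      Continuous.const_cpow (by fun_prop) (Or.inl hu0)
    exact hc.aestronglyMeasurable.smul hi.aestronglyMeasurable
  · filter_upwards [lt_mem_nhds hx0, hcσ.eventually (gt_mem_nhds (lt_add_one _))] with u hu hu2
    refine Eventually.of_forall fun y => ?_
    rw [norm_smul, Complex.norm_cpow_eq_rpow_re_of_pos hu]
    have h1 : (-((σ : ℂ) + y * Complex.I)).re = -σ := by simp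
    rw [h1]
    exact mul_le_mul_of_nonneg_right hu2.le (norm_nonneg _)
  · exact hi.norm.const_mul _
  · refine Eventually.of_forall fun y => ?_
    refine ContinuousAt.fun_smul ?_ continuousAt_const
    exact ContinuousAt.comp (f := fun u : ℝ => (u : ℂ))
      (continuousAt_cpow_const (Complex.ofReal_mem_slitPlane.mpr hx0))
      Complex.continuous_ofReal.continuousAt

/-! ### Mellin transforms of the leading terms -/

lemma mellin_leadingTerm {d : ℕ} (hd : 1 ≤ d) (α s : ℂ) (hs : 0 < (s + α).re) :
    MellinConvergent (leadingTerm d α) s ∧ mellin (leadingTerm d α) s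
      = (asympConst d : ℂ) * ((1 / (d : ℂ)) ^ (s + α) * Complex.Gamma (s + α)) := by
  have hd0 : (0 : ℝ) < d := by exact_mod_cast hd
  set E : ℝ → ℂ := fun t => Complex.exp (-((d : ℂ) * t)) with hE
  have e1 : leadingTerm d α = fun t : ℝ => (asympConst d : ℂ) • ((t : ℂ) ^ α • E t) := by
    funext t
    simp only [leadingTerm, hE, smul_eq_mul]
    ring
  have e2 : mellin E (s + α) = (1 / (d : ℂ)) ^ (s + α) * Complex.Gamma (s + α) := by
    have := Complex.integral_cpow_mul_exp_neg_mul_Ioi hs hd0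
    simp only [mellin, hE, smul_eq_mul]
    simpa using this
  have hne : (1 / (d : ℂ)) ^ (s + α) * Complex.Gamma (s + α) ≠ 0 := by
    refine mul_ne_zero ?_ (Complex.Gamma_ne_zero_of_re_pos hs)
    rw [Complex.cpow_ne_zero_iff]
    left
    exact one_div_ne_zero (by exact_mod_cast hd0.ne')
  -- A divergent Mellin integral has the default value `0`, whereas the value found above is
  -- non-zero.
  have hconv : MellinConvergent E (s + α) := by
    by_contra hcon
    rw [← e2] at hne
    exact hne (integral_undef hcon)
  constructor
  · rw [e1]
    exact (MellinConvergent.cpow_smul.mpr hconv).const_smul _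
  · rw [e1, mellin_const_smul, mellin_cpow_smul, e2, smul_eq_mul]

lemma mellin_leadingTerm_comp_rpow {d : ℕ} (hd : 1 ≤ d) (α s : ℂ) (hs : 0 < (d / 2 * s + α).re) :
    MellinConvergent (fun x : ℝ => leadingTerm d α (x ^ (2 / (d : ℝ)))) s ∧
      mellin (fun x : ℝ => leadingTerm d α (x ^ (2 / (d : ℝ)))) s
      = (d / 2 : ℂ) * ((asympConst d : ℂ) * ((1 / (d : ℂ)) ^ (d / 2 * s + α)
        * Complex.Gamma (d / 2 * s + α))) := by
  have hd0 : (0 : ℝ) < d := by exact_mod_cast hd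
  have hdC : (d : ℂ) ≠ 0 := by exact_mod_cast hd0.ne'
  have e : s / ((2 / (d : ℝ) : ℝ) : ℂ) = d / 2 * s := by
    push_cast
    field_simp
  have h := mellin_leadingTerm hd α (d / 2 * s) hs
  constructor
  · rw [MellinConvergent.comp_rpow (by positivity : (2 / (d : ℝ)) ≠ 0), e]
    exact h.1
  · rw [mellin_comp_rpow, e, h.2, abs_of_pos (by positivity), inv_div, Complex.real_smul]
    push_cast
    rfl

lemma integrable_mellin_leadingTerm {d : ℕ} (hd : 1 ≤ d) (α : ℂ) (σ : ℝ)
    (hσ : 0 < d / 2 * σ + α.re) :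
    Integrable fun y : ℝ => mellin (fun x : ℝ => leadingTerm d α (x ^ (2 / (d : ℝ))))
      (σ + y * Complex.I) := by
  have hd0 : (0 : ℝ) < d := by exact_mod_cast hd
  have hd1 : (1 : ℝ) ≤ d := by exact_mod_cast hd
  have hdC : (1 / (d : ℂ)) ≠ 0 := one_div_ne_zero (by exact_mod_cast hd0.ne')
  have hre : ∀ s : ℂ, s.re = σ → (d / 2 * s + α).re = d / 2 * σ + α.re := by
    intro s hs
    have : (d / 2 * s : ℂ) = ((d / 2 : ℝ) : ℂ) * s := by push_cast; ring
    rw [Complex.add_re, this, Complex.re_ofReal_mul, hs]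
  -- The bound is applied at the point `ds` with shift `2α`, as `ds/2 + α = (ds + 2α)/2`.
  obtain ⟨C, hC, h⟩ := exists_norm_Gamma_half_le (a := d * σ) (b := d * σ) (2 * α)
    (by simp; linarith)
  set F : ℂ → ℂ := fun s => (d / 2 : ℂ) * ((asympConst d : ℂ) *
    ((1 / (d : ℂ)) ^ (d / 2 * s + α) * Complex.Gamma (d / 2 * s + α))) with hF
  set B : ℝ := ‖(d / 2 : ℂ)‖ * (‖(asympConst d : ℂ)‖ * ((1 / (d : ℝ)) ^ (d / 2 * σ + α.re) * C))
    with hB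
  have hint : Integrable fun y : ℝ => F (σ + y * Complex.I) := by
    refine integrable_vertical_of_bound (C := B) ?_ ?_
    · intro s hs
      have h1 : DifferentiableAt ℂ Complex.Gamma (d / 2 * s + α) := by
        refine Complex.differentiableAt_Gamma _ fun m hm => ?_
        have h2 := hre s hs
        rw [hm] at h2
        simp at h2
        have : (0 : ℝ) ≤ m := Nat.cast_nonneg m
        linarith
      have h3 : DifferentiableAt ℂ (fun s => Complex.Gamma (d / 2 * s + α)) s :=
        DifferentiableAt.comp (f := fun s => d / 2 * s + α) s h1 (by fun_prop)
      have h4 : DifferentiableAt ℂ (fun s : ℂ => (1 / (d : ℂ)) ^ (d / 2 * s + α)) s :=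
        DifferentiableAt.const_cpow (by fun_prop) (Or.inl hdC)
      exact ((h4.mul h3).const_mul _).const_mul _
    · intro s hs
      have h1 := h (d * s) (by simp [hs]) (by simp [hs])
      rw [show ((d : ℂ) * s + 2 * α) / 2 = d / 2 * s + α by ring] at h1
      have h2 : (((d : ℂ) * s).im) = d * s.im := by simp
      rw [h2] at h1
      have h3 : (1 + (d * s.im) ^ 2)⁻¹ ≤ (1 + s.im ^ 2)⁻¹ := by
        refine inv_anti₀ (by positivity) ?_
        rw [mul_pow]
        nlinarith [sq_nonneg s.im, one_le_pow₀ hd1 (n := 2)]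
      have h4 : ‖(1 / (d : ℂ)) ^ (d / 2 * s + α)‖ = (1 / (d : ℝ)) ^ (d / 2 * σ + α.re) := by
        have : (1 / (d : ℂ)) = ((1 / (d : ℝ) : ℝ) : ℂ) := by push_cast; rfl
        rw [this, Complex.norm_cpow_eq_rpow_re_of_pos (by positivity), hre s hs]
      simp only [hF]
      rw [norm_mul, norm_mul, norm_mul, h4, hB]
      have h5 : ‖Complex.Gamma (d / 2 * s + α)‖ ≤ C * (1 + s.im ^ 2)⁻¹ :=
        h1.trans (by gcongr)
      have h6 : (0 : ℝ) ≤ (1 / (d : ℝ)) ^ (d / 2 * σ + α.re) := by positivity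
      calc _ ≤ ‖(d / 2 : ℂ)‖ * (‖(asympConst d : ℂ)‖ * ((1 / (d : ℝ)) ^ (d / 2 * σ + α.re)
            * (C * (1 + s.im ^ 2)⁻¹))) := by gcongr
        _ = _ := by ring
  refine hint.congr (Eventually.of_forall fun y => ?_)
  simp only [hF]
  refine ((mellin_leadingTerm_comp_rpow hd α _ ?_).2).symm
  rw [hre _ (by simp)]
  exact hσ

lemma continuousAt_leadingTerm (d : ℕ) (α : ℂ) {t : ℝ} (ht : 0 < t) :
    ContinuousAt (leadingTerm d α) t := by
  have h1 : ContinuousAt (fun u : ℝ => (u : ℂ) ^ α) t :=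
    ContinuousAt.comp (f := fun u : ℝ => (u : ℂ))
      (continuousAt_cpow_const (Complex.ofReal_mem_slitPlane.mpr ht))
      Complex.continuous_ofReal.continuousAt
  have h2 : ContinuousAt (fun u : ℝ => (asympConst d : ℂ) * Complex.exp (-((d : ℂ) * (u : ℂ)))) t :=
    by fun_prop
  exact h2.mul h1

lemma mellinInv_mellin_leadingTerm {d : ℕ} (hd : 1 ≤ d) (α : ℂ) (σ : ℝ)
    (hσ : 0 < d / 2 * σ + α.re) {x : ℝ} (hx : 0 < x) :
    mellinInv σ (mellin (fun x : ℝ => leadingTerm d α (x ^ (2 / (d : ℝ))))) x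
      = leadingTerm d α (x ^ (2 / (d : ℝ))) := by
  refine mellinInv_mellin_eq σ _ hx (mellin_leadingTerm_comp_rpow hd α σ ?_).1
    (integrable_mellin_leadingTerm hd α σ hσ) ?_
  · have : (d / 2 * (σ : ℂ)) = ((d / 2 * σ : ℝ) : ℂ) := by push_cast; ring
    rw [Complex.add_re, this, Complex.ofReal_re]
    exact hσ
  · exact ContinuousAt.comp (f := fun x : ℝ => x ^ (2 / (d : ℝ)))
      (continuousAt_leadingTerm d α (by positivity))
      (Real.continuousAt_rpow_const _ _ (Or.inl hx.ne'))

/-! ### The inverse Mellin transform as a linear map -/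

lemma integrable_cpow_smul_vertical {F : ℂ → ℂ} {σ x : ℝ} (hx : 0 < x)
    (hF : Integrable fun y : ℝ => F (σ + y * Complex.I)) :
    Integrable fun y : ℝ => (x : ℂ) ^ (-((σ : ℂ) + y * Complex.I)) • F (σ + y * Complex.I) := by
  have hx0 : (x : ℂ) ≠ 0 := by exact_mod_cast hx.ne'
  have hc : Continuous fun y : ℝ => (x : ℂ) ^ (-((σ : ℂ) + y * Complex.I)) :=
    Continuous.const_cpow (by fun_prop) (Or.inl hx0)
  refine Integrable.mono' (hF.norm.const_mul (x ^ (-σ)))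
    (hc.aestronglyMeasurable.smul hF.aestronglyMeasurable) (Eventually.of_forall fun y => ?_)
  rw [norm_smul, Complex.norm_cpow_eq_rpow_re_of_pos hx]
  simp

lemma norm_mellinInv_le {F : ℂ → ℂ} {σ x : ℝ} (hx : 0 < x) {b : ℝ → ℝ} (hb : Integrable b)
    (h : ∀ y : ℝ, ‖F (σ + y * Complex.I)‖ ≤ b y) :
    ‖mellinInv σ F x‖ ≤ x ^ (-σ) * ∫ y, b y := by
  have h0 : 0 ≤ x ^ (-σ) * ∫ y, b y :=
    mul_nonneg (by positivity) (integral_nonneg fun y => (norm_nonneg _).trans (h y))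
  rw [mellinInv, norm_smul, Real.norm_eq_abs, abs_of_pos (by positivity)]
  have h1 : ‖∫ y : ℝ, (x : ℂ) ^ (-((σ : ℂ) + y * Complex.I)) • F (σ + y * Complex.I)‖
      ≤ x ^ (-σ) * ∫ y, b y := by
    rw [← integral_const_mul]
    refine norm_integral_le_of_norm_le (hb.const_mul _) (Eventually.of_forall fun y => ?_)
    rw [norm_smul, Complex.norm_cpow_eq_rpow_re_of_pos hx]
    have h1 : (-((σ : ℂ) + y * Complex.I)).re = -σ := by simp
    rw [h1]
    exact mul_le_mul_of_nonneg_left (h y) (by positivity)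
  refine (mul_le_mul_of_nonneg_left h1 (by positivity)).trans (mul_le_of_le_one_left h0 ?_)
  rw [div_le_one (by positivity)]
  linarith [Real.pi_gt_three]

lemma mellinInv_sub_sum {F : ℂ → ℂ} {ι : Type*} (S : Finset ι) (H : ι → ℂ → ℂ) (c : ι → ℂ)
    {σ x : ℝ} (hx : 0 < x) (hF : Integrable fun y : ℝ => F (σ + y * Complex.I))
    (hH : ∀ i ∈ S, Integrable fun y : ℝ => H i (σ + y * Complex.I)) :
    mellinInv σ F x - ∑ i ∈ S, c i * mellinInv σ (H i) x
      = mellinInv σ (fun s => F s - ∑ i ∈ S, c i * H i s) x := by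
  simp only [mellinInv, smul_eq_mul, Complex.real_smul, mul_sub, Finset.mul_sum]
  have hFi := integrable_cpow_smul_vertical hx hF
  simp only [smul_eq_mul] at hFi
  rw [integral_sub hFi, integral_finsetSum]
  · rw [mul_sub, Finset.mul_sum]
    congr 1
    refine Finset.sum_congr rfl fun i _ => ?_
    rw [mul_left_comm, ← integral_const_mul]
    congr 2
    funext y
    ring
  · intro i hi
    refine ((integrable_cpow_smul_vertical hx (hH i hi)).const_mul (c i)).congr
      (Eventually.of_forall fun y => ?_)
    simp only [smul_eq_mul]
    ring
  · refine integrable_finsetSum _ fun i hi => ?_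
    refine ((integrable_cpow_smul_vertical hx (hH i hi)).const_mul (c i)).congr
      (Eventually.of_forall fun y => ?_)
    simp only [smul_eq_mul]
    ring

/-! ### The expansion of `φ` -/

lemma gammaFactor_eq {d : ℕ} (hd : 1 ≤ d) (lam : Fin d → ℂ) {s : ℂ}
    (hz : 0 < (d / 2 * s + kappa lam).re) :
    gammaFactor lam s = gammaRatio lam (d / 2 * s + kappa lam) *
      (((d : ℂ) ^ (d / 2 * s + kappa lam))⁻¹ * Complex.Gamma (d / 2 * s + kappa lam)) := by
  have hd0 : (d : ℂ) ≠ 0 := by exact_mod_cast (by omega : d ≠ 0)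
  have h1 : (d : ℂ) ^ (d / 2 * s + kappa lam) ≠ 0 := by
    rw [Complex.cpow_ne_zero_iff]
    exact Or.inl hd0
  have h2 := Complex.Gamma_ne_zero_of_re_pos hz
  rw [gammaRatio, gammaFactor]
  have : ∀ j, (d / 2 * s + kappa lam - kappa lam) / d + lam j / 2 = (s + lam j) / 2 := by
    intro j
    field_simp
    ring
  simp_rw [this]
  generalize (d : ℂ) ^ (d / 2 * s + kappa lam) = A at *
  generalize Complex.Gamma (d / 2 * s + kappa lam) = B at *
  field_simp

lemma one_div_cpow_sub_nat {d : ℕ} (hd : 1 ≤ d) (z : ℂ) (n : ℕ) :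
    (1 / (d : ℂ)) ^ (z - n) = ((d : ℂ) ^ z)⁻¹ * (d : ℂ) ^ n := by
  have hd0 : (d : ℂ) ≠ 0 := by exact_mod_cast (by omega : d ≠ 0)
  rw [one_div, Complex.inv_cpow _ _ (by rw [Complex.natCast_arg]; exact Real.pi_pos.ne),
    Complex.cpow_sub _ _ hd0, Complex.cpow_natCast, inv_div, div_eq_inv_mul]

/-- Both `φ` and the leading terms are written as inverse Mellin integrals over the line `Re z = m`,
where the uniform expansion of `gammaRatio` bounds the difference of the integrands. The integer `m`
stays free, with constants independent of it, so that it can be adapted to `t`. -/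
lemma exists_phi_sub_bound_nat {d : ℕ} (hd : 1 ≤ d) (lam : Fin d → ℂ) {σ : ℝ}
    (hσ : ∀ j, 0 < σ + (lam j).re) {N : ℕ} (hN : 1 ≤ N) :
    ∃ K X : ℝ, 0 ≤ K ∧ ∀ m : ℕ, X ≤ m → ∀ t : ℝ, 0 < t →
      ‖phi lam σ (t ^ ((d : ℝ) / 2))
        - ∑ n ∈ Finset.range N, (2 * phiCoeff lam n) * leadingTerm d (kappa lam - n) t‖
      ≤ K * t ^ (kappa lam).re * (((d * t) ^ m)⁻¹ * (m + 1).factorial / (m : ℝ) ^ N) := by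
  have hd0 : (0 : ℝ) < d := by exact_mod_cast hd
  have hdC : (d : ℂ) ≠ 0 := by exact_mod_cast hd0.ne'
  obtain ⟨K, X, hK, hX, h⟩ := exists_gammaRatio_sub_bound hd lam hN
  set b : ℝ → ℝ := fun y => (1 + (d / 2 * y + (kappa lam).im) ^ 2)⁻¹ with hb
  have hbi : Integrable b := by
    have h1 : Integrable fun y : ℝ => (1 + (y + (kappa lam).im) ^ 2)⁻¹ :=
      integrable_inv_one_add_sq.comp_add_right (kappa lam).im
    exact h1.comp_mul_left' (R := (d : ℝ) / 2) (by positivity)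
  have hb0 : 0 ≤ ∫ y, b y := integral_nonneg fun y => by positivity
  -- The three lower bounds for `m` put the line inside the half-plane of the expansion, to the
  -- right of the poles of all `Γ(z - n)` with `n < N`, and to the right of the original contour.
  refine ⟨K * ∫ y, b y, max (max X (N + 1)) (d / 2 * σ + (kappa lam).re), by positivity,
    fun m hm t ht => ?_⟩
  have hmX : X ≤ m := (le_max_left _ _).trans ((le_max_left _ _).trans hm)
  have hmN : (N : ℝ) + 1 ≤ m := (le_max_right _ _).trans ((le_max_left _ _).trans hm)
  have hmσ : d / 2 * σ + (kappa lam).re ≤ m := (le_max_right _ _).trans hm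
  have hm1 : (1 : ℝ) ≤ m := hX.trans hmX
  set x : ℝ := t ^ ((d : ℝ) / 2) with hx
  have hx0 : 0 < x := by positivity
  have hxt : x ^ (2 / (d : ℝ)) = t := by
    rw [hx, ← Real.rpow_mul ht.le]
    have : (d : ℝ) / 2 * (2 / d) = 1 := by field_simp
    rw [this, Real.rpow_one]
  set σ' : ℝ := 2 / d * (m - (kappa lam).re) with hσ'
  have hσσ' : σ ≤ σ' := by
    rw [hσ', div_mul_eq_mul_div, le_div_iff₀ hd0]
    linarith
  have hσ'd : d / 2 * σ' = m - (kappa lam).re := by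
    rw [hσ']
    field_simp
  have hline : ∀ n ∈ Finset.range N, 0 < d / 2 * σ' + (kappa lam - n : ℂ).re := by
    intro n hn
    have hnN : (n : ℝ) < N := by exact_mod_cast Finset.mem_range.mp hn
    rw [hσ'd, Complex.sub_re, Complex.natCast_re]
    linarith
  have hsum : ∀ n ∈ Finset.range N, leadingTerm d (kappa lam - n) t
      = mellinInv σ' (mellin (fun x : ℝ => leadingTerm d (kappa lam - n) (x ^ (2 / (d : ℝ))))) x := by
    intro n hn
    rw [mellinInv_mellin_leadingTerm hd _ σ' (hline n hn) hx0, hxt]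
  obtain ⟨C, hC, hCb⟩ := exists_norm_gammaFactor_le (b := σ') hd lam hσ
  rw [phi_eq_of_le hd lam hσ hσσ' hx0, Finset.sum_congr rfl fun n hn => by rw [hsum n hn], phi,
    mellinInv_sub_sum _ _ _ hx0
      (integrable_vertical_of_bound (C := C)
        (fun s hs => differentiableAt_gammaFactor lam fun j => by linarith [hσ j])
        (fun s hs => hCb s (by linarith) hs.le))
      (fun n hn => integrable_mellin_leadingTerm hd _ σ' (hline n hn))]
  have hmain : ∀ y : ℝ, ‖gammaFactor lam (σ' + y * Complex.I)
      - ∑ n ∈ Finset.range N, 2 * phiCoeff lam n *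
        mellin (fun x : ℝ => leadingTerm d (kappa lam - n) (x ^ (2 / (d : ℝ))))
          (σ' + y * Complex.I)‖
      ≤ (K / (m : ℝ) ^ N * (((d : ℝ) ^ m)⁻¹ * (m + 1).factorial)) * b y := by
    intro y
    set s : ℂ := σ' + y * Complex.I with hs
    set z : ℂ := d / 2 * s + kappa lam with hz
    have hds : (d / 2 * s : ℂ) = ((d / 2 : ℝ) : ℂ) * s := by push_cast; ring
    have hzre : z.re = m := by
      rw [hz, Complex.add_re, hds, Complex.re_ofReal_mul]
      simp [hs, hσ'd]
    have hzim : z.im = d / 2 * y + (kappa lam).im := by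
      rw [hz, Complex.add_im, hds, Complex.im_ofReal_mul]
      simp [hs]
    have hz0 : 0 < z.re := by rw [hzre]; linarith
    have hzm : (m : ℝ) ≤ ‖z‖ := hzre ▸ Complex.re_le_norm z
    have hGz := Complex.Gamma_ne_zero_of_re_pos hz0
    have e1 : ∀ n ∈ Finset.range N, 2 * phiCoeff lam n *
        mellin (fun x : ℝ => leadingTerm d (kappa lam - n) (x ^ (2 / (d : ℝ)))) s
        = (((d : ℂ) ^ z)⁻¹ * Complex.Gamma z) * ((asympConst d * d : ℝ) *
          (phiCoeff lam n * (d : ℂ) ^ n * (Complex.Gamma (z - n) / Complex.Gamma z))) := by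
      intro n hn
      have e2 : d / 2 * s + (kappa lam - n) = z - n := by rw [hz]; ring
      rw [(mellin_leadingTerm_comp_rpow hd _ s (by
        rw [Complex.add_re, hds, Complex.re_ofReal_mul]
        simpa [hs] using hline n hn)).2, e2, one_div_cpow_sub_nat hd]
      push_cast
      field_simp
    rw [Finset.sum_congr rfl e1, ← Finset.mul_sum, ← Finset.mul_sum, gammaFactor_eq hd lam hz0,
      ← hz, mul_comm (gammaRatio lam z), ← mul_sub, norm_mul, norm_mul, norm_inv,
      Complex.norm_natCast_cpow_of_pos (by omega), hzre, Real.rpow_natCast]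
    have hzsq : 1 + (d / 2 * y + (kappa lam).im) ^ 2 ≤ ‖z‖ ^ 2 := by
      rw [Complex.sq_norm, Complex.normSq_apply, hzre, hzim]
      nlinarith
    have hG : ‖Complex.Gamma z‖ ≤ (m + 1).factorial * b y := by
      refine (norm_Gamma_le_div_sq hz0).trans ?_
      have e3 : z.re + 2 = ((m + 1 : ℕ) : ℝ) + 1 := by rw [hzre]; push_cast; ring
      rw [e3, Real.Gamma_nat_eq_factorial, div_eq_mul_inv]
      simp only [hb]
      gcongr
    have hr : ‖gammaRatio lam z - (asympConst d * d : ℝ) * gammaSum lam N z‖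
        ≤ K / (m : ℝ) ^ N := (h z (by rw [hzre]; exact hmX)).trans (by gcongr)
    have hby : 0 ≤ b y := by positivity
    calc _ ≤ ((d : ℝ) ^ m)⁻¹ * ((m + 1).factorial * b y) * (K / (m : ℝ) ^ N) := by
          refine mul_le_mul ?_ hr (norm_nonneg _) (by positivity)
          gcongr
      _ = _ := by ring
  refine (norm_mellinInv_le hx0 (hbi.const_mul _) hmain).trans (le_of_eq ?_)
  have hxσ : x ^ (-σ') = t ^ (kappa lam).re * (t ^ m)⁻¹ := by
    rw [hx, ← Real.rpow_mul ht.le, mul_neg, hσ'd, neg_sub, Real.rpow_sub ht, Real.rpow_natCast]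
    rfl
  rw [integral_const_mul, hxσ, mul_pow, mul_inv]
  ring

/-! ### Optimal position of the contour. -/

lemma exists_factorial_le : ∃ C : ℝ, 0 ≤ C ∧ ∀ m : ℕ, 1 ≤ m →
    (m.factorial : ℝ) ≤ C * m * ((m : ℝ) / Real.exp 1) ^ m := by
  refine ⟨2 * Stirling.stirlingSeq 1, ?_, fun m hm => ?_⟩
  · have := Stirling.stirlingSeq'_pos 0
    positivity
  · obtain ⟨n, rfl⟩ := Nat.exists_eq_add_of_le' hm
    have h1 := Stirling.stirlingSeq'_antitone (Nat.zero_le n)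
    simp only [Function.comp] at h1
    set y : ℝ := ((n + 1 : ℕ) : ℝ) with hy
    have hy1 : 1 ≤ y := by rw [hy]; exact_mod_cast hm
    have h2 : Real.sqrt (2 * y) ≤ 2 * y := by
      rw [Real.sqrt_le_left (by positivity)]
      nlinarith
    have hpos := Stirling.stirlingSeq'_pos 0
    have hp : 0 < Real.sqrt (2 * y) * (y / Real.exp 1) ^ (n + 1) := by positivity
    change Stirling.stirlingSeq (n + 1) ≤ Stirling.stirlingSeq 1 at h1
    rw [Stirling.stirlingSeq, div_le_iff₀ hp] at h1
    refine h1.trans ?_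
    calc Stirling.stirlingSeq 1 * (Real.sqrt (2 * y) * (y / Real.exp 1) ^ (n + 1))
        ≤ Stirling.stirlingSeq 1 * (2 * y * (y / Real.exp 1) ^ (n + 1)) := by gcongr
      _ = _ := by ring

/-- The minimum over `m` of `(m + 1)! / Y^m`, up to powers of `Y`. -/
lemma exists_inv_pow_mul_factorial_le (N : ℕ) : ∃ C : ℝ, 0 ≤ C ∧ ∀ Y : ℝ, 1 ≤ Y →
    (Y ^ ⌈Y⌉₊)⁻¹ * (⌈Y⌉₊ + 1).factorial / (⌈Y⌉₊ : ℝ) ^ (N + 2)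
      ≤ C * (Real.exp (-Y) / Y ^ N) := by
  obtain ⟨C, hC, h⟩ := exists_factorial_le
  refine ⟨2 * C * Real.exp 1 ^ 2, by positivity, fun Y hY => ?_⟩
  have hY0 : 0 < Y := by linarith
  set m := ⌈Y⌉₊ with hm
  have hYm : Y ≤ m := Nat.le_ceil Y
  have hmY : (m : ℝ) < Y + 1 := Nat.ceil_lt_add_one hY0.le
  have hm1 : 1 ≤ m := by
    have : (1 : ℝ) ≤ m := hY.trans hYm
    exact_mod_cast this
  have hm0 : (0 : ℝ) < m := by exact_mod_cast hm1
  -- Rounding `Y` up costs only a constant: `m/Y ≤ 1 + 1/Y ≤ e^{1/Y}` and `m ≤ 2Y`.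
  have h1 : ((m : ℝ) / Y) ^ m ≤ Real.exp 1 ^ 2 := by
    have e1 : (m : ℝ) / Y ≤ Real.exp (1 / Y) := by
      refine le_trans ?_ (Real.add_one_le_exp (1 / Y))
      rw [div_add_one hY0.ne', div_le_div_iff_of_pos_right hY0]
      linarith
    calc ((m : ℝ) / Y) ^ m ≤ Real.exp (1 / Y) ^ m := by gcongr
      _ = Real.exp (m * (1 / Y)) := (Real.exp_nat_mul _ _).symm
      _ ≤ Real.exp (2 : ℕ) := by
        rw [Real.exp_le_exp, mul_one_div, div_le_iff₀ hY0]
        push_cast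
        linarith
      _ = Real.exp 1 ^ 2 := by rw [← Real.exp_nat_mul]; simp
  have h2 : (Real.exp 1 ^ m)⁻¹ ≤ Real.exp (-Y) := by
    rw [← Real.exp_nat_mul, mul_one, ← Real.exp_neg, Real.exp_le_exp]
    linarith
  -- The two spare factors `m`, one from `m + 1` and one from the crude bound for `m!`, are absorbed
  -- by the exponent `N + 2`.
  have h3 : ((m + 1).factorial : ℝ) ≤ 2 * m * (C * m * ((m : ℝ) / Real.exp 1) ^ m) := by
    rw [Nat.factorial_succ]
    push_cast
    refine mul_le_mul ?_ (h m hm1) (by positivity) (by positivity)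
    have : (1 : ℝ) ≤ m := by exact_mod_cast hm1
    linarith
  calc (Y ^ m)⁻¹ * (m + 1).factorial / (m : ℝ) ^ (N + 2)
      ≤ (Y ^ m)⁻¹ * (2 * m * (C * m * ((m : ℝ) / Real.exp 1) ^ m)) / (m : ℝ) ^ (N + 2) := by
        gcongr
    _ = 2 * C * (((m : ℝ) / Y) ^ m * ((Real.exp 1 ^ m)⁻¹ / (m : ℝ) ^ N)) := by
        rw [div_pow, div_pow]
        field_simp
        ring
    _ ≤ 2 * C * (Real.exp 1 ^ 2 * (Real.exp (-Y) / Y ^ N)) := by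
        gcongr
    _ = _ := by ring

lemma asympConst_pos {d : ℕ} (hd : 1 ≤ d) : 0 < asympConst d := by
  have hd0 : (0 : ℝ) < d := by exact_mod_cast hd
  have := Real.pi_pos
  rw [asympConst]
  positivity

lemma norm_leadingTerm {d : ℕ} (hd : 1 ≤ d) (α : ℂ) {t : ℝ} (ht : 0 < t) :
    ‖leadingTerm d α t‖ = asympConst d * (t ^ α.re * Real.exp (-(d * t))) := by
  rw [leadingTerm, norm_mul, norm_mul, Complex.norm_real, Real.norm_eq_abs,
    abs_of_pos (asympConst_pos hd), Complex.norm_exp, Complex.norm_cpow_eq_rpow_re_of_pos ht]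
  have : (-((d : ℂ) * t)).re = -(d * t) := by simp
  rw [this]
  ring

/-- Taking `m = ⌈dt⌉` loses two powers of `t`. They are regained by expanding to order `N + 2` and
counting the terms of index `N` and `N + 1` as error. -/
lemma exists_phi_sub_bound {d : ℕ} (hd : 1 ≤ d) (lam : Fin d → ℂ) {σ : ℝ}
    (hσ : ∀ j, 0 < σ + (lam j).re) (N : ℕ) :
    ∃ K T : ℝ, 0 ≤ K ∧ 1 ≤ T ∧ ∀ t : ℝ, T ≤ t →
      ‖phi lam σ (t ^ ((d : ℝ) / 2))
        - ∑ n ∈ Finset.range N, (2 * phiCoeff lam n) * leadingTerm d (kappa lam - n) t‖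
      ≤ K * (t ^ ((kappa lam).re - N) * Real.exp (-(d * t))) := by
  have hd1 : (1 : ℝ) ≤ d := by exact_mod_cast hd
  obtain ⟨K, X, hK, h⟩ := exists_phi_sub_bound_nat hd lam hσ (N := N + 2) (by omega)
  obtain ⟨C, hC, hC'⟩ := exists_inv_pow_mul_factorial_le N
  set B : ℕ → ℝ := fun n => ‖2 * phiCoeff lam n‖ * asympConst d with hB
  have hB0 : ∀ n, 0 ≤ B n := fun n => mul_nonneg (norm_nonneg _) (asympConst_pos hd).le
  refine ⟨K * C + B N + B (N + 1), max 1 X, by have := hB0 N; have := hB0 (N + 1); positivity,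
    le_max_left _ _, fun t ht => ?_⟩
  have ht1 : 1 ≤ t := (le_max_left _ _).trans ht
  have ht0 : 0 < t := by linarith
  have htd : t ≤ d * t := le_mul_of_one_le_left ht0.le hd1
  have h1 := h ⌈(d : ℝ) * t⌉₊ (((le_max_right _ _).trans ht).trans (htd.trans (Nat.le_ceil _))) t ht0
  have h2 := hC' (d * t) (ht1.trans htd)
  set E : ℝ := t ^ ((kappa lam).re - N) * Real.exp (-(d * t)) with hE
  have h3 : K * t ^ (kappa lam).re * (C * (Real.exp (-(d * t)) / (d * t) ^ N)) ≤ K * C * E := by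
    have : t ^ ((kappa lam).re - N) = t ^ (kappa lam).re / t ^ N := by
      rw [Real.rpow_sub ht0, Real.rpow_natCast]
    rw [hE, this]
    calc K * t ^ (kappa lam).re * (C * (Real.exp (-(d * t)) / (d * t) ^ N))
        ≤ K * t ^ (kappa lam).re * (C * (Real.exp (-(d * t)) / t ^ N)) := by gcongr
      _ = _ := by ring
  have h4 : ∀ n, N ≤ n → ‖(2 * phiCoeff lam n) * leadingTerm d (kappa lam - n) t‖ ≤ B n * E := by
    intro n hn
    have hnN : (N : ℝ) ≤ n := by exact_mod_cast hn
    rw [norm_mul, norm_leadingTerm hd _ ht0, Complex.sub_re, Complex.natCast_re, hB, mul_assoc]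
    refine mul_le_mul_of_nonneg_left ?_ (norm_nonneg _)
    refine mul_le_mul_of_nonneg_left ?_ (asympConst_pos hd).le
    rw [hE]
    gcongr
  rw [Finset.sum_range_succ, Finset.sum_range_succ] at h1
  have h5 : phi lam σ (t ^ ((d : ℝ) / 2))
        - ∑ n ∈ Finset.range N, (2 * phiCoeff lam n) * leadingTerm d (kappa lam - n) t
      = (phi lam σ (t ^ ((d : ℝ) / 2))
        - (∑ n ∈ Finset.range N, (2 * phiCoeff lam n) * leadingTerm d (kappa lam - n) t
          + (2 * phiCoeff lam N) * leadingTerm d (kappa lam - N) t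
          + (2 * phiCoeff lam (N + 1)) * leadingTerm d (kappa lam - (N + 1 : ℕ)) t))
        + (2 * phiCoeff lam N) * leadingTerm d (kappa lam - N) t
        + (2 * phiCoeff lam (N + 1)) * leadingTerm d (kappa lam - (N + 1 : ℕ)) t := by ring
  rw [h5, add_mul, add_mul]
  refine norm_add₃_le.trans (add_le_add (add_le_add ?_ (h4 N le_rfl)) (h4 (N + 1) (by omega)))
  refine (h1.trans ?_).trans h3
  gcongr

/-! ### The incomplete Mellin transform -/

lemma integrableOn_phi {d : ℕ} (hd : 1 ≤ d) (lam : Fin d → ℂ) {σ : ℝ}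
    (hσ : ∀ j, 0 < σ + (lam j).re) {t : ℝ} (ht : 0 < t) :
    IntegrableOn (phi lam σ) (Set.Ioi t) := by
  obtain ⟨C, hC⟩ := exists_norm_phi_le hd lam hσ (le_max_left σ 2)
  have hcont : ContinuousOn (phi lam σ) (Set.Ioi t) :=
    (continuousOn_phi hd lam hσ).mono (Set.Ioi_subset_Ioi ht.le)
  have hm : -(max σ 2) < -1 := by linarith [le_max_right σ 2]
  refine Integrable.mono' ((integrableOn_Ioi_rpow_of_lt hm ht).const_mul C)
    (hcont.aestronglyMeasurable measurableSet_Ioi) ?_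
  exact (ae_restrict_mem measurableSet_Ioi).mono fun x hx => hC x (ht.trans hx)

/-- The exponent `a` is arbitrarily large because the contour may be moved to the right at will.
Together with vanishing near `0`, this makes the Mellin transform of the truncated `φ` converge for
all `s`, hence entire. -/
lemma isBigO_indicator_phi_atTop {d : ℕ} (hd : 1 ≤ d) (lam : Fin d → ℂ) {σ : ℝ}
    (hσ : ∀ j, 0 < σ + (lam j).re) (t : ℝ) {a : ℝ} (ha : σ ≤ a) :
    (Set.Ioi t).indicator (phi lam σ) =O[atTop] (fun x : ℝ => x ^ (-a)) := by
  obtain ⟨C, hC⟩ := exists_norm_phi_le hd lam hσ ha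
  refine IsBigO.of_bound C ?_
  filter_upwards [eventually_gt_atTop 0] with x hx
  refine (norm_indicator_le_norm_self _ _).trans ((hC x hx).trans (le_of_eq ?_))
  rw [Real.norm_eq_abs, abs_of_pos (by positivity)]

lemma isBigO_indicator_phi_nhds_zero {d : ℕ} (lam : Fin d → ℂ) (σ : ℝ) {t : ℝ} (ht : 0 < t)
    (b : ℝ) :
    (Set.Ioi t).indicator (phi lam σ) =O[𝓝[>] 0] (fun x : ℝ => x ^ (-b)) := by
  refine IsBigO.of_bound 0 ?_
  filter_upwards [nhdsWithin_le_nhds (gt_mem_nhds ht)] with x hx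
  rw [Set.indicator_of_notMem (by simpa using le_of_lt hx)]
  simp

lemma locallyIntegrableOn_indicator_phi {d : ℕ} (hd : 1 ≤ d) (lam : Fin d → ℂ) {σ : ℝ}
    (hσ : ∀ j, 0 < σ + (lam j).re) {t : ℝ} (ht : 0 < t) :
    LocallyIntegrableOn ((Set.Ioi t).indicator (phi lam σ)) (Set.Ioi 0) :=
  ((integrable_indicator_iff measurableSet_Ioi).mpr
    (integrableOn_phi hd lam hσ ht)).locallyIntegrable.locallyIntegrableOn _

lemma cpow_smul_indicator_eq {d : ℕ} (lam : Fin d → ℂ) (σ : ℝ) (s : ℂ) {t : ℝ} (ht : 0 < t) :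
    (fun x : ℝ => (x : ℂ) ^ (s - 1) • (Set.Ioi t).indicator (phi lam σ) x)
      = (Set.Ioi t).indicator (incompleteIntegrand lam σ s) := by
  funext x
  by_cases hx : x ∈ Set.Ioi t
  · have hx0 : (x : ℂ) ≠ 0 := by exact_mod_cast (ht.trans hx).ne'
    rw [Set.indicator_of_mem hx, Set.indicator_of_mem hx, incompleteIntegrand,
      Complex.cpow_sub _ _ hx0, Complex.cpow_one, smul_eq_mul]
    ring
  · rw [Set.indicator_of_notMem hx, Set.indicator_of_notMem hx, smul_zero]

lemma integrableOn_incompleteIntegrand {d : ℕ} (hd : 1 ≤ d) (lam : Fin d → ℂ) {σ : ℝ}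
    (hσ : ∀ j, 0 < σ + (lam j).re) {t : ℝ} (ht : 0 < t) (s : ℂ) :
    IntegrableOn (incompleteIntegrand lam σ s) (Set.Ioi t) := by
  have h : MellinConvergent ((Set.Ioi t).indicator (phi lam σ)) s :=
    mellinConvergent_of_isBigO_rpow (a := max σ (s.re + 1)) (b := s.re - 1)
      (locallyIntegrableOn_indicator_phi hd lam hσ ht)
      (isBigO_indicator_phi_atTop hd lam hσ t (le_max_left _ _))
      (by linarith [le_max_right σ (s.re + 1)])
      (isBigO_indicator_phi_nhds_zero lam σ ht _) (by linarith)
  rw [MellinConvergent, cpow_smul_indicator_eq lam σ s ht] at h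
  refine (h.mono_set (Set.Ioi_subset_Ioi ht.le)).congr_fun (fun x hx => ?_) measurableSet_Ioi
  exact Set.indicator_of_mem hx _

lemma G_eq_mellin {d : ℕ} (lam : Fin d → ℂ) (σ : ℝ) {t : ℝ} (ht : 0 < t) (s : ℂ) :
    G lam σ s t = (t : ℂ) ^ (-s) * mellin ((Set.Ioi t).indicator (phi lam σ)) s := by
  rw [G, mellin, cpow_smul_indicator_eq lam σ s ht, setIntegral_indicator measurableSet_Ioi,
    Set.inter_eq_self_of_subset_right (Set.Ioi_subset_Ioi ht.le)]

lemma differentiable_G {d : ℕ} (hd : 1 ≤ d) (lam : Fin d → ℂ) {σ : ℝ}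
    (hσ : ∀ j, 0 < σ + (lam j).re) {t : ℝ} (ht : 0 < t) :
    Differentiable ℂ (fun s : ℂ => G lam σ s t) := by
  have ht0 : (t : ℂ) ≠ 0 := by exact_mod_cast ht.ne'
  simp_rw [G_eq_mellin lam σ ht]
  intro s
  refine DifferentiableAt.mul (DifferentiableAt.const_cpow (by fun_prop) (Or.inl ht0)) ?_
  exact mellin_differentiableAt_of_isBigO_rpow (a := max σ (s.re + 1)) (b := s.re - 1)
    (locallyIntegrableOn_indicator_phi hd lam hσ ht)
    (isBigO_indicator_phi_atTop hd lam hσ t (le_max_left _ _))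
    (by linarith [le_max_right σ (s.re + 1)])
    (isBigO_indicator_phi_nhds_zero lam σ ht _) (by linarith)

lemma image_rpow_Ioi {p : ℝ} (hp : 0 < p) {t : ℝ} (ht : 0 < t) :
    (fun u : ℝ => u ^ p) '' Set.Ioi t = Set.Ioi (t ^ p) := by
  ext x
  simp only [Set.mem_image, Set.mem_Ioi]
  constructor
  · rintro ⟨u, hu, rfl⟩
    exact Real.rpow_lt_rpow ht.le hu hp
  · intro hx
    have hx0 : 0 < x := lt_trans (by positivity) hx
    refine ⟨x ^ p⁻¹, ?_, Real.rpow_inv_rpow hx0.le hp.ne'⟩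
    rw [Real.lt_rpow_inv_iff_of_pos ht.le hx0.le hp]
    exact hx

lemma G_comp_rpow {d : ℕ} (hd : 1 ≤ d) (lam : Fin d → ℂ) (σ : ℝ) (s : ℂ) {t : ℝ} (ht : 0 < t) :
    G lam σ s (t ^ ((d : ℝ) / 2)) = (t : ℂ) ^ (-(d / 2 * s)) *
      ∫ u in Set.Ioi t, (d / 2 : ℂ) * ((u : ℂ) ^ (d / 2 * s - 1)
        * phi lam σ (u ^ ((d : ℝ) / 2))) := by
  have hd0 : (0 : ℝ) < d := by exact_mod_cast hd
  set p : ℝ := (d : ℝ) / 2 with hp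
  have hp0 : 0 < p := by positivity
  have hpC : (d / 2 : ℂ) = (p : ℂ) := by rw [hp]; push_cast; rfl
  clear_value p
  have hder : ∀ u ∈ Set.Ioi t,
      HasDerivWithinAt (fun u : ℝ => u ^ p) (p * u ^ (p - 1)) (Set.Ioi t) u := fun u hu =>
    (Real.hasDerivAt_rpow_const (Or.inl (ht.trans hu).ne')).hasDerivWithinAt
  have hinj : Set.InjOn (fun u : ℝ => u ^ p) (Set.Ioi t) := fun x hx y hy h =>
    (Real.rpow_left_inj (ht.trans hx).le (ht.trans hy).le hp0.ne').mp h
  have h1 := integral_image_eq_integral_abs_deriv_smul measurableSet_Ioi hder hinj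
    (incompleteIntegrand lam σ s)
  rw [image_rpow_Ioi hp0 ht] at h1
  have hcp : ∀ u : ℝ, 0 < u → ∀ w : ℂ, ((u ^ p : ℝ) : ℂ) ^ w = (u : ℂ) ^ (p * w) := by
    intro u hu w
    exact (Complex.cpow_mul_ofReal_nonneg hu.le p w).symm
  rw [G, h1, hcp t ht, hpC, mul_neg]
  congr 1
  refine setIntegral_congr_fun measurableSet_Ioi fun u hu => ?_
  have hu0 : 0 < u := ht.trans hu
  have huC : (u : ℂ) ≠ 0 := by exact_mod_cast hu0.ne'
  rw [abs_of_pos (by positivity), incompleteIntegrand, Complex.real_smul, hcp u hu0,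
    Complex.cpow_sub _ _ huC, Complex.cpow_one, Complex.ofReal_mul, Real.rpow_sub hu0,
    Real.rpow_one, Complex.ofReal_div]
  have : ((u ^ p : ℝ) : ℂ) ≠ 0 := by exact_mod_cast (Real.rpow_pos_of_pos hu0 p).ne'
  field_simp

/-! ### Exponentially small integrals -/

/-- For `t ≥ 2E` the growth `(u/t)^e` is at most `e^{(u-t)/2}`, half of the available exponential
decay. The condition on `t` involves only the bound `E`, which later gives uniformity in `s`. -/
lemma rpow_mul_exp_le {d : ℕ} (hd : 1 ≤ d) {e E t u : ℝ} (he : |e| ≤ E) (ht : 0 < t)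
    (htE : 2 * E ≤ t) (hu : t ≤ u) :
    u ^ e * Real.exp (-(d * u))
      ≤ t ^ e * Real.exp (-(d * t)) * (Real.exp (t / 2) * Real.exp (-(1 / 2) * u)) := by
  have hd1 : (1 : ℝ) ≤ d := by exact_mod_cast hd
  have hu0 : 0 < u := ht.trans_le hu
  have h1 : (u / t) ^ e ≤ Real.exp ((u - t) / 2) := by
    have hut : 1 ≤ u / t := (one_le_div ht).mpr hu
    calc (u / t) ^ e ≤ (u / t) ^ E :=
          Real.rpow_le_rpow_of_exponent_le hut ((le_abs_self e).trans he)
      _ = Real.exp (Real.log (u / t) * E) := Real.rpow_def_of_pos (by positivity) _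
      _ ≤ Real.exp ((u - t) / 2) := by
        rw [Real.exp_le_exp]
        have h2 : Real.log (u / t) ≤ (u - t) / t := by
          have := Real.log_le_sub_one_of_pos (by positivity : 0 < u / t)
          rwa [div_sub_one ht.ne'] at this
        have hE : 0 ≤ E := (abs_nonneg e).trans he
        calc Real.log (u / t) * E ≤ (u - t) / t * (t / 2) := by
              have : 0 ≤ (u - t) / t := div_nonneg (by linarith) ht.le
              gcongr
              linarith
          _ = (u - t) / 2 := by field_simp
  have h3 : u ^ e = t ^ e * (u / t) ^ e := by
    rw [← Real.mul_rpow ht.le (by positivity)]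
    congr 1
    field_simp
  have h4 : Real.exp (-(d * u)) ≤ Real.exp (-(d * t)) * Real.exp (-(u - t)) := by
    rw [← Real.exp_add, Real.exp_le_exp]
    nlinarith
  calc u ^ e * Real.exp (-(d * u))
      ≤ (t ^ e * Real.exp ((u - t) / 2)) * (Real.exp (-(d * t)) * Real.exp (-(u - t))) := by
        rw [h3]
        gcongr
    _ = t ^ e * Real.exp (-(d * t)) * (Real.exp ((u - t) / 2) * Real.exp (-(u - t))) := by ring
    _ = _ := by
      rw [← Real.exp_add, ← Real.exp_add]
      congr 2
      ring

lemma integrableOn_and_norm_integral_le {d : ℕ} (hd : 1 ≤ d) {e E t K : ℝ} (he : |e| ≤ E)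
    (ht : 0 < t) (htE : 2 * E ≤ t) {f : ℝ → ℂ} (hf : ContinuousOn f (Set.Ioi t))
    (hb : ∀ u : ℝ, t ≤ u → ‖f u‖ ≤ K * (u ^ e * Real.exp (-(d * u)))) :
    IntegrableOn f (Set.Ioi t) ∧
      ‖∫ u in Set.Ioi t, f u‖ ≤ 2 * K * (t ^ e * Real.exp (-(d * t))) := by
  have hK : 0 ≤ K := by
    have h1 := (norm_nonneg _).trans (hb t le_rfl)
    have h2 : 0 < t ^ e * Real.exp (-(d * t)) := by positivity
    exact nonneg_of_mul_nonneg_left h1 h2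
  set A : ℝ := K * (t ^ e * Real.exp (-(d * t)) * Real.exp (t / 2)) with hA
  have hbound : ∀ u ∈ Set.Ioi t, ‖f u‖ ≤ A * Real.exp (-(1 / 2) * u) := by
    intro u hu
    refine (hb u (le_of_lt hu)).trans ?_
    rw [hA, mul_assoc]
    refine mul_le_mul_of_nonneg_left ?_ hK
    rw [mul_assoc]
    exact rpow_mul_exp_le hd he ht htE (le_of_lt hu)
  have hint := (integrableOn_exp_mul_Ioi (a := -(1 / 2)) (by norm_num) t).const_mul A
  refine ⟨Integrable.mono' hint (hf.aestronglyMeasurable measurableSet_Ioi)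
    ((ae_restrict_mem measurableSet_Ioi).mono hbound), ?_⟩
  refine (norm_integral_le_of_norm_le hint
    ((ae_restrict_mem measurableSet_Ioi).mono hbound)).trans (le_of_eq ?_)
  rw [integral_const_mul, integral_exp_mul_Ioi (by norm_num), hA]
  have : Real.exp (t / 2) * Real.exp (-(1 / 2) * t) = 1 := by
    rw [← Real.exp_add]
    simp
    ring
  linear_combination 2 * K * (t ^ e * Real.exp (-(d * t))) * this

/-! ### The expansion of `G_s`, uniformly in `s` -/

lemma cpow_mul_leadingTerm (d : ℕ) (α β : ℂ) {t : ℝ} (ht : 0 < t) :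
    (t : ℂ) ^ β * leadingTerm d α t = leadingTerm d (α + β) t := by
  have ht0 : (t : ℂ) ≠ 0 := by exact_mod_cast ht.ne'
  rw [leadingTerm, leadingTerm, Complex.cpow_add _ _ ht0]
  ring

lemma hasDerivAt_leadingTerm (d : ℕ) (α : ℂ) {t : ℝ} (ht : 0 < t) :
    HasDerivAt (leadingTerm d α)
      (-(d : ℂ) * leadingTerm d α t + α * leadingTerm d (α - 1) t) t := by
  have h1 : HasDerivAt (fun u : ℝ => (u : ℂ) ^ α) (α * (t : ℂ) ^ (α - 1)) t := by
    have hs : (t : ℂ) ∈ Complex.slitPlane := Complex.ofReal_mem_slitPlane.mpr ht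
    have := (hasDerivAt_id (t : ℂ)).cpow_const (c := α) hs
    have h2 := this.comp_ofReal
    simpa using h2
  have h3 : HasDerivAt (fun u : ℝ => (asympConst d : ℂ) * Complex.exp (-((d : ℂ) * (u : ℂ))))
      ((asympConst d : ℂ) * (Complex.exp (-((d : ℂ) * (t : ℂ))) * (-(d : ℂ)))) t := by
    have h4 : HasDerivAt (fun z : ℂ => (asympConst d : ℂ) * Complex.exp (-((d : ℂ) * z)))
        ((asympConst d : ℂ) * (Complex.exp (-((d : ℂ) * (t : ℂ))) * (-(d : ℂ)))) (t : ℂ) := by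
      have h5 : HasDerivAt (fun z : ℂ => -((d : ℂ) * z)) (-(d : ℂ)) (t : ℂ) := by
        simpa using ((hasDerivAt_id (t : ℂ)).const_mul (d : ℂ)).fun_neg
      exact h5.cexp.const_mul _
    exact h4.comp_ofReal
  refine (h3.mul h1).congr_deriv ?_
  rw [leadingTerm, leadingTerm]
  ring

lemma tendsto_leadingTerm {d : ℕ} (hd : 1 ≤ d) (α : ℂ) :
    Tendsto (leadingTerm d α) atTop (𝓝 0) := by
  have hd0 : (0 : ℝ) < d := by exact_mod_cast hd
  have h := (tendsto_rpow_mul_exp_neg_mul_atTop_nhds_zero α.re d hd0).const_mul (asympConst d)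
  rw [mul_zero] at h
  refine squeeze_zero_norm' ?_ h
  filter_upwards [eventually_gt_atTop 0] with t ht
  rw [norm_leadingTerm hd α ht, neg_mul]

/-- The remainder coefficient in the first-order differential equation satisfied by the truncated
expansion of `G_s`. -/
noncomputable def remCoeff {d : ℕ} (lam : Fin d → ℂ) (s : ℂ) : ℕ → ℂ
  | 0 => 0
  | n + 1 => (kappa lam - 1 - n + d / 2 * s) * (gCoeff lam n).eval s

lemma continuous_remCoeff {d : ℕ} (lam : Fin d → ℂ) (n : ℕ) :
    Continuous fun s => remCoeff lam s n := by
  rcases n with _ | n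
  · exact continuous_const
  · simp only [remCoeff]
    have := (gCoeff lam n).continuous
    fun_prop

lemma mul_phiCoeff_eq {d : ℕ} (hd : 1 ≤ d) (lam : Fin d → ℂ) (n : ℕ) (s : ℂ) :
    (d : ℂ) * phiCoeff lam n = d * (gCoeff lam n).eval s - remCoeff lam s n := by
  have hd0 : (d : ℂ) ≠ 0 := by exact_mod_cast (by omega : d ≠ 0)
  rcases n with _ | n
  · simp [phiCoeff, gCoeff, remCoeff]
  · rw [gCoeff, remCoeff]
    simp only [Polynomial.eval_add, Polynomial.eval_mul, Polynomial.eval_C, Polynomial.eval_X]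
    field_simp
    ring

/-- `t^{ds/2}` times the truncated expansion of `G_s(t^{d/2})`. -/
noncomputable def gPartial {d : ℕ} (lam : Fin d → ℂ) (s : ℂ) (N : ℕ) (u : ℝ) : ℂ :=
  ∑ n ∈ Finset.range N, (gCoeff lam n).eval s * leadingTerm d (kappa lam - 1 - n + d / 2 * s) u

/-- The derivative of `gPartial`. -/
noncomputable def gPartialDeriv {d : ℕ} (lam : Fin d → ℂ) (s : ℂ) (N : ℕ) (u : ℝ) : ℂ :=
  remCoeff lam s N * leadingTerm d (kappa lam - 1 - N + d / 2 * s) u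
    - ∑ n ∈ Finset.range N,
      (d : ℂ) * phiCoeff lam n * leadingTerm d (kappa lam - 1 - n + d / 2 * s) u

/-- Differentiating the power in term `n` produces a multiple of term `n + 1`. The relation `d M_n =
d μ_n - remCoeff n` makes these contributions telescope, leaving only the one of index `N`. -/
lemma hasDerivAt_gPartial {d : ℕ} (hd : 1 ≤ d) (lam : Fin d → ℂ) (s : ℂ) (N : ℕ) {u : ℝ}
    (hu : 0 < u) : HasDerivAt (gPartial lam s N) (gPartialDeriv lam s N u) u := by
  have h1 : HasDerivAt (gPartial lam s N) (∑ n ∈ Finset.range N, (gCoeff lam n).eval s *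
      (-(d : ℂ) * leadingTerm d (kappa lam - 1 - n + d / 2 * s) u
        + (kappa lam - 1 - n + d / 2 * s)
          * leadingTerm d (kappa lam - 1 - n + d / 2 * s - 1) u)) u := by
    unfold gPartial
    exact HasDerivAt.fun_sum fun n _ => (hasDerivAt_leadingTerm d _ hu).const_mul _
  refine h1.congr_deriv ?_
  set L : ℕ → ℂ := fun n => leadingTerm d (kappa lam - 1 - n + d / 2 * s) u with hL
  have h2 := Finset.sum_range_sub (fun n => remCoeff lam s n * L n) N
  have h3 : remCoeff lam s 0 * L 0 = 0 := by simp [remCoeff]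
  rw [h3, sub_zero] at h2
  rw [gPartialDeriv, eq_sub_iff_add_eq, ← Finset.sum_add_distrib]
  refine Eq.trans (Finset.sum_congr rfl fun n _ => ?_) h2
  have h4 : leadingTerm d (kappa lam - 1 - n + d / 2 * s - 1) u = L (n + 1) := by
    simp only [hL]
    congr 1
    push_cast
    ring
  rw [h4, mul_phiCoeff_eq hd lam n s]
  simp only [hL, remCoeff]
  ring

/-- The integrand of `G` plus the derivative of `gPartial` is smaller than the leading term by `N`
powers of `u`, and the integral of such a tail has the size of its integrand at `t`. All constants
depend on `s` only through `R`, as needed for Cauchy's inequalities. -/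
lemma exists_G_sub_bound {d : ℕ} (hd : 1 ≤ d) (lam : Fin d → ℂ) {σ : ℝ}
    (hσ : ∀ j, 0 < σ + (lam j).re) (N : ℕ) (R : ℝ) :
    ∃ K T : ℝ, 0 ≤ K ∧ 1 ≤ T ∧ ∀ t : ℝ, T ≤ t → ∀ s : ℂ, ‖s‖ ≤ R →
      ‖G lam σ s (t ^ ((d : ℝ) / 2)) - ∑ n ∈ Finset.range N,
        (gCoeff lam n).eval s * leadingTerm d (kappa lam - 1 - n) t‖
      ≤ K * (t ^ ((kappa lam).re - 1 - N) * Real.exp (-(d * t))) := by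
  have hd0 : (0 : ℝ) < d := by exact_mod_cast hd
  obtain ⟨K₁, T₁, hK₁, hT₁, h₁⟩ := exists_phi_sub_bound hd lam hσ N
  obtain ⟨K₀, T₀, hK₀, hT₀, h₀⟩ := exists_phi_sub_bound hd lam hσ 0
  obtain ⟨Q, hQ⟩ := (isCompact_closedBall (0 : ℂ) R).exists_bound_of_continuousOn
    (continuous_remCoeff lam N).continuousOn
  set K₂ : ℝ := d / 2 * K₁ + |Q| * asympConst d with hK₂
  have hac := (asympConst_pos hd).le
  -- A bound for all exponents of `u` that occur, valid for every `s` in the disc, so one threshold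
  -- for `t` serves them all.
  set E : ℝ := |(kappa lam).re| + 1 + N + d / 2 * |R| with hE
  refine ⟨2 * K₂, max (max T₁ T₀) (2 * E), by positivity,
    hT₁.trans ((le_max_left _ _).trans (le_max_left _ _)), fun t ht s hs => ?_⟩
  have htT₁ : T₁ ≤ t := (le_max_left _ _).trans ((le_max_left _ _).trans ht)
  have htT₀ : T₀ ≤ t := (le_max_right _ _).trans ((le_max_left _ _).trans ht)
  have htE : 2 * E ≤ t := (le_max_right _ _).trans ht
  have ht0 : 0 < t := by linarith
  have htC : (t : ℂ) ≠ 0 := by exact_mod_cast ht0.ne'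
  set a : ℂ := d / 2 * s with ha
  have hare : |a.re| ≤ d / 2 * |R| := by
    refine (Complex.abs_re_le_norm a).trans ?_
    have : ‖(d / 2 : ℂ)‖ = d / 2 := by simp
    rw [ha, norm_mul, this]
    have := hs.trans (le_abs_self R)
    gcongr
  have habs : ∀ x : ℝ, |x| ≤ 1 + N → |(kappa lam).re + x + a.re| ≤ E := by
    intro x hx
    refine (abs_add_le _ _).trans ?_
    have := abs_add_le (kappa lam).re x
    linarith
  have hNn : (0 : ℝ) ≤ N := Nat.cast_nonneg N
  have hcontL : ∀ α : ℂ, ContinuousOn (leadingTerm d α) (Set.Ioi t) := fun α u hu =>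
    (continuousAt_leadingTerm d α (ht0.trans hu)).continuousWithinAt
  have hcontF : ContinuousOn (fun u : ℝ => (d / 2 : ℂ) * ((u : ℂ) ^ (a - 1)
      * phi lam σ (u ^ ((d : ℝ) / 2)))) (Set.Ioi t) := by
    refine continuousOn_const.mul (ContinuousOn.mul ?_ ?_)
    · intro u hu
      exact (ContinuousAt.comp (f := fun u : ℝ => (u : ℂ))
        (continuousAt_cpow_const (Complex.ofReal_mem_slitPlane.mpr (ht0.trans hu)))
        Complex.continuous_ofReal.continuousAt).continuousWithinAt
    · refine (continuousOn_phi hd lam hσ).comp (fun u hu => ?_) fun u hu => ?_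
      · exact (Real.continuousAt_rpow_const _ _
          (Or.inl (ht0.trans hu).ne')).continuousWithinAt
      · exact Real.rpow_pos_of_pos (ht0.trans hu) _
  have hcontD : ContinuousOn (gPartialDeriv lam s N) (Set.Ioi t) :=
    (continuousOn_const.mul (hcontL _)).sub
      (continuousOn_finsetSum _ fun n _ => continuousOn_const.mul (hcontL _))
  have hnormpow : ∀ u : ℝ, 0 < u → ∀ x : ℝ, ‖(d / 2 : ℂ) * (u : ℂ) ^ (a - 1)‖
      * u ^ ((kappa lam).re - x) = d / 2 * u ^ ((kappa lam).re + (-1 - x) + a.re) := by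
    intro u hu x
    have h2 : ‖(d / 2 : ℂ)‖ = d / 2 := by simp
    rw [norm_mul, h2, Complex.norm_cpow_eq_rpow_re_of_pos hu, mul_assoc, ← Real.rpow_add hu]
    congr 2
    simp
    ring
  -- integrability of the integrand of `G`
  have hF := (integrableOn_and_norm_integral_le (e := (kappa lam).re + (-1 - 0) + a.re)
    (K := d / 2 * K₀) hd (habs _ (by norm_num)) ht0 htE hcontF (by
      intro u hu
      have hu0 : 0 < u := ht0.trans_le hu
      have h2 := h₀ u (htT₀.trans hu)
      simp only [Finset.range_zero, Finset.sum_empty, sub_zero, Nat.cast_zero] at h2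
      rw [← mul_assoc, norm_mul]
      calc _ ≤ ‖(d / 2 : ℂ) * (u : ℂ) ^ (a - 1)‖ * (K₀ * (u ^ (kappa lam).re
            * Real.exp (-(d * u)))) := mul_le_mul_of_nonneg_left h2 (norm_nonneg _)
        _ = K₀ * (‖(d / 2 : ℂ) * (u : ℂ) ^ (a - 1)‖ * u ^ ((kappa lam).re - 0))
            * Real.exp (-(d * u)) := by rw [sub_zero]; ring
        _ = _ := by rw [hnormpow u hu0]; ring)).1
  -- the difference of the integrands
  have hdiff := integrableOn_and_norm_integral_le (e := (kappa lam).re + (-1 - N) + a.re)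
    (K := K₂) hd (habs _ (by rw [abs_le]; constructor <;> linarith)) ht0 htE
    (hcontF.add hcontD) (by
      intro u hu
      have hu0 : 0 < u := ht0.trans_le hu
      have h2 := h₁ u (htT₁.trans hu)
      have e1 : (d / 2 : ℂ) * ((u : ℂ) ^ (a - 1) * phi lam σ (u ^ ((d : ℝ) / 2)))
          + gPartialDeriv lam s N u
          = (d / 2 : ℂ) * (u : ℂ) ^ (a - 1) * (phi lam σ (u ^ ((d : ℝ) / 2))
            - ∑ n ∈ Finset.range N, (2 * phiCoeff lam n) * leadingTerm d (kappa lam - n) u)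
          + remCoeff lam s N * leadingTerm d (kappa lam - 1 - N + a) u := by
        have e2 : ∀ n ∈ Finset.range N,
            (d : ℂ) * phiCoeff lam n * leadingTerm d (kappa lam - 1 - n + a) u
            = (d / 2 : ℂ) * (u : ℂ) ^ (a - 1)
              * ((2 * phiCoeff lam n) * leadingTerm d (kappa lam - n) u) := by
          intro n _
          rw [show kappa lam - 1 - n + a = (kappa lam - n) + (a - 1) by ring,
            ← cpow_mul_leadingTerm d _ _ hu0]
          ring
        rw [gPartialDeriv, Finset.sum_congr rfl e2, ← Finset.mul_sum]
        ring
      simp only [Pi.add_apply]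
      rw [e1]
      refine (norm_add_le _ _).trans ?_
      rw [norm_mul, norm_mul (remCoeff lam s N), norm_leadingTerm hd _ hu0, hK₂, add_mul]
      refine add_le_add ?_ ?_
      · calc _ ≤ ‖(d / 2 : ℂ) * (u : ℂ) ^ (a - 1)‖ * (K₁ * (u ^ ((kappa lam).re - N)
              * Real.exp (-(d * u)))) := mul_le_mul_of_nonneg_left h2 (norm_nonneg _)
          _ = K₁ * (‖(d / 2 : ℂ) * (u : ℂ) ^ (a - 1)‖ * u ^ ((kappa lam).re - N))
              * Real.exp (-(d * u)) := by ring
          _ = _ := by rw [hnormpow u hu0]; ring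
      · have e3 : (kappa lam - 1 - N + a).re = (kappa lam).re + (-1 - N) + a.re := by
          simp
          ring
        rw [e3, mul_assoc |Q|]
        refine mul_le_mul_of_nonneg_right ?_ (by positivity)
        exact (hQ s (by simpa using hs)).trans (le_abs_self Q))
  have hDint : IntegrableOn (gPartialDeriv lam s N) (Set.Ioi t) := by
    refine (hdiff.1.sub hF).congr (Eventually.of_forall fun u => ?_)
    simp
  -- The leading terms vanish at infinity, so only the lower endpoint contributes.
  have hFTC : ∫ u in Set.Ioi t, gPartialDeriv lam s N u = 0 - gPartial lam s N t := by
    refine integral_Ioi_of_hasDerivAt_of_tendsto'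
      (fun u hu => hasDerivAt_gPartial hd lam s N (ht0.trans_le hu)) hDint ?_
    have := tendsto_finsetSum (Finset.range N) fun n _ =>
      (tendsto_leadingTerm hd (kappa lam - 1 - n + a)).const_mul ((gCoeff lam n).eval s)
    simp only [mul_zero, Finset.sum_const_zero] at this
    exact this
  have hkey : G lam σ s (t ^ ((d : ℝ) / 2)) - ∑ n ∈ Finset.range N,
        (gCoeff lam n).eval s * leadingTerm d (kappa lam - 1 - n) t
      = (t : ℂ) ^ (-a) * ∫ u in Set.Ioi t, ((fun u : ℝ => (d / 2 : ℂ) * ((u : ℂ) ^ (a - 1)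
        * phi lam σ (u ^ ((d : ℝ) / 2)))) + gPartialDeriv lam s N) u := by
    simp only [Pi.add_apply]
    rw [integral_add hF hDint, hFTC, mul_add, ← G_comp_rpow hd lam σ s ht0, sub_eq_add_neg,
      zero_sub, mul_neg, gPartial, Finset.mul_sum]
    congr 2
    refine Finset.sum_congr rfl fun n _ => ?_
    rw [← ha, mul_left_comm, cpow_mul_leadingTerm d _ _ ht0, add_neg_cancel_right]
  rw [hkey, norm_mul, Complex.norm_cpow_eq_rpow_re_of_pos ht0, Complex.neg_re]
  refine (mul_le_mul_of_nonneg_left hdiff.2 (by positivity)).trans (le_of_eq ?_)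
  have e4 : t ^ (-a.re) * t ^ ((kappa lam).re + (-1 - N) + a.re)
      = t ^ ((kappa lam).re - 1 - N) := by
    rw [← Real.rpow_add ht0]
    congr 1
    ring
  rw [← e4]
  ring

/-! ### Asymptotic expansions -/

lemma leadingTerm_ne_zero {d : ℕ} (hd : 1 ≤ d) (α : ℂ) {t : ℝ} (ht : 0 < t) :
    leadingTerm d α t ≠ 0 := by
  rw [← norm_pos_iff, norm_leadingTerm hd α ht]
  have := asympConst_pos hd
  positivity

lemma leadingTerm_mul_zpow (d : ℕ) (α : ℂ) (n : ℕ) {t : ℝ} (ht : 0 < t) :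
    leadingTerm d α t * (t : ℂ) ^ (-(n : ℤ)) = leadingTerm d (α - n) t := by
  rw [sub_eq_add_neg, ← cpow_mul_leadingTerm d α _ ht, Complex.cpow_neg, Complex.cpow_natCast,
    zpow_neg, zpow_natCast, mul_comm]

lemma hasAsymptoticExpansion_of_bound {d : ℕ} (hd : 1 ≤ d) {f g : ℝ → ℂ} {c α : ℂ} {a : ℕ → ℂ}
    (hc : c ≠ 0) (hg : ∀ t, g t = c * leadingTerm d α t)
    (h : ∀ N : ℕ, ∃ K T : ℝ, ∀ t : ℝ, T ≤ t →
      ‖f t - ∑ n ∈ Finset.range N, c * a n * leadingTerm d (α - n) t‖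
        ≤ K * (t ^ (α.re - N) * Real.exp (-(d * t)))) :
    HasAsymptoticExpansion f g a := by
  intro N
  obtain ⟨K, T, hK⟩ := h N
  have hA := asympConst_pos hd
  have hcn : 0 < ‖c‖ := norm_pos_iff.mpr hc
  refine IsBigO.of_bound (K / (‖c‖ * asympConst d)) ?_
  filter_upwards [eventually_ge_atTop T, eventually_gt_atTop 0] with t htT ht
  have e1 : g t * ∑ n ∈ Finset.range N, a n * (t : ℂ) ^ (-(n : ℤ))
      = ∑ n ∈ Finset.range N, c * a n * leadingTerm d (α - n) t := by
    rw [Finset.mul_sum]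
    refine Finset.sum_congr rfl fun n _ => ?_
    rw [← leadingTerm_mul_zpow d α n ht, hg]
    ring
  have e2 : ‖g t * (t : ℂ) ^ (-(N : ℤ))‖
      = ‖c‖ * (asympConst d * (t ^ (α.re - N) * Real.exp (-(d * t)))) := by
    rw [hg, mul_assoc, leadingTerm_mul_zpow d α N ht, norm_mul, norm_leadingTerm hd _ ht]
    simp
  rw [e1, e2]
  refine (hK t htT).trans (le_of_eq ?_)
  field_simp

/-- If the coefficients agree below `N`, subtracting the two expansions of order `N + 1` and
dividing by `g t^{-N}` gives `|a_N - b_N| = O(1/t)`. -/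
lemma HasAsymptoticExpansion.unique {f g : ℝ → ℂ} {a b : ℕ → ℂ}
    (ha : HasAsymptoticExpansion f g a) (hb : HasAsymptoticExpansion f g b)
    (hg : ∀ᶠ t in atTop, g t ≠ 0) (n : ℕ) : a n = b n := by
  induction n using Nat.strong_induction_on with
  | _ N ih =>
    obtain ⟨C, hC⟩ := ((hb (N + 1)).sub (ha (N + 1))).bound
    have hle : ∀ᶠ t : ℝ in atTop, ‖a N - b N‖ ≤ C * t⁻¹ := by
      filter_upwards [hC, hg, eventually_gt_atTop 0] with t h1 h2 h3
      have htC : (t : ℂ) ≠ 0 := by exact_mod_cast h3.ne'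
      rw [sub_sub_sub_cancel_left, ← mul_sub, ← Finset.sum_sub_distrib,
        Finset.sum_range_succ, Finset.sum_eq_zero (fun n hn => by
          rw [ih n (Finset.mem_range.mp hn), sub_self]), zero_add, ← sub_mul, norm_mul, norm_mul,
        norm_mul, mul_left_comm C] at h1
      have h4 := le_of_mul_le_mul_left h1 (norm_pos_iff.mpr h2)
      have h5 : (t : ℂ) ^ (-((N + 1 : ℕ) : ℤ)) = (t : ℂ) ^ (-(N : ℤ)) * (t : ℂ)⁻¹ := by
        rw [← zpow_sub_one₀ htC]
        congr 1
        push_cast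
        ring
      have h6 : 0 < ‖(t : ℂ) ^ (-(N : ℤ))‖ := norm_pos_iff.mpr (zpow_ne_zero _ htC)
      rw [h5, norm_mul, mul_left_comm C, mul_comm ‖a N - b N‖] at h4
      have h7 := le_of_mul_le_mul_left h4 h6
      rwa [norm_inv, Complex.norm_real, Real.norm_eq_abs, abs_of_pos h3] at h7
    have hlim : Tendsto (fun t : ℝ => C * t⁻¹) atTop (𝓝 0) := by
      simpa using tendsto_inv_atTop_zero.const_mul C
    have h0 : ‖a N - b N‖ ≤ 0 := ge_of_tendsto hlim hle
    exact sub_eq_zero.mp (norm_le_zero_iff.mp h0)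

lemma eventually_leadingTerm_ne_zero {d : ℕ} (hd : 1 ≤ d) (α : ℂ) :
    ∀ᶠ t in atTop, leadingTerm d α t ≠ 0 := by
  filter_upwards [eventually_gt_atTop 0] with t ht
  exact leadingTerm_ne_zero hd α ht

lemma hasAsymptoticExpansion_phi {d : ℕ} (hd : 1 ≤ d) (lam : Fin d → ℂ) {σ : ℝ}
    (hσ : ∀ j, 0 < σ + (lam j).re) :
    HasAsymptoticExpansion (fun t => phi lam σ (t ^ ((d : ℝ) / 2)))
      (fun t => 2 * leadingTerm d (kappa lam) t) (phiCoeff lam) := by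
  refine hasAsymptoticExpansion_of_bound hd two_ne_zero (fun t => rfl) fun N => ?_
  obtain ⟨K, T, -, -, h⟩ := exists_phi_sub_bound hd lam hσ N
  exact ⟨K, T, h⟩

/-! ### Derivatives with respect to `s`. -/

lemma iteratedDeriv_polynomial_eval (P : Polynomial ℂ) (k : ℕ) :
    iteratedDeriv k (fun s => P.eval s) = fun s => (Polynomial.derivative^[k] P).eval s := by
  induction k with
  | zero => simp
  | succ k ih =>
    rw [iteratedDeriv_succ, ih, Function.iterate_succ_apply']
    funext s
    exact Polynomial.deriv _

/-- The remainder after `N + k` terms is entire in `s` and uniformly small on the unit circle around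
`s`, so Cauchy's inequality bounds its `k`-th derivative. The first `k` terms are polynomials of
degree less than `k` and disappear, which shifts the index by `k`. -/
lemma hasAsymptoticExpansion_iteratedDeriv_G {d : ℕ} (hd : 1 ≤ d) (lam : Fin d → ℂ) {σ : ℝ}
    (hσ : ∀ j, 0 < σ + (lam j).re) (k : ℕ) (s : ℂ) :
    HasAsymptoticExpansion
      (fun t => iteratedDeriv k (fun z => G lam σ z (t ^ ((d : ℝ) / 2))) s)
      (leadingTerm d (kappa lam - 1 - (k : ℂ)))
      (fun n => iteratedDeriv k (fun z => (gCoeff lam (n + k)).eval z) s) := by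
  refine hasAsymptoticExpansion_of_bound hd one_ne_zero (fun t => (one_mul _).symm) fun N => ?_
  obtain ⟨K, T, hK, hT, h⟩ := exists_G_sub_bound hd lam hσ (N + k) (‖s‖ + 1)
  refine ⟨k.factorial * K, T, fun t ht => ?_⟩
  have ht0 : 0 < t := by linarith
  have hGd := differentiable_G hd lam hσ (Real.rpow_pos_of_pos ht0 ((d : ℝ) / 2))
  set S : ℂ → ℂ := fun z => ∑ n ∈ Finset.range (N + k),
    (gCoeff lam n).eval z * leadingTerm d (kappa lam - 1 - n) t with hS
  have hterm : ∀ n, Differentiable ℂ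
      fun z => (gCoeff lam n).eval z * leadingTerm d (kappa lam - 1 - n) t :=
    fun n => (gCoeff lam n).differentiable.mul_const _
  have hSd : Differentiable ℂ S := Differentiable.fun_sum fun n _ => hterm n
  have hcauchy := Complex.norm_iteratedDeriv_le_of_forall_mem_sphere_norm_le k (c := s)
    (R := 1) one_pos (hGd.sub hSd).diffContOnCl
    (C := K * (t ^ ((kappa lam).re - 1 - (N + k : ℕ)) * Real.exp (-(d * t)))) (by
      intro z hz
      refine h t ht z ?_
      have h1 : ‖z - s‖ = 1 := mem_sphere_iff_norm.mp hz
      have h2 := norm_add_le s (z - s)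
      rw [add_sub_cancel] at h2
      linarith)
  rw [iteratedDeriv_sub hGd.contDiff.contDiffAt hSd.contDiff.contDiffAt] at hcauchy
  have hSk : iteratedDeriv k S s = ∑ n ∈ Finset.range N,
      1 * iteratedDeriv k (fun z => (gCoeff lam (n + k)).eval z) s
        * leadingTerm d (kappa lam - 1 - k - n) t := by
    rw [hS, iteratedDeriv_fun_sum fun n _ => (hterm n).contDiff.contDiffAt, add_comm N k,
      Finset.sum_range_add, Finset.sum_eq_zero, zero_add]
    · refine Finset.sum_congr rfl fun n _ => ?_
      rw [iteratedDeriv_mul_const_field, one_mul, add_comm k n]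
      congr 2
      push_cast
      ring
    · intro n hn
      rw [iteratedDeriv_mul_const_field, iteratedDeriv_polynomial_eval,
        Polynomial.iterate_derivative_eq_zero]
      · simp
      · rw [(gCoeff_natDegree_leadingCoeff lam n).1]
        exact Finset.mem_range.mp hn
  rw [hSk] at hcauchy
  refine hcauchy.trans (le_of_eq ?_)
  have e : (kappa lam).re - 1 - (N + k : ℕ) = (kappa lam - 1 - k : ℂ).re - N := by
    simp
    ring
  rw [e, one_pow, div_one, mul_assoc]

lemma hasAsymptoticExpansion_G {d : ℕ} (hd : 1 ≤ d) (lam : Fin d → ℂ) {σ : ℝ}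
    (hσ : ∀ j, 0 < σ + (lam j).re) (s : ℂ) :
    HasAsymptoticExpansion (fun t => G lam σ s (t ^ ((d : ℝ) / 2)))
      (leadingTerm d (kappa lam - 1)) (fun n => (gCoeff lam n).eval s) := by
  simpa using hasAsymptoticExpansion_iteratedDeriv_G hd lam hσ 0 s

/-! ### Recursions for integer-indexed coefficient sequences. -/

lemma sum_Icc_mul_int_sub {d n : ℕ} {F : ℕ → ℂ} {M : ℤ → ℂ} (hF : ∀ p, d < p → F p = 0)
    (hM : ∀ m : ℤ, m < 0 → M m = 0) :
    ∑ p ∈ Finset.Icc 1 d, F p * M ((n : ℤ) - (p : ℤ))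
      = ∑ i ∈ Finset.range n, F (n - i) * M i := by
  -- Both ranges are compared with `1 ≤ p ≤ d + n`: beyond `d` the factor `F` vanishes, beyond `n`
  -- the factor `M` does.
  have h1 : ∑ p ∈ Finset.Icc 1 d, F p * M ((n : ℤ) - (p : ℤ))
      = ∑ p ∈ Finset.Icc 1 (d + n), F p * M ((n : ℤ) - (p : ℤ)) := by
    refine Finset.sum_subset (Finset.Icc_subset_Icc_right (by omega)) fun p hp hp' => ?_
    simp only [Finset.mem_Icc] at hp hp'
    rw [hF p (by omega), zero_mul]
  have h2 : ∑ p ∈ Finset.Icc 1 n, F p * M ((n : ℤ) - (p : ℤ))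
      = ∑ p ∈ Finset.Icc 1 (d + n), F p * M ((n : ℤ) - (p : ℤ)) := by
    refine Finset.sum_subset (Finset.Icc_subset_Icc_right (by omega)) fun p hp hp' => ?_
    simp only [Finset.mem_Icc] at hp hp'
    rw [hM _ (by omega), mul_zero]
  rw [h1, ← h2]
  refine Finset.sum_nbij' (fun p => n - p) (fun i => n - i) ?_ ?_ ?_ ?_ ?_
  · intro p hp
    simp only [Finset.mem_Icc, Finset.mem_range] at hp ⊢
    omega
  · intro i hi
    simp only [Finset.mem_Icc, Finset.mem_range] at hi ⊢
    omega
  · intro p hp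
    simp only [Finset.mem_Icc] at hp
    omega
  · intro i hi
    simp only [Finset.mem_range] at hi
    omega
  · intro p hp
    simp only [Finset.mem_Icc] at hp
    rw [Nat.sub_sub_self hp.2, Nat.cast_sub hp.2]

lemma IsPhiCoeff.eq_phiCoeff {d : ℕ} (hd : 1 ≤ d) {lam : Fin d → ℂ} {σ : ℝ}
    (hσ : ∀ j, 0 < σ + (lam j).re) {M : ℤ → ℂ} (hM : IsPhiCoeff lam σ M) (n : ℕ) :
    M n = phiCoeff lam n := by
  refine hM.2.unique (hasAsymptoticExpansion_phi hd lam hσ) ?_ n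
  filter_upwards [eventually_leadingTerm_ne_zero hd (kappa lam)] with t ht
  exact mul_ne_zero two_ne_zero ht

lemma IsGCoeff.eq_gCoeff {d : ℕ} (hd : 1 ≤ d) {lam : Fin d → ℂ} {σ : ℝ}
    (hσ : ∀ j, 0 < σ + (lam j).re) {μ : ℤ → ℂ → ℂ} (hμ : IsGCoeff lam σ μ) (n : ℕ) (s : ℂ) :
    μ n s = (gCoeff lam n).eval s :=
  (hμ.2 s).unique (hasAsymptoticExpansion_G hd lam hσ s)
    (eventually_leadingTerm_ne_zero hd (kappa lam - 1)) n

lemma exists_isPhiCoeff {d : ℕ} (hd : 1 ≤ d) (lam : Fin d → ℂ) {σ : ℝ}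
    (hσ : ∀ j, 0 < σ + (lam j).re) : ∃ M : ℤ → ℂ, IsPhiCoeff lam σ M := by
  refine ⟨fun n => if n < 0 then 0 else phiCoeff lam n.toNat, fun n hn => if_pos hn, ?_⟩
  convert hasAsymptoticExpansion_phi hd lam hσ using 2 with n
  beta_reduce
  rw [if_neg (by omega), Int.toNat_natCast]

lemma exists_isGCoeff {d : ℕ} (hd : 1 ≤ d) (lam : Fin d → ℂ) {σ : ℝ}
    (hσ : ∀ j, 0 < σ + (lam j).re) : ∃ μ : ℤ → ℂ → ℂ, IsGCoeff lam σ μ := by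
  refine ⟨fun n s => if n < 0 then 0 else (gCoeff lam n.toNat).eval s,
    fun n hn s => if_pos hn, fun s => ?_⟩
  convert hasAsymptoticExpansion_G hd lam hσ s using 2 with n
  beta_reduce
  rw [if_neg (by omega), Int.toNat_natCast]

lemma IsPhiCoeff.recursion {d : ℕ} (hd : 1 ≤ d) {lam : Fin d → ℂ} {σ : ℝ}
    (hσ : ∀ j, 0 < σ + (lam j).re) {M : ℤ → ℂ} (hM : IsPhiCoeff lam σ M) (n : ℕ) (hn : 1 ≤ n) :
    M n = 1 / (n : ℂ) * ∑ p ∈ Finset.Icc 1 d,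
      (nu lam (p + 1)).eval (n : ℂ) * M ((n : ℤ) - (p : ℤ)) := by
  rw [sum_Icc_mul_int_sub (F := fun p => (nu lam (p + 1)).eval (n : ℂ))
    (fun p hp => by rw [nu_eq_zero_of_lt lam (by omega), Polynomial.eval_zero]) hM.1]
  simp_rw [hM.eq_phiCoeff hd hσ]
  exact phiCoeff_recursion hd lam n hn

lemma IsGCoeff.recursion {d : ℕ} (hd : 1 ≤ d) {lam : Fin d → ℂ} {σ : ℝ}
    (hσ : ∀ j, 0 < σ + (lam j).re) {μ : ℤ → ℂ → ℂ} (hμ : IsGCoeff lam σ μ) (s : ℂ) (n : ℕ)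
    (hn : 1 ≤ n) :
    μ n s = 1 / (n : ℂ) * ∑ p ∈ Finset.Icc 1 d, ((nu lam (p + 1)).eval (n : ℂ)
      - (symS lam 1 + (d : ℂ) * (s - 1) - 2 * ((n : ℂ) - (p : ℂ)) - 1)
        / (2 * (d : ℂ)) * (nu lam p).eval (n : ℂ)) * μ ((n : ℤ) - (p : ℤ)) s := by
  rw [sum_Icc_mul_int_sub (F := fun p => (nu lam (p + 1)).eval (n : ℂ)
      - (symS lam 1 + (d : ℂ) * (s - 1) - 2 * ((n : ℂ) - (p : ℂ)) - 1)
        / (2 * (d : ℂ)) * (nu lam p).eval (n : ℂ)) (M := fun m => μ m s)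
    (fun p hp => by
      rw [nu_eq_zero_of_lt lam (by omega), nu_eq_zero_of_lt lam hp]
      simp) (fun m hm => hμ.1 m hm s)]
  simp_rw [hμ.eq_gCoeff hd hσ]
  rw [gCoeff_recursion hd lam n hn s]
  congr 1
  refine Finset.sum_congr rfl fun i hi => ?_
  have hin : i ≤ n := (Finset.mem_range.mp hi).le
  rw [Nat.cast_sub hin, sub_sub_cancel]

end MotivicL

theorem mainTheorem4 (d : ℕ) (hd : 1 ≤ d) (lam : Fin d → ℂ) (σ : ℝ)
    (hσ : ∀ j, 0 < σ + (lam j).re) :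
    -- the expansion of `φ`: existence, and the recursion for its coefficients
    (∃ M : ℤ → ℂ, MotivicL.IsPhiCoeff lam σ M) ∧
    (∀ M : ℤ → ℂ, MotivicL.IsPhiCoeff lam σ M →
      M 0 = 1 ∧
      ∀ n : ℤ, 1 ≤ n →
        M n = 1 / (n : ℂ) * ∑ p ∈ Finset.Icc 1 d,
          (MotivicL.nu lam (p + 1)).eval (n : ℂ) * M (n - (p : ℤ))) ∧
    -- `G_s(t)` is given by a convergent integral and is entire in `s`
    (∀ t : ℝ, 0 < t →
      (∀ s : ℂ, MeasureTheory.IntegrableOn (MotivicL.incompleteIntegrand lam σ s)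
        (Set.Ioi t)) ∧
      Differentiable ℂ (fun s : ℂ => MotivicL.G lam σ s t)) ∧
    -- the expansion of `G_s`: existence, recursion, polynomiality, and the `s`-derivatives
    (∃ μ : ℤ → ℂ → ℂ, MotivicL.IsGCoeff lam σ μ) ∧
    (∀ μ : ℤ → ℂ → ℂ, MotivicL.IsGCoeff lam σ μ →
      (∀ s : ℂ, μ 0 s = 1 ∧
        ∀ n : ℤ, 1 ≤ n →
          μ n s = 1 / (n : ℂ) * ∑ p ∈ Finset.Icc 1 d,
            ((MotivicL.nu lam (p + 1)).eval (n : ℂ)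
              - (MotivicL.symS lam 1 + (d : ℂ) * (s - 1) - 2 * ((n : ℂ) - (p : ℂ)) - 1)
                  / (2 * (d : ℂ)) * (MotivicL.nu lam p).eval (n : ℂ))
              * μ (n - (p : ℤ)) s) ∧
      (∀ n : ℕ, ∃ P : Polynomial ℂ, (∀ s : ℂ, μ n s = P.eval s) ∧
        P.natDegree = n ∧ P.leadingCoeff = (2 : ℂ)⁻¹ ^ n) ∧
      (∀ (k : ℕ) (s : ℂ),
        MotivicL.HasAsymptoticExpansion
          (fun t => iteratedDeriv k (fun z => MotivicL.G lam σ z (t ^ ((d : ℝ) / 2))) s)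
          (MotivicL.leadingTerm d (MotivicL.kappa lam - 1 - (k : ℂ)))
          (fun n => iteratedDeriv k (μ ((n : ℤ) + (k : ℤ))) s))) := by
  refine ⟨MotivicL.exists_isPhiCoeff hd lam hσ, fun M hM => ⟨?_, fun n hn => ?_⟩,
    fun t ht => ⟨MotivicL.integrableOn_incompleteIntegrand hd lam hσ ht,
      MotivicL.differentiable_G hd lam hσ ht⟩,
    MotivicL.exists_isGCoeff hd lam hσ,
    fun μ hμ => ⟨fun s => ⟨?_, fun n hn => ?_⟩, fun n => ?_, fun k s => ?_⟩⟩
  · have := hM.eq_phiCoeff hd hσ 0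
    simpa [MotivicL.phiCoeff] using this
  · obtain ⟨m, rfl⟩ := Int.eq_ofNat_of_zero_le (by omega : 0 ≤ n)
    simpa using hM.recursion hd hσ m (by omega)
  · have := hμ.eq_gCoeff hd hσ 0 s
    simpa [MotivicL.gCoeff] using this
  · obtain ⟨m, rfl⟩ := Int.eq_ofNat_of_zero_le (by omega : 0 ≤ n)
    simpa using hμ.recursion hd hσ s m (by omega)
  · exact ⟨MotivicL.gCoeff lam n, hμ.eq_gCoeff hd hσ n,
      MotivicL.gCoeff_natDegree_leadingCoeff lam n⟩
  · have h := MotivicL.hasAsymptoticExpansion_iteratedDeriv_G hd lam hσ k s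
    have e : ∀ n : ℕ, μ ((n : ℤ) + (k : ℤ)) = fun z => (MotivicL.gCoeff lam (n + k)).eval z := by
      intro n
      funext z
      exact_mod_cast hμ.eq_gCoeff hd hσ (n + k) z
    simp_rw [e]
    exact h
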